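/- Let $\Bbbk$ be an algebraically closed field of characteristic zero, let $\mathcal C$ be a fusion category over $\Bbbk$ with associativity $\alpha$ and unit constraints $\ell,r$, let $(G,\Gamma,\blacktriangleright,\blacktriangleleft)$ be a matched pair of finite groups, and let a $(G,\Gamma)$-crossed action on $\mathcal C$ be given: a faithful grading $\mathcal C=\bigoplus_{k\in\Gamma}\mathcal C_k$, a right action of $G$ on $\mathcal C$ by $\Bbbk$-linear functors $-\triangleleft g$, with $\mathcal C_k\triangleleft g\subseteq\mathcal C_{k\blacktriangleleft g}$ and constraints $\mathbf R^2_{g,h}\colon(-\triangleleft g)\triangleleft h\to-\triangleleft gh$, $\mathbf R^0\colon\mathrm{id}\to-\triangleleft e$, and natural isomorphisms $\eta^g_{X,Y}\colon(X\otimes Y)\triangleleft g\to X\triangleleft(k\blacktriangleright g)\otimes Y\triangleleft g$ (for $Y\in\mathcal C_k$) and $\eta^g_0\colon\mathbf 1\triangleleft g\to\mathbf 1$, subject to the usual coherence conditions with $\alpha,\ell,r,\mathbf R^2,\mathbf R^0$. All constructions below that are written for homogeneous objects are extended additively. **Categories.** $\mathcal C^{(G,\Gamma)}$ is the $\Bbbk$-linear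 monoidal category of equivariant objects $(X,\{u_g\colon X\triangleleft g\xrightarrow{\sim}X\}_{g\in G})$, $u_{gh}\mathbf R^2_{g,h}=u_h(u_g\triangleleft h)$, with tensor product $X\otimes Y$ equipped with the isomorphisms $(u_{k\blacktriangleright g}\otimes u_g)\eta^g$ on the summand $(X\otimes Y_k)\triangleleft g$, and with unit $(\mathbf 1,\{\eta_0^g\})$. $\mathcal B=\operatorname{vec}_G\bowtie\mathcal C$ is the bicrossed product: $\operatorname{vec}_G\boxtimes\mathcal C$ with $(g\bowtie X)\otimes(g'\bowtie X')=g(k\blacktriangleright g')\bowtie(X\triangleleft g'\otimes X')$ for $X\in\mathcal C_k$. It acts on $\mathcal C$ from the right by $M\,\bar\otimes\,(g\bowtie X)=M\triangleleft g\otimes X$, with associativity constraint $((\eta^{g'}_{M\triangleleft g,X})^{-1}\otimes\mathrm{id})((\mathbf R^2_{g,k\blacktriangleright g'})_M^{-1}\otimes\mathrm{id}\otimes\mathrm{id})\alpha^{-1}$ and unit constraint $r_M((\mathbf R^0_M)^{-1}\otimes\mathrm{id})$. $\mathcal B^*_{\mathcal C}$ is the category of $\Bbbk$-linear $\mathcal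 B$-module endofunctors $(\mathbf F,s)$ of $\mathcal C$, with tensor product $\mathbf F\otimes\mathbf F'=\mathbf F\circ\mathbf F'$. **Functors.** Let $\operatorname{can}\colon\operatorname{vec}\to\mathcal C$, $\operatorname{can}(V)=\bigoplus_{i=1}^{\dim V}\mathbf 1$, and let $\operatorname{Rep}G$ be the category of finite-dimensional left representations of $G$, with its forgetful functor $\omega\colon\operatorname{Rep}G\to\operatorname{vec}$. Consider the tensor functors * $\iota_1\colon\operatorname{Rep}G\to\mathcal C^{(G,\Gamma)}$, $\iota_1(V,\rho)=(\operatorname{can}(V),\{\operatorname{can}(\rho(g)^{-1})\,(\bigoplus_{i=1}^{\dim V}\eta_0^g)\}_{g\in G})$, and the forgetful functor $\mathbf F_1\colon\mathcal C^{(G,\Gamma)}\to\mathcal C$; * $\iota_2\colon\operatorname{Rep}G\to\mathcal B^*_{\mathcal C}$, $\iota_2(V,\rho)=(\operatorname{can}(V)\otimes-,s)$, where, for $M\in\mathcal C_k$, $s_{M,g\bowtie X}$ is $$\big((\eta^g_{\operatorname{can}(V),M})^{-1}\otimes\mathrm{id}_X\big)\Big(\Big(\textstyle\bigoplus_{i=1}^{\dim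 V}\eta_0^{k\blacktriangleright g}\Big)^{-1}\operatorname{can}(\rho(k\blacktriangleright g))\otimes\mathrm{id}\otimes\mathrm{id}\Big)\alpha^{-1}_{\operatorname{can}(V),M\triangleleft g,X};$$ * $\mathbf F_2\colon\mathcal B^*_{\mathcal C}\to\mathcal C$, which restricts $(\mathbf F,s)$ along $\mathcal C\to\mathcal B$, $X\mapsto e\bowtie X$, to a module endofunctor $(\mathbf F,s')$ of the regular $\mathcal C$-module category (through $\mathbf R^0$), and sends it to $\mathbf F(\mathbf 1)$, with monoidal structure $\mathbf F(\ell_{\mathbf F'(\mathbf 1)})\,s'^{-1}_{\mathbf 1,\mathbf F'(\mathbf 1)}$; * $\mathbf S\colon\mathcal C^{(G,\Gamma)}\to\mathcal B^*_{\mathcal C}$, $\mathbf S(U,u)=(U\otimes-,s)$, where $s_{M,g\bowtie X}=((\eta^g_{U,M})^{-1}\otimes\mathrm{id}_X)(u_{k\blacktriangleright g}^{-1}\otimes\mathrm{id}\otimes\mathrm{id})\alpha^{-1}_{U,M\triangleleft g,X}$ for $M\in\mathcal C_k$, with monoidal structure $\alpha^{-1}_{U,U',-}$. **Extensions.** A sequence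 of $\Bbbk$-linear tensor functors $\mathcal A\xrightarrow{\iota}\mathcal D\xrightarrow{\mathbf F}\mathcal C$ is an extension with respect to $\operatorname{vec}$, viewed as an $\mathcal A$-module category through a tensor functor $\omega\colon\mathcal A\to\operatorname{vec}$, if: $\iota$ is fully faithful; every object of $\mathcal C$ is a subquotient of some $\mathbf F(X)$; $\mathbf F(X)$ is trivial (isomorphic to $\mathbf 1^{\oplus n}$ for some $n\ge 0$) if and only if $X$ is isomorphic to an object in the image of $\iota$; $\mathbf F\iota\simeq\operatorname{can}\omega$ as monoidal functors; and $\mathbf F$ is normal: each $X\in\mathcal D$ has a subobject $X_0$ such that $\mathbf F(X_0)$ is the largest trivial subobject of $\mathbf F(X)$. Three tensor equivalences $\mathbf T',\mathbf T,\mathbf T''$ form an equivalence from such an extension $(\iota,\mathbf F,\omega)$ to another one $(\iota',\mathbf F',\omega')$ if $\mathbf T\iota\simeq\iota'\mathbf T'$, $\mathbf F'\mathbf T\simeq\mathbf T''\mathbf F$ and $\omega\simeq\omega'\mathbf T'$ as monoidal functors. **Lemma.** The sequences $$\operatorname{Rep}G\xrightarrow{\iota_1}\mathcal C^{(G,\Gamma)}\xrightarrow{\mathbf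 F_1}\mathcal C\qquad\text{and}\qquad\operatorname{Rep}G\xrightarrow{\iota_2}\mathcal B^*_{\mathcal C}\xrightarrow{\mathbf F_2}\mathcal C$$ are extensions with respect to $(\operatorname{vec},\omega)$, and $(\mathrm{id}_{\operatorname{Rep}G},\mathbf S,\mathrm{id}_{\mathcal C})$ is an equivalence between them. In particular $\mathbf S$ is a tensor equivalence. Moreover, the isomorphisms $r_U\colon U\otimes\mathbf 1\to U$ form a monoidal natural isomorphism $\mathbf F_2\circ\mathbf S\to\mathbf F_1$. -/

import Mathlib

open CategoryTheory MonoidalCategory Limits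

set_option linter.unusedSectionVars false
set_option linter.unusedVariables false
set_option linter.unusedSimpArgs false

noncomputable section

attribute [instance] Abelian.hasFiniteBiproducts

namespace FusionDual

universe v u

/-- A matched pair of groups: `l k g` is the left action `k ▶ g` of `Γ` on the set `G`, and
`r k g` is the right action `k ◀ g` of `G` on the set `Γ`. -/
structure MatchedPair (G Γ : Type*) [Group G] [Group Γ] where
  l : Γ → G → G
  r : Γ → G → Γ
  one_l : ∀ g, l 1 g = g
  mul_l : ∀ k t g, l (k * t) g = l k (l t g)
  r_one : ∀ k, r k 1 = k
  r_mul : ∀ k g h, r k (g * h) = r (r k g) h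
  mul_r : ∀ k t g, r (k * t) g = r k (l t g) * r t g
  l_mul : ∀ k g h, l k (g * h) = l k g * l (r k g) h

namespace MatchedPair

variable {G Γ : Type*} [Group G] [Group Γ] (P : MatchedPair G Γ)

theorem l_one (k : Γ) : P.l k 1 = 1 := by
  have h := P.l_mul k 1 1
  rw [mul_one, P.r_one] at h
  exact left_eq_mul.mp h

theorem one_r (g : G) : P.r 1 g = 1 := by
  have h := P.mul_r 1 1 g
  rw [mul_one, P.one_l] at h
  exact left_eq_mul.mp h

end MatchedPair

section Fusion

variable (𝕜 : Type*) [Field 𝕜] (C : Type u) [Category.{v} C]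

/-- A fusion category over `𝕜`: a `𝕜`-linear abelian rigid monoidal category with bilinear tensor
product, finite-dimensional spaces of morphisms, simple unit object, finitely many simple objects
up to isomorphism, and in which each object is a finite direct sum of simple objects. -/
class FusionCategory [Abelian C] [Linear 𝕜 C] [MonoidalCategory C] [MonoidalPreadditive C]
    [MonoidalLinear 𝕜 C] [RigidCategory C] : Prop where
  finite_hom : ∀ X Y : C, Module.Finite 𝕜 (X ⟶ Y)
  simple_unit : Simple (𝟙_ C)
  finite_simples : ∃ (n : ℕ) (S : Fin n → C), ∀ X : C, Simple X → ∃ i, Nonempty (X ≅ S i)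
  semisimple : ∀ X : C, ∃ (n : ℕ) (S : Fin n → C), (∀ i, Simple (S i)) ∧
    Nonempty (X ≅ ⨁ S)

end Fusion

theorem biproduct_total {J : Type*} [Fintype J] {C : Type u} [Category.{v} C] [Preadditive C]
    (f : J → C) [HasBiproduct f] : ∑ j, biproduct.π f j ≫ biproduct.ι f j = 𝟙 (⨁ f) := by
  classical
  refine biproduct.hom_ext' _ _ fun i => ?_
  rw [Preadditive.comp_sum, Finset.sum_eq_single i]
  · simp
  · intro j _ hj
    rw [← Category.assoc, biproduct.ι_π_ne _ hj.symm, zero_comp]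
  · simp

section Grading

variable (Γ : Type*) [Group Γ] [Fintype Γ] (C : Type u) [Category.{v} C] [Preadditive C]
  [HasFiniteBiproducts C] [MonoidalCategory C]

/-- A faithful `Γ`-grading `C = ⨁ₖ Cₖ` of a monoidal category. `deg k X` says that `X` lies in the
full subcategory `Cₖ`. That the unit lies in `C₁` is a consequence of the other conditions. -/
structure Grading where
  deg : Γ → C → Prop
  deg_iso : ∀ {k X Y}, (X ≅ Y) → deg k X → deg k Y
  hom_eq_zero : ∀ {k l X Y}, k ≠ l → deg k X → deg l Y → ∀ f : X ⟶ Y, f = 0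
  exists_decomp : ∀ X, ∃ Y : Γ → C, (∀ k, deg k (Y k)) ∧ Nonempty (X ≅ ⨁ Y)
  deg_unit : deg 1 (𝟙_ C)
  deg_tensor : ∀ {k l X Y}, deg k X → deg l Y → deg (k * l) (X ⊗ Y)
  faithful : ∀ k, ∃ X, deg k X ∧ ¬ IsZero X

namespace Grading

variable {Γ C} (gr : Grading Γ C)

/-- The component `X_k ∈ C_k` of an object `X`. -/
def comp (X : C) (k : Γ) : C := (gr.exists_decomp X).choose k

theorem deg_comp (X : C) (k : Γ) : gr.deg k (gr.comp X k) :=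
  (gr.exists_decomp X).choose_spec.1 k

/-- The decomposition of an object into its homogeneous components. -/
def decomp (X : C) : X ≅ ⨁ gr.comp X := (gr.exists_decomp X).choose_spec.2.some

/-- The inclusion `X_k ⟶ X`. -/
def incl (X : C) (k : Γ) : gr.comp X k ⟶ X := biproduct.ι (gr.comp X) k ≫ (gr.decomp X).inv

/-- The projection `X ⟶ X_k`. -/
def proj (X : C) (k : Γ) : X ⟶ gr.comp X k := (gr.decomp X).hom ≫ biproduct.π (gr.comp X) k

theorem incl_proj (X : C) (k : Γ) : gr.incl X k ≫ gr.proj X k = 𝟙 _ := by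
  simp [incl, proj]

theorem total (X : C) : ∑ k, gr.proj X k ≫ gr.incl X k = 𝟙 X := by
  have h : ∀ k, gr.proj X k ≫ gr.incl X k = (gr.decomp X).hom ≫
      (biproduct.π (gr.comp X) k ≫ biproduct.ι (gr.comp X) k) ≫ (gr.decomp X).inv := by
    intro k; simp [incl, proj]
  rw [Finset.sum_congr rfl fun k _ => h k, ← Preadditive.comp_sum, ← Preadditive.sum_comp,
    biproduct_total]
  simp

theorem proj_eq_zero {X : C} {k l : Γ} (hX : gr.deg k X) (h : l ≠ k) : gr.proj X l = 0 :=
  gr.hom_eq_zero h.symm hX (gr.deg_comp X l) _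

theorem proj_incl {X : C} {k : Γ} (hX : gr.deg k X) : gr.proj X k ≫ gr.incl X k = 𝟙 X := by
  rw [← gr.total X, Finset.sum_eq_single k]
  · intro l _ h
    rw [gr.proj_eq_zero hX h, zero_comp]
  · simp

theorem incl_proj_ne (X : C) {k l : Γ} (h : k ≠ l) : gr.incl X k ≫ gr.proj X l = 0 :=
  gr.hom_eq_zero h (gr.deg_comp X k) (gr.deg_comp X l) _

/-- The component of a morphism. -/
def compMap {X Y : C} (f : X ⟶ Y) (k : Γ) : gr.comp X k ⟶ gr.comp Y k :=
  gr.incl X k ≫ f ≫ gr.proj Y k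

theorem comp_proj {X Y : C} (f : X ⟶ Y) (k : Γ) :
    f ≫ gr.proj Y k = gr.proj X k ≫ gr.compMap f k := by
  have h : f ≫ gr.proj Y k = 𝟙 X ≫ f ≫ gr.proj Y k := by simp
  rw [h, ← gr.total X, Preadditive.sum_comp, Finset.sum_eq_single k]
  · simp [compMap]
  · intro l _ hl
    have := gr.hom_eq_zero hl (gr.deg_comp X l) (gr.deg_comp Y k) (gr.incl X l ≫ f ≫ gr.proj Y k)
    rw [Category.assoc, this, comp_zero]
  · simp

theorem incl_comp {X Y : C} (f : X ⟶ Y) (k : Γ) :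
    gr.incl X k ≫ f = gr.compMap f k ≫ gr.incl Y k := by
  have h : gr.incl X k ≫ f = gr.incl X k ≫ f ≫ 𝟙 Y := by simp
  rw [h, ← gr.total Y, Preadditive.comp_sum, Preadditive.comp_sum, Finset.sum_eq_single k]
  · simp [compMap]
  · intro l _ hl
    have := gr.hom_eq_zero hl.symm (gr.deg_comp X k) (gr.deg_comp Y l)
      (gr.incl X k ≫ f ≫ gr.proj Y l)
    have e : gr.incl X k ≫ f ≫ gr.proj Y l ≫ gr.incl Y l =
      (gr.incl X k ≫ f ≫ gr.proj Y l) ≫ gr.incl Y l := by simp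
    rw [e, this, zero_comp]
  · simp

/-- Two morphisms out of `F X` agree if they agree on each `F X_k`. -/
theorem hom_ext_incl {D : Type*} [Category D] [Preadditive D] (F : C ⥤ D) [F.Additive] {X : C}
    {Z : D} {f f' : F.obj X ⟶ Z}
    (h : ∀ k, F.map (gr.incl X k) ≫ f = F.map (gr.incl X k) ≫ f') : f = f' := by
  have e : ∀ q : F.obj X ⟶ Z,
      q = ∑ k, F.map (gr.proj X k) ≫ F.map (gr.incl X k) ≫ q := by
    intro q
    simp only [← Category.assoc, ← F.map_comp, ← Preadditive.sum_comp, ← F.map_sum, gr.total]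
    simp
  rw [e f, e f']
  exact Finset.sum_congr rfl fun k _ => by rw [h k]

end Grading

end Grading

section Action

variable (𝕜 : Type*) [Field 𝕜] (G : Type*) [Group G] (C : Type u) [Category.{v} C]
  [Preadditive C] [Linear 𝕜 C]

/-- A right action of `G` on `C` by `𝕜`-linear functors `- ◁ g`. -/
structure RightAction where
  act : G → C ⥤ C
  additive : ∀ g, (act g).Additive
  linear : ∀ g, (act g).Linear 𝕜
  R2 : ∀ g h, act g ⋙ act h ≅ act (g * h)
  R0 : 𝟭 C ≅ act 1
  assoc : ∀ (g h k : G) (X : C),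
    (act k).map ((R2 g h).hom.app X) ≫ (R2 (g * h) k).hom.app X =
      (R2 h k).hom.app ((act g).obj X) ≫ (R2 g (h * k)).hom.app X ≫
        eqToHom (by rw [mul_assoc])
  right_unit : ∀ (g : G) (X : C),
    R0.hom.app ((act g).obj X) ≫ (R2 g 1).hom.app X = eqToHom (by rw [mul_one]; rfl)
  left_unit : ∀ (g : G) (X : C),
    (act g).map (R0.hom.app X) ≫ (R2 1 g).hom.app X = eqToHom (by rw [one_mul]; rfl)

namespace RightAction

variable {𝕜 G C} (T : RightAction 𝕜 G C)

instance (g : G) : (T.act g).Additive := T.additive g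

instance (g : G) : (T.act g).Linear 𝕜 := T.linear g

open scoped Classical in
/-- The canonical morphism `X ◁ g ⟶ X ◁ g'`: the identity if `g = g'`, and zero otherwise. -/
def tr (X : C) (g g' : G) : (T.act g).obj X ⟶ (T.act g').obj X :=
  if h : g = g' then eqToHom (by rw [h]) else 0

@[simp]
theorem tr_self (X : C) (g : G) : T.tr X g g = 𝟙 _ := by simp [tr]

theorem tr_ne (X : C) {g g' : G} (h : g ≠ g') : T.tr X g g' = 0 := by simp [tr, h]

theorem eqToHom_eq_tr (X : C) {g g' : G} (h : g = g')
    (e : (T.act g).obj X = (T.act g').obj X) : eqToHom e = T.tr X g g' := by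
  subst h; simp

theorem tr_comp (X : C) {g g' : G} (h : g = g') (g'' : G) :
    T.tr X g g' ≫ T.tr X g' g'' = T.tr X g g'' := by
  subst h; simp

theorem map_tr {X Y : C} (f : X ⟶ Y) (g g' : G) :
    (T.act g).map f ≫ T.tr Y g g' = T.tr X g g' ≫ (T.act g').map f := by
  by_cases h : g = g'
  · subst h; simp
  · simp [T.tr_ne _ h]

/-- The isomorphism `(X ◁ g) ◁ h ≅ X ◁ p`, for `g h = p`. -/
def mulIso (X : C) (g h p : G) (e : g * h = p) :
    (T.act h).obj ((T.act g).obj X) ≅ (T.act p).obj X :=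
  (T.R2 g h).app X ≪≫ eqToIso (by rw [e])

/-- The isomorphism `X ≅ X ◁ e`. -/
def oneIso (X : C) : X ≅ (T.act 1).obj X := T.R0.app X

theorem mulIso_nat {X Y : C} (f : X ⟶ Y) (g h p : G) (e : g * h = p) :
    (T.act h).map ((T.act g).map f) ≫ (T.mulIso Y g h p e).hom =
      (T.mulIso X g h p e).hom ≫ (T.act p).map f := by
  subst e
  have := (T.R2 g h).hom.naturality f
  simpa [mulIso] using this

theorem oneIso_nat {X Y : C} (f : X ⟶ Y) :
    f ≫ (T.oneIso Y).hom = (T.oneIso X).hom ≫ (T.act 1).map f := by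
  simpa [oneIso] using T.R0.hom.naturality f

theorem mulIso_assoc (X : C) (g h k p q r : G) (e₁ : g * h = p) (e₂ : p * k = r) (e₃ : h * k = q)
    (e₄ : g * q = r) :
    (T.act k).map (T.mulIso X g h p e₁).hom ≫ (T.mulIso X p k r e₂).hom =
      (T.mulIso _ h k q e₃).hom ≫ (T.mulIso X g q r e₄).hom := by
  subst e₁ e₃ e₄
  simp [mulIso, reassoc_of% (T.assoc g h k X)]

theorem mulIso_one (X : C) (g : G) (e : g * 1 = g) :
    (T.oneIso ((T.act g).obj X)).hom ≫ (T.mulIso X g 1 g e).hom = 𝟙 _ := by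
  simp [mulIso, oneIso, reassoc_of% (T.right_unit g X)]

theorem one_mulIso (X : C) (g : G) (e : 1 * g = g) :
    (T.act g).map (T.oneIso X).hom ≫ (T.mulIso X 1 g g e).hom = 𝟙 _ := by
  simp [mulIso, oneIso, reassoc_of% (T.left_unit g X)]

theorem mulIso_tr (X : C) (g h p p' : G) (e : g * h = p) (e' : g * h = p') :
    (T.mulIso X g h p e).hom ≫ T.tr X p p' = (T.mulIso X g h p' e').hom := by
  subst e e'; simp

theorem tr_mulIso (X : C) (g h h' p : G) (e : g * h = p) (e' : g * h' = p) :
    T.tr _ h h' ≫ (T.mulIso X g h' p e').hom = (T.mulIso X g h p e).hom := by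
  obtain rfl : h = h' := mul_left_cancel (e.trans e'.symm)
  simp

end RightAction

end Action

section Crossed

variable (𝕜 : Type*) [Field 𝕜] {G Γ : Type*} [Group G] [Group Γ] [Fintype Γ]
  (P : MatchedPair G Γ) (C : Type u) [Category.{v} C] [Preadditive C] [HasFiniteBiproducts C]
  [Linear 𝕜 C] [MonoidalCategory C]

/-- A `(G, Γ)`-crossed action on `C`, with constraints
`η g X Y : (X ⊗ Y) ◁ g ≅ X ◁ (k ▶ g) ⊗ Y ◁ g`, for `Y` of degree `k`, and `η0 g : 1 ◁ g ≅ 1`. -/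
structure CrossedAction where
  gr : Grading Γ C
  T : RightAction 𝕜 G C
  deg_act : ∀ {k : Γ} {X : C} (g : G), gr.deg k X → gr.deg (P.r k g) ((T.act g).obj X)
  η : ∀ (g : G) (X : C) {Y : C} {k : Γ}, gr.deg k Y →
    ((T.act g).obj (X ⊗ Y) ≅ (T.act (P.l k g)).obj X ⊗ (T.act g).obj Y)
  η0 : ∀ g : G, (T.act g).obj (𝟙_ C) ≅ 𝟙_ C
  η_nat : ∀ (g : G) {X X' Y Y' : C} {k : Γ} (hY : gr.deg k Y) (hY' : gr.deg k Y')
    (f : X ⟶ X') (f' : Y ⟶ Y'),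
    (T.act g).map (f ⊗ₘ f') ≫ (η g X' hY').hom =
      (η g X hY).hom ≫ ((T.act (P.l k g)).map f ⊗ₘ (T.act g).map f')
  η_assoc : ∀ (g : G) (X : C) {Y Z : C} {k l : Γ} (hY : gr.deg k Y) (hZ : gr.deg l Z),
    (η g (X ⊗ Y) hZ).hom ≫ (η (P.l l g) X hY).hom ▷ (T.act g).obj Z ≫ (α_ _ _ _).hom =
      (T.act g).map (α_ X Y Z).hom ≫ (η g X (gr.deg_tensor hY hZ)).hom ≫
        eqToHom (by rw [P.mul_l]) ▷ (T.act g).obj (Y ⊗ Z) ≫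
          (T.act (P.l k (P.l l g))).obj X ◁ (η g Y hZ).hom
  η_right_unit : ∀ (g : G) (X : C),
    (η g X gr.deg_unit).hom ≫ (T.act (P.l 1 g)).obj X ◁ (η0 g).hom ≫ (ρ_ _).hom ≫
      eqToHom (by rw [P.one_l]) = (T.act g).map (ρ_ X).hom
  η_left_unit : ∀ (g : G) {Y : C} {k : Γ} (hY : gr.deg k Y),
    (η g (𝟙_ C) hY).hom ≫ (η0 (P.l k g)).hom ▷ (T.act g).obj Y ≫ (λ_ _).hom =
      (T.act g).map (λ_ Y).hom
  η_R2 : ∀ (g h : G) (X : C) {Y : C} {k : Γ} (hY : gr.deg k Y),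
    (T.R2 g h).hom.app (X ⊗ Y) ≫ (η (g * h) X hY).hom =
      (T.act h).map (η g X hY).hom ≫ (η h _ (deg_act g hY)).hom ≫
        ((T.R2 (P.l k g) (P.l (P.r k g) h)).hom.app X ⊗ₘ (T.R2 g h).hom.app Y) ≫
          eqToHom (by rw [P.l_mul])
  η0_R2 : ∀ g h : G,
    (T.R2 g h).hom.app (𝟙_ C) ≫ (η0 (g * h)).hom = (T.act h).map (η0 g).hom ≫ (η0 h).hom
  η_R0 : ∀ (X : C) {Y : C} {k : Γ} (hY : gr.deg k Y),
    T.R0.hom.app (X ⊗ Y) ≫ (η 1 X hY).hom =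
      (T.R0.hom.app X ⊗ₘ T.R0.hom.app Y) ≫ eqToHom (by rw [P.l_one])
  η0_R0 : T.R0.hom.app (𝟙_ C) ≫ (η0 1).hom = 𝟙 _

namespace CrossedAction

variable {𝕜 P C} (A : CrossedAction 𝕜 P C)

theorem η_nat_left (g : G) {X X' Y : C} {k : Γ} (hY : A.gr.deg k Y) (f : X ⟶ X') :
    (A.T.act g).map (f ▷ Y) ≫ (A.η g X' hY).hom =
      (A.η g X hY).hom ≫ (A.T.act (P.l k g)).map f ▷ (A.T.act g).obj Y := by
  simpa using A.η_nat g hY hY f (𝟙 Y)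

theorem η_nat_right (g : G) (X : C) {Y Y' : C} {k : Γ} (hY : A.gr.deg k Y) (hY' : A.gr.deg k Y')
    (f : Y ⟶ Y') :
    (A.T.act g).map (X ◁ f) ≫ (A.η g X hY').hom =
      (A.η g X hY).hom ≫ (A.T.act (P.l k g)).obj X ◁ (A.T.act g).map f := by
  simpa using A.η_nat g hY hY' (𝟙 X) f

theorem eqToHom_whiskerRight_tr (X : C) {g g' : G} (h : g = g') (Y : C)
    (e : (A.T.act g).obj X ⊗ Y = (A.T.act g').obj X ⊗ Y) :
    eqToHom e = A.T.tr X g g' ▷ Y := by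
  subst h; simp

theorem η_assoc_tr (g : G) (X : C) {Y Z : C} {k l : Γ} (hY : A.gr.deg k Y)
    (hZ : A.gr.deg l Z) :
    (A.η g (X ⊗ Y) hZ).hom ≫ (A.η (P.l l g) X hY).hom ▷ (A.T.act g).obj Z ≫ (α_ _ _ _).hom =
      (A.T.act g).map (α_ X Y Z).hom ≫ (A.η g X (A.gr.deg_tensor hY hZ)).hom ≫
        A.T.tr _ _ (P.l k (P.l l g)) ▷ (A.T.act g).obj (Y ⊗ Z) ≫
          (A.T.act (P.l k (P.l l g))).obj X ◁ (A.η g Y hZ).hom := by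
  have := A.η_assoc g X hY hZ
  rwa [A.T.eqToHom_eq_tr X (P.mul_l k l g)] at this

theorem η_mul (g h p : G) (X : C) {Y : C} {k : Γ} (hY : A.gr.deg k Y) (e : g * h = p)
    (e' : P.l k g * P.l (P.r k g) h = P.l k p) :
    (A.T.act h).map (A.η g X hY).hom ≫ (A.η h _ (A.deg_act g hY)).hom ≫
        ((A.T.mulIso X _ _ _ e').hom ⊗ₘ (A.T.mulIso Y g h p e).hom) =
      (A.T.mulIso (X ⊗ Y) g h p e).hom ≫ (A.η p X hY).hom := by
  subst e
  have := A.η_R2 g h X hY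
  simp only [RightAction.mulIso, eqToIso_refl, Iso.trans_hom, Iso.refl_hom, Category.comp_id,
    Iso.app_hom, eqToIso.hom]
  rw [this, A.eqToHom_whiskerRight_tr X (P.l_mul k g h).symm,
    A.T.eqToHom_eq_tr X (P.l_mul k g h).symm]
  simp [tensorHom_def']

theorem η_one (X : C) {Y : C} {k : Γ} (hY : A.gr.deg k Y) :
    (A.T.oneIso (X ⊗ Y)).hom ≫ (A.η 1 X hY).hom =
      ((A.T.oneIso X).hom ≫ A.T.tr X 1 _) ▷ Y ≫ _ ◁ (A.T.oneIso Y).hom := by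
  have := A.η_R0 X hY
  rw [A.eqToHom_whiskerRight_tr X (P.l_one k).symm] at this
  simp only [RightAction.oneIso, Iso.app_hom]
  rw [this]
  simp [tensorHom_def', whisker_exchange]

theorem η_unit_right (g : G) (X : C) :
    (A.η g X A.gr.deg_unit).hom ≫ (A.T.act (P.l 1 g)).obj X ◁ (A.η0 g).hom ≫ (ρ_ _).hom ≫
      A.T.tr X (P.l 1 g) g = (A.T.act g).map (ρ_ X).hom := by
  rw [← A.η_right_unit, A.T.eqToHom_eq_tr X (P.one_l g)]

variable [MonoidalPreadditive C]

/-- The homogeneous objects `g ⋈ X` of `vec_G ⋈ C`, where `g ∈ G` and `X ∈ C_k`. -/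
structure Homog (A : CrossedAction 𝕜 P C) where
  g : G
  {k : Γ}
  {obj : C}
  deg : A.gr.deg k obj

namespace Homog

variable {A}

/-- Morphisms `g ⋈ X ⟶ g' ⋈ X'`: morphisms `X ⟶ X'` if `g = g'`, and only zero otherwise. -/
@[ext]
structure Hom (W W' : Homog A) where
  val : W.obj ⟶ W'.obj
  eq_zero : W.g ≠ W'.g → val = 0

@[simps]
instance : Category (Homog A) where
  Hom W W' := Hom W W'
  id W := ⟨𝟙 _, fun h => (h rfl).elim⟩
  comp {W W' W''} f f' := ⟨f.val ≫ f'.val, fun h => by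
    by_cases e : W.g = W'.g
    · rw [f'.eq_zero (e ▸ h), comp_zero]
    · rw [f.eq_zero e, zero_comp]⟩

@[ext]
theorem hom_ext {W W' : Homog A} {f f' : W ⟶ W'} (h : f.val = f'.val) : f = f' := Hom.ext h

/-- The additive group of morphisms. -/
def homSubgroup (W W' : Homog A) : AddSubgroup (W.obj ⟶ W'.obj) where
  carrier := {f | W.g ≠ W'.g → f = 0}
  zero_mem' _ := rfl
  add_mem' {a b} ha hb h := by rw [ha h, hb h, add_zero]
  neg_mem' {a} ha h := by rw [ha h, neg_zero]

/-- Morphisms as elements of a subgroup. -/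
def homEquiv (W W' : Homog A) : (W ⟶ W') ≃ homSubgroup W W' where
  toFun f := ⟨f.val, f.eq_zero⟩
  invFun f := ⟨f.1, f.2⟩

instance (W W' : Homog A) : AddCommGroup (W ⟶ W') := (homEquiv W W').addCommGroup

@[simp]
theorem zero_val (W W' : Homog A) : (0 : W ⟶ W').val = 0 := rfl

@[simp]
theorem add_val {W W' : Homog A} (f f' : W ⟶ W') : (f + f').val = f.val + f'.val := rfl

instance : Preadditive (Homog A) where
  add_comp _ _ _ _ _ _ := by ext; simp
  comp_add _ _ _ _ _ _ := by ext; simp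

/-- A morphism is zero unless the labels in `G` and the degrees agree. -/
theorem cases_hom {W W' : Homog A} (f : W ⟶ W') : f.val = 0 ∨ (W.g = W'.g ∧ W.k = W'.k) := by
  by_cases h : W.g = W'.g
  · by_cases h' : W.k = W'.k
    · exact Or.inr ⟨h, h'⟩
    · exact Or.inl (A.gr.hom_eq_zero h' W.deg W'.deg _)
  · exact Or.inl (f.eq_zero h)

end Homog

/-- The object `M ◁ g ⊗ X`, the result of the action of `g ⋈ X` on `M`. -/
abbrev mact (M : C) (W : Homog A) : C := (A.T.act W.g).obj M ⊗ W.obj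

/-- Functoriality of the action in the module variable. -/
def mactL {M M' : C} (f : M ⟶ M') (W : Homog A) : A.mact M W ⟶ A.mact M' W :=
  (A.T.act W.g).map f ▷ W.obj

/-- Functoriality of the action in the variable of the acting category. -/
def mactR (M : C) {W W' : Homog A} (f : W ⟶ W') : A.mact M W ⟶ A.mact M W' :=
  A.T.tr M W.g W'.g ▷ W.obj ≫ _ ◁ f.1

/-- The tensor product `(g ⋈ X) ⊗ (g' ⋈ X') = g (k ▶ g') ⋈ (X ◁ g' ⊗ X')`, for `X` of degree `k`. -/
abbrev Homog.tensor {A : CrossedAction 𝕜 P C} (W W' : Homog A) : Homog A where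
  g := W.g * P.l W.k W'.g
  obj := A.mact W.obj W'
  deg := A.gr.deg_tensor (A.deg_act W'.g W.deg) W'.deg

/-- The constraint `M ⊗ ((g ⋈ X) ⊗ (g' ⋈ X')) ≅ (M ⊗ (g ⋈ X)) ⊗ (g' ⋈ X')` of the action. -/
def mactAssoc (M : C) (W W' : Homog A) :
    A.mact M (W.tensor W') ≅ A.mact (A.mact M W) W' :=
  (α_ _ _ _).symm ≪≫ whiskerRightIso
    (whiskerRightIso (A.T.mulIso M W.g (P.l W.k W'.g) _ rfl).symm _ ≪≫
      (A.η W'.g ((A.T.act W.g).obj M) W.deg).symm) W'.obj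

/-- The unit `1 ⋈ 1`. -/
abbrev Homog.unit : Homog A where
  g := 1
  obj := 𝟙_ C
  deg := A.gr.deg_unit

/-- The unit constraint `M ⊗ (1 ⋈ 1) ≅ M` of the action. -/
def mactUnit (M : C) : A.mact M (Homog.unit A) ≅ M :=
  (ρ_ _) ≪≫ (A.T.oneIso M).symm

theorem mactL_comp {M M' M'' : C} (f : M ⟶ M') (f' : M' ⟶ M'') (W : Homog A) :
    A.mactL (f ≫ f') W = A.mactL f W ≫ A.mactL f' W := by
  simp [mactL]

theorem mactL_id (M : C) (W : Homog A) : A.mactL (𝟙 M) W = 𝟙 _ := by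
  simp [mactL]

theorem mactR_id (M : C) (W : Homog A) : A.mactR M (𝟙 W) = 𝟙 _ := by
  simp [mactR]

theorem mactR_comp (M : C) {W W' W'' : Homog A} (f : W ⟶ W') (f' : W' ⟶ W'') :
    A.mactR M (f ≫ f') = A.mactR M f ≫ A.mactR M f' := by
  rcases Homog.cases_hom f with h | ⟨h, -⟩
  · simp [mactR, h]
  · simp only [mactR, Homog.comp_val, Category.assoc, whisker_exchange_assoc,
      MonoidalCategory.whiskerLeft_comp]
    rw [← A.T.tr_comp M h]
    simp

theorem mact_exchange {M M' : C} (f : M ⟶ M') {W W' : Homog A} (f' : W ⟶ W') :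
    A.mactL f W ≫ A.mactR M' f' = A.mactR M f' ≫ A.mactL f W' := by
  simp only [mactL, mactR, Category.assoc]
  rw [← comp_whiskerRight_assoc, A.T.map_tr, comp_whiskerRight_assoc, whisker_exchange]

namespace Homog

variable {A}

/-- Tensoring a morphism with an object on the right. -/
def whiskerR {W₁ W₂ : Homog A} (f : W₁ ⟶ W₂) (W : Homog A) : W₁.tensor W ⟶ W₂.tensor W :=
  ⟨A.mactL f.val W, fun h => by
    rcases cases_hom f with h' | ⟨h', h''⟩
    · simp [mactL, h']
    · exact (h (by simp [h', h''])).elim⟩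

/-- Tensoring a morphism with an object on the left. -/
def whiskerL (W : Homog A) {W₁ W₂ : Homog A} (f : W₁ ⟶ W₂) : W.tensor W₁ ⟶ W.tensor W₂ :=
  ⟨A.mactR W.obj f, fun h => by
    rcases cases_hom f with h' | ⟨h', h''⟩
    · simp [mactR, h']
    · exact (h (by simp [h'])).elim⟩

/-- An isomorphism between the underlying objects of homogeneous objects with the same label. -/
def mkIso {W W' : Homog A} (e : W.obj ≅ W'.obj) (h : W.g = W'.g) : W ≅ W' where
  hom := ⟨e.hom, fun h' => (h' h).elim⟩
  inv := ⟨e.inv, fun h' => (h' h.symm).elim⟩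

end Homog

theorem mactAssoc_inv (M : C) (W W' : Homog A) : (A.mactAssoc M W W').inv =
    (A.η W'.g ((A.T.act W.g).obj M) W.deg).hom ▷ W'.obj ≫
      ((A.T.mulIso M W.g (P.l W.k W'.g) _ rfl).hom ▷ _) ▷ W'.obj ≫ (α_ _ _ _).hom := by
  simp [mactAssoc]

theorem mactAssoc_nat_left {M M' : C} (f : M ⟶ M') (W W' : Homog A) :
    A.mactL (A.mactL f W) W' ≫ (A.mactAssoc M' W W').inv =
      (A.mactAssoc M W W').inv ≫ A.mactL f (W.tensor W') := by
  simp only [mactAssoc_inv, mactL, Category.assoc]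
  have h := congrArg (fun t => (t ▷ (A.T.act W'.g).obj W.obj) ▷ W'.obj)
    (A.T.mulIso_nat f W.g (P.l W.k W'.g) _ rfl)
  simp only [comp_whiskerRight] at h
  rw [← comp_whiskerRight_assoc, A.η_nat_left, comp_whiskerRight_assoc, reassoc_of% h]
  simp

theorem mactAssoc_nat_mid (M : C) {W₁ W₂ : Homog A} (f : W₁ ⟶ W₂) (W : Homog A) :
    A.mactL (A.mactR M f) W ≫ (A.mactAssoc M W₂ W).inv =
      (A.mactAssoc M W₁ W).inv ≫ A.mactR M (Homog.whiskerR f W) := by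
  rcases Homog.cases_hom f with h | ⟨h, h'⟩
  · simp [mactL, mactR, Homog.whiskerR, h]
  · obtain ⟨g, d⟩ := W₁
    obtain ⟨g', d'⟩ := W₂
    dsimp only at h h'
    subst h h'
    simp only [mactAssoc_inv, mactL, mactR, Homog.whiskerR, RightAction.tr_self,
      id_whiskerRight, Category.id_comp, Category.assoc]
    rename_i k _ _
    have h := congrArg (fun t => t ▷ W.obj) (whisker_exchange
      (A.T.mulIso M g (P.l k W.g) _ rfl).hom ((A.T.act W.g).map f.val))
    simp only [comp_whiskerRight] at h
    rw [← comp_whiskerRight_assoc, A.η_nat_right W.g _ d d', comp_whiskerRight_assoc,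
      reassoc_of% h]
    simp

theorem mactAssoc_nat_right (M : C) (W : Homog A) {W₁ W₂ : Homog A} (f : W₁ ⟶ W₂) :
    A.mactR (A.mact M W) f ≫ (A.mactAssoc M W W₂).inv =
      (A.mactAssoc M W W₁).inv ≫ A.mactR M (Homog.whiskerL W f) := by
  rcases Homog.cases_hom f with h | ⟨h, h'⟩
  · simp [mactR, Homog.whiskerL, h]
  · obtain ⟨g, d⟩ := W₁
    obtain ⟨g', d'⟩ := W₂
    dsimp only at h h'
    subst h h'
    simp only [mactAssoc_inv, mactR, Homog.whiskerL, RightAction.tr_self,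
      id_whiskerRight, Category.id_comp, Category.assoc, whisker_exchange_assoc]
    simp

/-- The associator of homogeneous objects. -/
def Homog.assoc {A : CrossedAction 𝕜 P C} (W W' W'' : Homog A) :
    (W.tensor W').tensor W'' ≅ W.tensor (W'.tensor W'') :=
  Homog.mkIso (A.mactAssoc W.obj W' W'').symm (by simp [P.l_mul, P.mul_l, mul_assoc])

theorem mact_pentagon_aux (M : C) (a b c : G) {X Y : C} {k l : Γ} (d₁ : A.gr.deg k X)
    (d₂ : A.gr.deg l Y) :
    (A.η c _ d₂).hom ≫ ((A.T.mulIso ((A.T.act a).obj M ⊗ X) b (P.l l c) _ rfl).hom ≫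
        (A.η (b * P.l l c) _ d₁).hom ≫ (A.T.mulIso M a _ _ rfl).hom ▷ _) ▷ (A.T.act c).obj Y ≫
          (α_ _ _ _).hom =
      (A.T.act c).map ((A.η b _ d₁).hom ▷ Y ≫ (A.T.mulIso M a (P.l k b) _ rfl).hom ▷ _ ▷ Y ≫
        (α_ _ _ _).hom) ≫ (A.η c _ (A.gr.deg_tensor (A.deg_act b d₁) d₂)).hom ≫
          ((A.T.mulIso M _ _ _ rfl).hom ≫ A.T.tr M _ (a * P.l k (b * P.l l c))) ▷ _ ≫
            _ ◁ ((A.η c _ d₂).hom ≫ (A.T.mulIso X b (P.l l c) _ rfl).hom ▷ _) := by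
  have h₁ := A.η_nat_left c d₂ (A.η b ((A.T.act a).obj M) d₁).hom
  have h₂ := A.η_assoc_tr c ((A.T.act (P.l k b)).obj ((A.T.act a).obj M)) (A.deg_act b d₁) d₂
  have h₃ := A.η_mul b (P.l l c) _ ((A.T.act a).obj M) d₁ rfl (P.l_mul k b (P.l l c)).symm
  have h₄ := A.η_nat_left c (A.gr.deg_tensor (A.deg_act b d₁) d₂)
    (A.T.mulIso M a (P.l k b) _ rfl).hom
  have e₁ : P.l (P.r k b * l) c = P.l (P.r k b) (P.l l c) := P.mul_l _ _ _
  have e₂ : a * P.l k b * P.l (P.r k b * l) c = a * P.l k (b * P.l l c) := by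
    rw [P.l_mul, P.mul_l, mul_assoc]
  have h₅ : (A.T.act _).map (A.T.mulIso M a (P.l k b) _ rfl).hom ≫
      (A.T.mulIso M _ (P.l (P.r k b * l) c) _ rfl).hom ≫ A.T.tr M _ (a * P.l k (b * P.l l c)) =
      A.T.tr _ _ _ ≫ (A.T.mulIso _ _ _ _ (P.l_mul k b (P.l l c)).symm).hom ≫
        (A.T.mulIso M a _ _ rfl).hom := by
    rw [A.T.mulIso_tr _ _ _ _ _ _ e₂]
    rw [reassoc_of% (A.T.tr_mulIso ((A.T.act a).obj M) (P.l k b) _ _ _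
      (by rw [e₁, ← P.l_mul]) (P.l_mul k b (P.l l c)).symm)]
    exact A.T.mulIso_assoc _ _ _ _ _ _ _ _ _ _ _
  have h₆ : (A.T.act c).map ((A.T.mulIso M a (P.l k b) _ rfl).hom ▷ (A.T.act b).obj X ▷ Y ≫
        (α_ _ _ _).hom) = (A.T.act c).map (α_ _ _ _).hom ≫
          (A.T.act c).map ((A.T.mulIso M a (P.l k b) _ rfl).hom ▷ ((A.T.act b).obj X ⊗ Y)) := by
    rw [← Functor.map_comp]; simp
  rw [Functor.map_comp, h₆, Category.assoc, Category.assoc, reassoc_of% h₄,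
    ← comp_whiskerRight_assoc, h₅]
  have h₇ := congrArg (fun t => t ▷ (A.T.act c).obj Y) h₃
  simp only [MonoidalCategory.tensorHom_def, comp_whiskerRight, MonoidalCategory.whiskerLeft_comp,
    Category.assoc] at h₇ ⊢
  rw [← whisker_exchange_assoc (A.T.mulIso M a _ _ rfl).hom (A.η c _ d₂).hom,
    ← whisker_exchange_assoc (A.T.mulIso _ _ _ _ _).hom (A.η c _ d₂).hom,
    ← reassoc_of% h₂, reassoc_of% h₁, ← reassoc_of% h₇,
    ← whisker_exchange (A.T.mulIso M a _ _ rfl).hom ((A.T.mulIso X b _ _ rfl).hom ▷ _)]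
  simp

theorem mact_pentagon (M : C) (W W' W'' : Homog A) :
    (A.mactAssoc (A.mact M W) W' W'').inv ≫ (A.mactAssoc M W (W'.tensor W'')).inv =
      A.mactL (A.mactAssoc M W W').inv W'' ≫ (A.mactAssoc M (W.tensor W') W'').inv ≫
        A.mactR M (W.assoc W' W'').hom := by
  obtain ⟨a, d₁⟩ := W
  obtain ⟨b, d₂⟩ := W'
  obtain ⟨c, d₃⟩ := W''
  rename_i k₁ X k₂ Y k₃ Z
  have h := congrArg (fun t => t ▷ Z ≫ (α_ _ _ _).hom ≫ _ ◁ (α_ _ _ _).hom)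
    (A.mact_pentagon_aux M a b c d₁ d₂)
  simp only [mactAssoc_inv, mactL, mactR, Homog.assoc, Homog.mkIso, Iso.symm_hom]
  refine Eq.trans ?_ (h.trans ?_)
  · simp
  · simp

/-- The left unitor of homogeneous objects. -/
def Homog.leftUnitor {A : CrossedAction 𝕜 P C} (W : Homog A) : (Homog.unit A).tensor W ≅ W :=
  Homog.mkIso (whiskerRightIso (A.η0 W.g) _ ≪≫ λ_ _) (by simp [P.one_l])

/-- The right unitor of homogeneous objects. -/
def Homog.rightUnitor {A : CrossedAction 𝕜 P C} (W : Homog A) : W.tensor (Homog.unit A) ≅ W :=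
  Homog.mkIso (A.mactUnit W.obj) (by simp [P.l_one])

theorem mact_leftUnitor (M : C) (W : Homog A) :
    (A.mactAssoc M (Homog.unit A) W).inv ≫ A.mactR M W.leftUnitor.hom =
      A.mactL (A.mactUnit M).hom W := by
  obtain ⟨g, d⟩ := W
  rename_i k X
  have h₁ := A.η_unit_right g ((A.T.act 1).obj M)
  have h₂ : (A.T.act g).map (A.T.oneIso M).inv = (A.T.mulIso M 1 g g (one_mul g)).hom := by
    rw [← cancel_epi ((A.T.act g).map (A.T.oneIso M).hom), A.T.one_mulIso, ← Functor.map_comp]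
    simp
  have h₃ : A.T.tr _ _ _ ≫ (A.T.mulIso M 1 g g (one_mul g)).hom =
      (A.T.mulIso M 1 (P.l 1 g) _ rfl).hom ≫ A.T.tr M (1 * P.l 1 g) g := by
    rw [A.T.mulIso_tr _ _ _ _ _ _ (by rw [P.one_l, one_mul]), A.T.tr_mulIso]
  simp only [mactAssoc_inv, mactL, mactR, Homog.leftUnitor, Homog.mkIso, mactUnit, Iso.trans_hom,
    whiskerRightIso_hom, Functor.map_comp, Iso.symm_hom]
  rw [h₂, ← h₁]
  simp only [Category.assoc]
  rw [h₃]
  have h₄ : ((A.T.mulIso M 1 (P.l 1 g) _ rfl).hom ≫ A.T.tr M (1 * P.l 1 g) g) ▷ _ ≫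
      _ ◁ (A.η0 g).hom ≫ (ρ_ _).hom = _ ◁ (A.η0 g).hom ≫ (ρ_ _).hom ≫
        ((A.T.mulIso M 1 (P.l 1 g) _ rfl).hom ≫ A.T.tr M (1 * P.l 1 g) g) := by
    rw [← whisker_exchange_assoc]
    simp
  rw [← h₄]
  simp

theorem mact_rightUnitor (M : C) (W : Homog A) :
    (A.mactAssoc M W (Homog.unit A)).inv ≫ A.mactR M W.rightUnitor.hom =
      (A.mactUnit (A.mact M W)).hom := by
  obtain ⟨g, d⟩ := W
  rename_i k X
  have h₁ := A.η_one ((A.T.act g).obj M) d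
  have h₂ : A.T.tr ((A.T.act g).obj M) 1 (P.l k 1) ≫ (A.T.mulIso M g (P.l k 1) _ rfl).hom ≫
      A.T.tr M _ g = (A.T.mulIso M g 1 g (mul_one g)).hom := by
    rw [A.T.mulIso_tr _ _ _ _ _ _ (by rw [P.l_one, mul_one]), A.T.tr_mulIso]
  have h₃ : (A.η 1 ((A.T.act g).obj M) d).hom ≫ ((A.T.mulIso M g (P.l k 1) _ rfl).hom ≫
      A.T.tr M _ g) ▷ _ ≫ _ ◁ (A.T.oneIso X).inv = (A.T.oneIso ((A.T.act g).obj M ⊗ X)).inv := by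
    rw [← cancel_epi (A.T.oneIso ((A.T.act g).obj M ⊗ X)).hom, reassoc_of% h₁,
      ← whisker_exchange_assoc, ← comp_whiskerRight_assoc, Category.assoc, h₂, A.T.mulIso_one]
    simp
  simp only [mactAssoc_inv, mactR, Homog.rightUnitor, Homog.mkIso, mactUnit, Iso.trans_hom,
    Iso.symm_hom]
  rw [← h₃]
  simp

end CrossedAction

end Crossed

section Constructors

variable {E : Type*} [Category E]

/-- A constructor of monoidal categories in terms of the one-variable tensor products. -/
abbrev monoidalOfWhisker [MonoidalCategoryStruct E]
    (hdef : ∀ {X₁ Y₁ X₂ Y₂ : E} (f : X₁ ⟶ Y₁) (g : X₂ ⟶ Y₂), f ⊗ₘ g = (f ▷ X₂) ≫ (Y₁ ◁ g))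
    (lid : ∀ X Y : E, X ◁ 𝟙 Y = 𝟙 (X ⊗ Y)) (rid : ∀ X Y : E, 𝟙 X ▷ Y = 𝟙 (X ⊗ Y))
    (lcomp : ∀ (X : E) {Y Y' Y'' : E} (f : Y ⟶ Y') (g : Y' ⟶ Y''),
      X ◁ (f ≫ g) = X ◁ f ≫ X ◁ g)
    (rcomp : ∀ {Y Y' Y'' : E} (f : Y ⟶ Y') (g : Y' ⟶ Y'') (X : E),
      (f ≫ g) ▷ X = f ▷ X ≫ g ▷ X)
    (exch : ∀ {X X' Y Y' : E} (f : X ⟶ X') (g : Y ⟶ Y'), X ◁ g ≫ f ▷ Y' = f ▷ Y ≫ X' ◁ g)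
    (n₁ : ∀ {X X' : E} (f : X ⟶ X') (Y Z : E),
      f ▷ Y ▷ Z ≫ (α_ X' Y Z).hom = (α_ X Y Z).hom ≫ f ▷ (Y ⊗ Z))
    (n₂ : ∀ (X : E) {Y Y' : E} (f : Y ⟶ Y') (Z : E),
      (X ◁ f) ▷ Z ≫ (α_ X Y' Z).hom = (α_ X Y Z).hom ≫ X ◁ f ▷ Z)
    (n₃ : ∀ (X Y : E) {Z Z' : E} (f : Z ⟶ Z'),
      (X ⊗ Y) ◁ f ≫ (α_ X Y Z').hom = (α_ X Y Z).hom ≫ X ◁ Y ◁ f)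
    (lnat : ∀ {X Y : E} (f : X ⟶ Y), 𝟙_ _ ◁ f ≫ (λ_ Y).hom = (λ_ X).hom ≫ f)
    (rnat : ∀ {X Y : E} (f : X ⟶ Y), f ▷ 𝟙_ _ ≫ (ρ_ Y).hom = (ρ_ X).hom ≫ f)
    (pent : ∀ W X Y Z : E,
      (α_ W X Y).hom ▷ Z ≫ (α_ W (X ⊗ Y) Z).hom ≫ W ◁ (α_ X Y Z).hom =
        (α_ (W ⊗ X) Y Z).hom ≫ (α_ W X (Y ⊗ Z)).hom)
    (tri : ∀ X Y : E, (α_ X (𝟙_ _) Y).hom ≫ X ◁ (λ_ Y).hom = (ρ_ X).hom ▷ Y) :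
    MonoidalCategory E where
  tensorHom_def := hdef
  id_tensorHom_id X Y := by rw [hdef, lid, rid, Category.comp_id]
  tensorHom_comp_tensorHom f₁ f₂ g₁ g₂ := by
    simp only [hdef, rcomp, lcomp, Category.assoc]
    rw [← Category.assoc (_ ◁ f₂), exch]
    simp
  whiskerLeft_id := lid
  id_whiskerRight := rid
  associator_naturality f₁ f₂ f₃ := by
    simp only [hdef, rcomp, lcomp, Category.assoc]
    rw [n₃, reassoc_of% (n₂ _ f₂), reassoc_of% (n₁ f₁)]
  leftUnitor_naturality := lnat
  rightUnitor_naturality := rnat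
  pentagon := pent
  triangle := tri

open scoped MonoidalRightAction

/-- A constructor of right actions in terms of the one-variable functors. -/
abbrev rightActionOfWhisker [MonoidalCategory E] {D : Type*} [Category D]
    [MonoidalRightActionStruct E D]
    (hdef : ∀ {c c' : E} {d d' : D} (f : d ⟶ d') (g : c ⟶ c'), f ⊙ᵣₘ g = f ⊵ᵣ c ≫ d' ⊴ᵣ g)
    (rid : ∀ (c : E) (d : D), d ⊴ᵣ 𝟙 c = 𝟙 (d ⊙ᵣ c))
    (lid : ∀ (c : E) (d : D), 𝟙 d ⊵ᵣ c = 𝟙 (d ⊙ᵣ c))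
    (rcomp : ∀ (d : D) {c c' c'' : E} (f : c ⟶ c') (g : c' ⟶ c''),
      d ⊴ᵣ (f ≫ g) = d ⊴ᵣ f ≫ d ⊴ᵣ g)
    (lcomp : ∀ {d d' d'' : D} (f : d ⟶ d') (g : d' ⟶ d'') (c : E),
      (f ≫ g) ⊵ᵣ c = f ⊵ᵣ c ≫ g ⊵ᵣ c)
    (exch : ∀ {c c' : E} {d d' : D} (f : d ⟶ d') (g : c ⟶ c'),
      f ⊵ᵣ c ≫ d' ⊴ᵣ g = d ⊴ᵣ g ≫ f ⊵ᵣ c')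
    (n₁ : ∀ {d d' : D} (f : d ⟶ d') (c c' : E),
      (f ⊵ᵣ c) ⊵ᵣ c' ≫ (αᵣ d' c c').inv = (αᵣ d c c').inv ≫ f ⊵ᵣ (c ⊗ c'))
    (n₂ : ∀ (d : D) {c c' : E} (f : c ⟶ c') (c'' : E),
      (d ⊴ᵣ f) ⊵ᵣ c'' ≫ (αᵣ d c' c'').inv = (αᵣ d c c'').inv ≫ d ⊴ᵣ (f ▷ c''))
    (n₃ : ∀ (d : D) (c'' : E) {c c' : E} (f : c ⟶ c'),
      (d ⊙ᵣ c'') ⊴ᵣ f ≫ (αᵣ d c'' c').inv = (αᵣ d c'' c).inv ≫ d ⊴ᵣ (c'' ◁ f))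
    (unat : ∀ {d d' : D} (f : d ⟶ d'), (ρᵣ[E] d).hom ≫ f = f ⊵ᵣ (𝟙_ E) ≫ (ρᵣ[E] d').hom)
    (pent : ∀ (c₁ c₂ c₃ : E) (d : D),
      (αᵣ (d ⊙ᵣ c₁ : D) c₂ c₃).inv ≫ (αᵣ d c₁ (c₂ ⊗ c₃)).inv =
        (αᵣ d c₁ c₂).inv ⊵ᵣ c₃ ≫ (αᵣ d (c₁ ⊗ c₂ : E) c₃).inv ≫ d ⊴ᵣ (α_ c₁ c₂ c₃).hom)
    (lu : ∀ (c : E) (d : D), (αᵣ _ _ _).inv ≫ d ⊴ᵣ (λ_ c).hom = (ρᵣ[E] d).hom ⊵ᵣ c)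
    (ru : ∀ (c : E) (d : D), (αᵣ _ _ _).inv ≫ d ⊴ᵣ (ρ_ c).hom = (ρᵣ[E] _).hom) :
    MonoidalRightAction E D where
  actionHom_def := hdef
  actionHomRight_id := rid
  id_actionHomLeft := lid
  actionHom_comp f₁ f₂ g₁ g₂ := by
    simp only [hdef, rcomp, lcomp, Category.assoc]
    rw [← Category.assoc (f₂ ⊵ᵣ _), exch]
    simp
  actionAssocIso_hom_naturality f g h := by
    rw [← Iso.inv_comp_eq]
    simp only [hdef, MonoidalCategory.tensorHom_def, rcomp, lcomp]
    rw [Category.assoc, Category.assoc, ← reassoc_of% (n₁ f), ← reassoc_of% (n₂ _ g),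
      ← reassoc_of% (n₃ _ _ h)]
    simp
  actionUnitIso_hom_naturality := unat
  actionHomRight_whiskerRight f c d := by rw [n₂]; simp
  whiskerRight_actionHomLeft c _ _ f d := by rw [n₃]; simp
  actionHom_associator c₁ c₂ c₃ d := by
    have h : (αᵣ d c₁ c₂).hom ⊵ᵣ c₃ ≫ (αᵣ d c₁ c₂).inv ⊵ᵣ c₃ = 𝟙 _ := by
      rw [← lcomp, Iso.hom_inv_id, lid]
    rw [← Iso.inv_comp_eq, ← Category.id_comp (αᵣ d (c₁ ⊗ c₂) c₃).inv, ← h, Category.assoc,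
      Category.assoc, ← reassoc_of% (pent c₁ c₂ c₃ d)]
    simp
  actionHom_leftUnitor c d := by rw [← lu]; simp
  actionHom_rightUnitor c d := by rw [← ru]; simp

end Constructors

section HomogMonoidal

variable {𝕜 : Type*} [Field 𝕜] {G Γ : Type*} [Group G] [Group Γ] [Fintype Γ]
  {P : MatchedPair G Γ} {C : Type u} [Category.{v} C] [Preadditive C] [HasFiniteBiproducts C]
  [Linear 𝕜 C] [MonoidalCategory C] [MonoidalPreadditive C] (A : CrossedAction 𝕜 P C)

namespace CrossedAction

instance : MonoidalCategoryStruct (Homog A) where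
  tensorObj W W' := W.tensor W'
  whiskerLeft W _ _ f := Homog.whiskerL W f
  whiskerRight f W := Homog.whiskerR f W
  tensorUnit := Homog.unit A
  associator W W' W'' := W.assoc W' W''
  leftUnitor W := W.leftUnitor
  rightUnitor W := W.rightUnitor

instance : MonoidalCategory (Homog A) :=
  monoidalOfWhisker (fun _ _ => rfl)
    (fun W W' => Homog.hom_ext (A.mactR_id W.obj W'))
    (fun W W' => Homog.hom_ext (A.mactL_id W.obj W'))
    (fun W _ _ _ f g => Homog.hom_ext (A.mactR_comp W.obj f g))
    (fun f g W => Homog.hom_ext (A.mactL_comp f.val g.val W))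
    (fun f g => Homog.hom_ext (A.mact_exchange f.val g).symm)
    (fun f Y Z => Homog.hom_ext (A.mactAssoc_nat_left f.val Y Z))
    (fun X _ _ f Z => Homog.hom_ext (A.mactAssoc_nat_mid X.obj f Z))
    (fun X Y _ _ f => Homog.hom_ext (A.mactAssoc_nat_right X.obj Y f))
    (fun {X Y} f => by
      apply Homog.hom_ext
      change A.mactR (𝟙_ C) f ≫ (A.η0 Y.g).hom ▷ _ ≫ (λ_ _).hom =
        ((A.η0 X.g).hom ▷ _ ≫ (λ_ _).hom) ≫ f.val
      rcases Homog.cases_hom f with h | ⟨h, h'⟩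
      · simp [mactR, h]
      · obtain ⟨g, d⟩ := X
        obtain ⟨g', d'⟩ := Y
        dsimp only at h h'
        subst h h'
        simp [mactR, whisker_exchange_assoc])
    (fun {X Y} f => by
      apply Homog.hom_ext
      change (A.T.act 1).map f.val ▷ _ ≫ (ρ_ _).hom ≫ (A.T.oneIso Y.obj).inv =
        ((ρ_ _).hom ≫ (A.T.oneIso X.obj).inv) ≫ f.val
      have h := A.T.oneIso_nat f.val
      rw [← Iso.eq_comp_inv, Category.assoc, ← Iso.inv_comp_eq] at h
      simp [← h])
    (fun W X Y Z => Homog.hom_ext (A.mact_pentagon W.obj X Y Z).symm)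
    (fun X Y => Homog.hom_ext (A.mact_leftUnitor X.obj Y))

theorem Homog.val_whiskerLeft (W : Homog A) {X Y : Homog A} (f : X ⟶ Y) :
    (W ◁ f).val = A.mactR W.obj f := rfl

theorem Homog.val_whiskerRight {X Y : Homog A} (f : X ⟶ Y) (W : Homog A) :
    (f ▷ W).val = A.mactL f.val W := rfl

instance : MonoidalPreadditive (Homog A) where
  whiskerLeft_zero := by intros; ext; simp [Homog.val_whiskerLeft, mactR]
  zero_whiskerRight := by intros; ext; simp [Homog.val_whiskerRight, mactL]
  whiskerLeft_add f g := by ext; simp [Homog.val_whiskerLeft, mactR]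
  add_whiskerRight f g := by ext; simp [Homog.val_whiskerRight, mactL, Functor.map_add]

open scoped MonoidalRightAction

instance : MonoidalRightActionStruct (Homog A) C where
  actionObj M W := A.mact M W
  actionHomLeft f W := A.mactL f W
  actionHomRight M _ _ f := A.mactR M f
  actionAssocIso M W W' := A.mactAssoc M W W'
  actionUnitIso M := A.mactUnit M

/-- `C` as a module category over the homogeneous objects: `M ⊗ (g ⋈ X) = M ◁ g ⊗ X`. -/
instance : MonoidalRightAction (Homog A) C :=
  rightActionOfWhisker (fun _ _ => rfl)
    (fun W M => A.mactR_id M W)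
    (fun W M => A.mactL_id M W)
    (fun M _ _ _ f g => A.mactR_comp M f g)
    (fun f g W => A.mactL_comp f g W)
    (fun f g => A.mact_exchange f g)
    (fun f W W' => A.mactAssoc_nat_left f W W')
    (fun M _ _ f W => A.mactAssoc_nat_mid M f W)
    (fun M W _ _ f => A.mactAssoc_nat_right M W f)
    (fun {M M'} f => by
      change ((ρ_ _).hom ≫ (A.T.oneIso M).inv) ≫ f =
        (A.T.act 1).map f ▷ _ ≫ (ρ_ _).hom ≫ (A.T.oneIso M').inv
      have h := A.T.oneIso_nat f
      rw [← Iso.eq_comp_inv, Category.assoc, ← Iso.inv_comp_eq] at h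
      simp [← h])
    (fun W W' W'' M => A.mact_pentagon M W W' W'')
    (fun W M => A.mact_leftUnitor M W)
    (fun W M => A.mact_rightUnitor M W)

/-- The action is additive in both variables. -/
theorem mactR_add (M : C) {W W' : Homog A} (f f' : W ⟶ W') :
    A.mactR M (f + f') = A.mactR M f + A.mactR M f' := by
  simp [mactR]

theorem mactL_add {M M' : C} (f f' : M ⟶ M') (W : Homog A) :
    A.mactL (f + f') W = A.mactL f W + A.mactL f' W := by
  simp [mactL, Functor.map_add]

end CrossedAction

end HomogMonoidal

section MatMonoidal

variable {E : Type*} [Category E] [Preadditive E]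

namespace MatAux

@[ext]
theorem hom_ext {M N : Mat_ E} {f g : M ⟶ N} (h : ∀ i j, f i j = g i j) : f = g :=
  DMatrix.ext h

open scoped Classical in
/-- The morphism of `Mat_ E` with one entry in each row. -/
def mono {M N : Mat_ E} (e : M.ι → N.ι) (φ : ∀ i, M.X i ⟶ N.X (e i)) : M ⟶ N := fun i j =>
  if h : e i = j then φ i ≫ eqToHom (by rw [h]) else 0

theorem mono_self {M N : Mat_ E} (e : M.ι → N.ι) (φ : ∀ i, M.X i ⟶ N.X (e i)) (i : M.ι) :
    mono e φ i (e i) = φ i := by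
  simp [mono]

theorem mono_ne {M N : Mat_ E} (e : M.ι → N.ι) (φ : ∀ i, M.X i ⟶ N.X (e i)) {i : M.ι} {j : N.ι}
    (h : e i ≠ j) : mono e φ i j = 0 := by
  simp [mono, h]

theorem id_eq_mono (M : Mat_ E) : 𝟙 M = mono (fun i => i) (fun i => 𝟙 (M.X i)) := by
  ext i j
  by_cases h : i = j
  · subst h
    rw [Mat_.id_apply_self]
    exact (mono_self (M := M) (N := M) (fun i => i) (fun i => 𝟙 _) i).symm
  · rw [Mat_.id_apply_of_ne _ _ _ h, mono_ne]
    exact h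

theorem mono_comp_apply {M N L : Mat_ E} (e : M.ι → N.ι) (φ : ∀ i, M.X i ⟶ N.X (e i))
    (f : N ⟶ L) (i : M.ι) (j : L.ι) : (mono e φ ≫ f) i j = φ i ≫ f (e i) j := by
  rw [Mat_.comp_apply, Finset.sum_eq_single (e i)]
  · rw [mono_self]
  · intro k _ hk
    rw [mono_ne e φ hk.symm, zero_comp]
  · simp

theorem comp_mono_apply {M N L : Mat_ E} (f : L ⟶ M) (e : M.ι → N.ι)
    (he : Function.Injective e) (φ : ∀ i, M.X i ⟶ N.X (e i))
    (i : L.ι) (j : M.ι) : (f ≫ mono e φ) i (e j) = f i j ≫ φ j := by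
  rw [Mat_.comp_apply, Finset.sum_eq_single j]
  · rw [mono_self]
  · intro k _ hk
    rw [mono_ne e φ (fun h => hk (he h)), comp_zero]
  · simp

theorem mono_comp_mono {M N L : Mat_ E} (e : M.ι → N.ι) (φ : ∀ i, M.X i ⟶ N.X (e i))
    (e' : N.ι → L.ι) (φ' : ∀ i, N.X i ⟶ L.X (e' i)) :
    mono e φ ≫ mono e' φ' = mono (fun i => e' (e i)) (fun i => φ i ≫ φ' (e i)) := by
  ext i j
  rw [mono_comp_apply]
  by_cases h : e' (e i) = j
  · subst h
    rw [mono_self, mono_self (fun i => e' (e i))]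
  · rw [mono_ne e' φ' h, mono_ne (fun i => e' (e i)) _ h, comp_zero]

/-- The isomorphism of `Mat_ E` given by a relabelling and a family of isomorphisms. -/
def monoIso {M N : Mat_ E} (e : M.ι ≃ N.ι) (φ : ∀ i, M.X i ≅ N.X (e i)) : M ≅ N where
  hom := mono e (fun i => (φ i).hom)
  inv := mono e.symm (fun j => eqToHom (by rw [e.apply_symm_apply]) ≫ (φ (e.symm j)).inv)
  hom_inv_id := by
    rw [mono_comp_mono, id_eq_mono]
    ext i j
    by_cases h : i = j
    · subst h
      have : ∀ k (hk : e.symm (e i) = k), (mono (M := M) (N := M) (fun i => e.symm (e i)) fun i =>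
          (φ i).hom ≫ eqToHom (by rw [e.apply_symm_apply]) ≫ (φ (e.symm (e i))).inv) i k =
          eqToHom (by rw [← hk, e.symm_apply_apply]) := by
        intro k hk
        subst hk
        rw [mono_self (fun i => e.symm (e i))]
        have : ∀ l (hl : i = l), (φ i).hom ≫ eqToHom (by rw [hl]) ≫ (φ l).inv =
            eqToHom (by rw [hl]) := by
          intro l hl; subst hl; simp
        exact this _ (e.symm_apply_apply i).symm
      rw [this i (by simp)]
      exact (mono_self (M := M) (N := M) (fun i => i) (fun i => 𝟙 _) i).symm
    · rw [mono_ne _ _ (by simpa using h), mono_ne _ _ (by simpa using h)]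
  inv_hom_id := by
    rw [mono_comp_mono, id_eq_mono]
    ext i j
    by_cases h : i = j
    · subst h
      have : ∀ k (hk : e (e.symm i) = k), (mono (M := N) (N := N) (fun i => e (e.symm i)) fun i =>
          (eqToHom (by rw [e.apply_symm_apply]) ≫ (φ (e.symm i)).inv) ≫ (φ (e.symm i)).hom) i k =
          eqToHom (by rw [← hk, e.apply_symm_apply]) := by
        intro k hk
        subst hk
        rw [mono_self (fun i => e (e.symm i))]
        simp
      rw [this i (by simp)]
      exact (mono_self (M := N) (N := N) (fun i => i) (fun i => 𝟙 _) i).symm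
    · rw [mono_ne _ _ (by simpa using h), mono_ne _ _ (by simpa using h)]

end MatAux

open MatAux

variable [MonoidalCategory E] [MonoidalPreadditive E]

instance : MonoidalCategoryStruct (Mat_ E) where
  tensorObj M N := ⟨M.ι × N.ι, fun p => M.X p.1 ⊗ N.X p.2⟩
  tensorHom f g := fun p q => f p.1 q.1 ⊗ₘ g p.2 q.2
  whiskerLeft M _ _ g := fun p q => (𝟙 M : M ⟶ M) p.1 q.1 ⊗ₘ g p.2 q.2
  whiskerRight f N := fun p q => f p.1 q.1 ⊗ₘ (𝟙 N : N ⟶ N) p.2 q.2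
  tensorUnit := ⟨PUnit, fun _ => 𝟙_ E⟩
  associator M N L := monoIso (M := ⟨(M.ι × N.ι) × L.ι, fun p => (M.X p.1.1 ⊗ N.X p.1.2) ⊗ L.X p.2⟩)
    (N := ⟨M.ι × (N.ι × L.ι), fun p => M.X p.1 ⊗ (N.X p.2.1 ⊗ L.X p.2.2)⟩)
    (Equiv.prodAssoc _ _ _) (fun p => α_ (M.X p.1.1) (N.X p.1.2) (L.X p.2))
  leftUnitor M := monoIso (M := ⟨PUnit × M.ι, fun p => 𝟙_ E ⊗ M.X p.2⟩)
    (Equiv.punitProd _) (fun p => λ_ (M.X p.2))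
  rightUnitor M := monoIso (M := ⟨M.ι × PUnit, fun p => M.X p.1 ⊗ 𝟙_ E⟩)
    (Equiv.prodPUnit _) (fun p => ρ_ (M.X p.1))

namespace MatAux

theorem tensor_apply {M M' N N' : Mat_ E} (f : M ⟶ M') (g : N ⟶ N') (p : M.ι × N.ι)
    (q : M'.ι × N'.ι) : (f ⊗ₘ g) p q = f p.1 q.1 ⊗ₘ g p.2 q.2 := rfl

theorem whiskerLeft_eq (M : Mat_ E) {N N' : Mat_ E} (g : N ⟶ N') : M ◁ g = 𝟙 M ⊗ₘ g := rfl

theorem whiskerRight_eq {M M' : Mat_ E} (f : M ⟶ M') (N : Mat_ E) : f ▷ N = f ⊗ₘ 𝟙 N := rfl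

theorem tensor_comp {M M' M'' N N' N'' : Mat_ E} (f : M ⟶ M') (f' : M' ⟶ M'') (g : N ⟶ N')
    (g' : N' ⟶ N'') : (f ⊗ₘ g) ≫ (f' ⊗ₘ g') = (f ≫ f') ⊗ₘ (g ≫ g') := by
  refine MatAux.hom_ext ?_
  rintro ⟨i, j⟩ ⟨i'', j''⟩
  rw [Mat_.comp_apply, tensor_apply, Mat_.comp_apply, Mat_.comp_apply, sum_tensor]
  simp only [tensor_sum]
  refine (Fintype.sum_prod_type _).trans ?_
  simp only [tensor_apply, MonoidalCategory.tensorHom_comp_tensorHom]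

theorem mono_tensor_mono {M M' N N' : Mat_ E} (e : M.ι → M'.ι) (φ : ∀ i, M.X i ⟶ M'.X (e i))
    (e' : N.ι → N'.ι) (φ' : ∀ i, N.X i ⟶ N'.X (e' i)) :
    mono e φ ⊗ₘ mono e' φ' = mono (M := M ⊗ N) (N := M' ⊗ N')
      (fun p : M.ι × N.ι => ((e p.1, e' p.2) : M'.ι × N'.ι))
      (fun p : M.ι × N.ι => φ p.1 ⊗ₘ φ' p.2) := by
  refine MatAux.hom_ext ?_
  rintro ⟨i, j⟩ ⟨i', j'⟩
  rw [tensor_apply]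
  by_cases h : e i = i'
  · subst h
    by_cases h : e' j = j'
    · subst h
      rw [mono_self, mono_self]
      exact (mono_self (M := M ⊗ N) (N := M' ⊗ N')
        (fun p : M.ι × N.ι => ((e p.1, e' p.2) : M'.ι × N'.ι))
        (fun p : M.ι × N.ι => φ p.1 ⊗ₘ φ' p.2) (i, j)).symm
    · rw [mono_ne _ φ' h]
      refine Eq.trans (by simp) (mono_ne (M := M ⊗ N) (N := M' ⊗ N')
        (fun p : M.ι × N.ι => ((e p.1, e' p.2) : M'.ι × N'.ι))
        (fun p : M.ι × N.ι => φ p.1 ⊗ₘ φ' p.2) (i := (i, j)) (j := (e i, j')) ?_).symm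
      exact fun h' => h (Prod.ext_iff.mp h').2
  · rw [mono_ne _ φ h]
    refine Eq.trans (by simp) (mono_ne (M := M ⊗ N) (N := M' ⊗ N')
      (fun p : M.ι × N.ι => ((e p.1, e' p.2) : M'.ι × N'.ι))
      (fun p : M.ι × N.ι => φ p.1 ⊗ₘ φ' p.2) (i := (i, j)) (j := (i', j')) ?_).symm
    exact fun h' => h (Prod.ext_iff.mp h').1

theorem id_tensor_id (M N : Mat_ E) : 𝟙 M ⊗ₘ 𝟙 N = 𝟙 (M ⊗ N) := by
  rw [id_eq_mono M, id_eq_mono N, mono_tensor_mono, id_eq_mono]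
  congr 1
  funext p
  exact id_tensorHom_id _ _

theorem assoc_nat {X X' Y Y' Z Z' : Mat_ E} (f : X ⟶ X') (g : Y ⟶ Y') (h : Z ⟶ Z') :
    ((f ⊗ₘ g) ⊗ₘ h) ≫ (α_ X' Y' Z').hom = (α_ X Y Z).hom ≫ (f ⊗ₘ (g ⊗ₘ h)) := by
  refine MatAux.hom_ext fun p q => ?_
  obtain ⟨q, rfl⟩ := (Equiv.prodAssoc X'.ι Y'.ι Z'.ι).surjective q
  refine (comp_mono_apply _ _ (Equiv.injective _) _ _ _).trans ?_
  refine Eq.trans ?_ (mono_comp_apply _ _ _ _ _).symm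
  exact associator_naturality _ _ _

end MatAux

instance : MonoidalCategory (Mat_ E) :=
  MonoidalCategory.ofTensorHom
    (id_tensorHom_id := id_tensor_id)
    (id_tensorHom := fun _ _ _ _ => rfl)
    (tensorHom_id := fun _ _ => rfl)
    (tensorHom_comp_tensorHom := fun f g f' g' => tensor_comp f f' g g')
    (associator_naturality := assoc_nat)
    (leftUnitor_naturality := fun {X Y} f => by
      refine MatAux.hom_ext fun p q => ?_
      obtain ⟨q, rfl⟩ := (Equiv.punitProd Y.ι).surjective q
      refine (comp_mono_apply _ _ (Equiv.injective _) _ _ _).trans ?_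
      refine Eq.trans ?_ (mono_comp_apply _ _ _ _ _).symm
      obtain ⟨⟨⟩, p⟩ := p
      obtain ⟨⟨⟩, q⟩ := q
      change ((𝟙 (𝟙_ (Mat_ E)) : 𝟙_ (Mat_ E) ⟶ 𝟙_ (Mat_ E)) PUnit.unit PUnit.unit ⊗ₘ f p q) ≫
        (λ_ _).hom = (λ_ _).hom ≫ f p q
      rw [Mat_.id_apply_self, MonoidalCategory.id_tensorHom]
      exact leftUnitor_naturality _)
    (rightUnitor_naturality := fun {X Y} f => by
      refine MatAux.hom_ext fun p q => ?_
      obtain ⟨q, rfl⟩ := (Equiv.prodPUnit Y.ι).surjective q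
      refine (comp_mono_apply _ _ (Equiv.injective _) _ _ _).trans ?_
      refine Eq.trans ?_ (mono_comp_apply _ _ _ _ _).symm
      obtain ⟨p, ⟨⟩⟩ := p
      obtain ⟨q, ⟨⟩⟩ := q
      change (f p q ⊗ₘ (𝟙 (𝟙_ (Mat_ E)) : 𝟙_ (Mat_ E) ⟶ 𝟙_ (Mat_ E)) PUnit.unit PUnit.unit) ≫
        (ρ_ _).hom = (ρ_ _).hom ≫ f p q
      rw [Mat_.id_apply_self, MonoidalCategory.tensorHom_id]
      exact rightUnitor_naturality _)
    (pentagon := fun X Y Z W => by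
      change (mono _ _ ⊗ₘ 𝟙 W) ≫ mono _ _ ≫ (𝟙 X ⊗ₘ mono _ _) = mono _ _ ≫ mono _ _
      rw [id_eq_mono W, id_eq_mono X, mono_tensor_mono]
      erw [mono_tensor_mono, mono_comp_mono, mono_comp_mono, mono_comp_mono]
      congr 1
      funext p
      change ((α_ _ _ _).hom ⊗ₘ 𝟙 _) ≫ (α_ _ _ _).hom ≫ (𝟙 _ ⊗ₘ (α_ _ _ _).hom) =
        (α_ _ _ _).hom ≫ (α_ _ _ _).hom
      simp)
    (triangle := fun X Y => by
      change mono _ _ ≫ (𝟙 X ⊗ₘ mono _ _) = (mono _ _ ⊗ₘ 𝟙 Y)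
      rw [id_eq_mono X, id_eq_mono Y]
      erw [mono_tensor_mono, mono_tensor_mono, mono_comp_mono]
      congr 1
      funext p
      change (α_ _ _ _).hom ≫ (𝟙 _ ⊗ₘ (λ_ _).hom) = ((ρ_ _).hom ⊗ₘ 𝟙 _)
      simp)

end MatMonoidal

section MatAction

open scoped MonoidalRightAction

/-- An action of a preadditive monoidal category which is additive in both variables. -/
class AdditiveAction (E : Type*) [Category E] [Preadditive E] [MonoidalCategory E]
    (D : Type*) [Category D] [Preadditive D] [MonoidalRightAction E D] : Prop where
  right_add : ∀ (d : D) {c c' : E} (f f' : c ⟶ c'), d ⊴ᵣ (f + f') = d ⊴ᵣ f + d ⊴ᵣ f'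
  left_add : ∀ {d d' : D} (f f' : d ⟶ d') (c : E), (f + f') ⊵ᵣ c = f ⊵ᵣ c + f' ⊵ᵣ c

variable {E : Type*} [Category E] [Preadditive E] [MonoidalCategory E] [MonoidalPreadditive E]
  {D : Type u} [Category.{v} D] [Preadditive D] [HasFiniteBiproducts D]
  [MonoidalRightAction E D] [AdditiveAction E D]

namespace MatAction

open MatAux

/-- The functor `- ⊗ c`. -/
@[simps]
def actL (D : Type u) [Category.{v} D] [MonoidalRightAction E D] (c : E) : D ⥤ D where
  obj d := d ⊙ᵣ c
  map f := f ⊵ᵣ c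
  map_comp f g := by simp

/-- The functor `d ⊗ -`. -/
@[simps]
def actR (E : Type*) [Category E] [MonoidalCategory E] [MonoidalRightAction E D] (d : D) :
    E ⥤ D where
  obj c := d ⊙ᵣ c
  map f := d ⊴ᵣ f
  map_comp f g := by simp

instance (c : E) : (actL D c).Additive where
  map_add := AdditiveAction.left_add _ _ _

instance (d : D) : (actR E d).Additive where
  map_add := AdditiveAction.right_add _ _ _

theorem right_zero (d : D) (c c' : E) : d ⊴ᵣ (0 : c ⟶ c') = 0 := (actR E d).map_zero c c'

theorem left_zero (d d' : D) (c : E) : (0 : d ⟶ d') ⊵ᵣ c = 0 := (actL D c).map_zero d d'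

theorem right_sum (d : D) {c c' : E} {J : Type*} (s : Finset J) (f : J → (c ⟶ c')) :
    d ⊴ᵣ (∑ j ∈ s, f j) = ∑ j ∈ s, d ⊴ᵣ (f j) := (actR E d).map_sum f s

theorem left_sum {d d' : D} (c : E) {J : Type*} (s : Finset J) (f : J → (d ⟶ d')) :
    (∑ j ∈ s, f j) ⊵ᵣ c = ∑ j ∈ s, (f j) ⊵ᵣ c := (actL D c).map_sum f s

/-- The result `⨁ᵢ d ⊗ Xᵢ` of the action on `d` of a formal sum of the objects `Xᵢ`. -/
abbrev obj (d : D) (X : Mat_ E) : D := ⨁ fun i => d ⊙ᵣ X.X i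

/-- The inclusion of a summand. -/
abbrev inc (d : D) (X : Mat_ E) (i : X.ι) : d ⊙ᵣ X.X i ⟶ obj d X :=
  biproduct.ι (fun i => d ⊙ᵣ X.X i) i

/-- The projection to a summand. -/
abbrev prj (d : D) (X : Mat_ E) (i : X.ι) : obj d X ⟶ d ⊙ᵣ X.X i :=
  biproduct.π (fun i => d ⊙ᵣ X.X i) i

theorem ext_inc {d d' : D} {X : Mat_ E} {f g : obj d X ⟶ d'}
    (h : ∀ i, inc d X i ≫ f = inc d X i ≫ g) : f = g := biproduct.hom_ext' _ _ h

/-- Functoriality in the module variable. -/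
def mapL {d d' : D} (f : d ⟶ d') (X : Mat_ E) : obj d X ⟶ obj d' X :=
  biproduct.desc fun i => f ⊵ᵣ X.X i ≫ inc d' X i

/-- Functoriality in the acting variable. -/
def mapR (d : D) {X Y : Mat_ E} (f : X ⟶ Y) : obj d X ⟶ obj d Y :=
  biproduct.desc fun i => ∑ j, d ⊴ᵣ (f i j) ≫ inc d Y j

theorem inc_mapL {d d' : D} (f : d ⟶ d') (X : Mat_ E) (i : X.ι) :
    inc d X i ≫ mapL f X = f ⊵ᵣ X.X i ≫ inc d' X i := by
  simp [mapL]

theorem inc_mapR (d : D) {X Y : Mat_ E} (f : X ⟶ Y) (i : X.ι) :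
    inc d X i ≫ mapR d f = ∑ j, d ⊴ᵣ (f i j) ≫ inc d Y j := by
  simp [mapR]

theorem inc_mapR_mono (d : D) {X Y : Mat_ E} (e : X.ι → Y.ι) (φ : ∀ i, X.X i ⟶ Y.X (e i))
    (i : X.ι) : inc d X i ≫ mapR d (mono e φ) = d ⊴ᵣ φ i ≫ inc d Y (e i) := by
  rw [inc_mapR, Finset.sum_eq_single (e i)]
  · rw [mono_self]
  · intro j _ hj
    rw [mono_ne e φ hj.symm, right_zero, zero_comp]
  · simp

theorem mapL_id (d : D) (X : Mat_ E) : mapL (𝟙 d) X = 𝟙 _ :=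
  ext_inc fun i => by rw [inc_mapL]; simp

theorem mapL_comp {d d' d'' : D} (f : d ⟶ d') (g : d' ⟶ d'') (X : Mat_ E) :
    mapL (f ≫ g) X = mapL f X ≫ mapL g X :=
  ext_inc fun i => by
    rw [inc_mapL, ← Category.assoc, inc_mapL, Category.assoc, inc_mapL]; simp

theorem mapR_id (d : D) (X : Mat_ E) : mapR d (𝟙 X) = 𝟙 _ :=
  ext_inc fun i => by rw [id_eq_mono, inc_mapR_mono]; simp

theorem mapR_comp (d : D) {X Y Z : Mat_ E} (f : X ⟶ Y) (g : Y ⟶ Z) :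
    mapR d (f ≫ g) = mapR d f ≫ mapR d g :=
  ext_inc fun i => by
    rw [inc_mapR, ← Category.assoc, inc_mapR, Preadditive.sum_comp]
    simp only [Mat_.comp_apply, right_sum, Preadditive.sum_comp, Category.assoc, inc_mapR,
      Preadditive.comp_sum, MonoidalRightAction.actionHomRight_comp]
    rw [Finset.sum_comm]

theorem exchange {d d' : D} (f : d ⟶ d') {X Y : Mat_ E} (g : X ⟶ Y) :
    mapL f X ≫ mapR d' g = mapR d g ≫ mapL f Y :=
  ext_inc fun i => by
    rw [← Category.assoc, ← Category.assoc, inc_mapL, inc_mapR, Category.assoc, inc_mapR,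
      Preadditive.comp_sum, Preadditive.sum_comp]
    refine Finset.sum_congr rfl fun j _ => ?_
    rw [Category.assoc, inc_mapL, ← Category.assoc, ← Category.assoc]
    congr 1
    rw [← MonoidalRightAction.actionHom_def, ← MonoidalRightAction.actionHom_def']

/-- The associativity constraint. -/
def assocInv (d : D) (X Y : Mat_ E) : obj (obj d X) Y ⟶ obj d (X ⊗ Y) :=
  biproduct.desc fun j => ∑ i, (prj d X i) ⊵ᵣ Y.X j ≫ (αᵣ d (X.X i) (Y.X j)).inv ≫
    inc d (X ⊗ Y) (i, j)

/-- The inverse associativity constraint. -/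
def assocHom (d : D) (X Y : Mat_ E) : obj d (X ⊗ Y) ⟶ obj (obj d X) Y :=
  biproduct.desc fun p : X.ι × Y.ι => (αᵣ d (X.X p.1) (Y.X p.2)).hom ≫
    (inc d X p.1) ⊵ᵣ Y.X p.2 ≫ inc (obj d X) Y p.2

/-- The inclusion of a summand in a two-fold action. -/
def inc₂ (d : D) (X Y : Mat_ E) (i : X.ι) (j : Y.ι) :
    (d ⊙ᵣ X.X i) ⊙ᵣ Y.X j ⟶ obj (obj d X) Y := inc d X i ⊵ᵣ Y.X j ≫ inc (obj d X) Y j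

theorem ext_inc_left {d d' : D} {X : Mat_ E} {c : E} {f g : (obj d X) ⊙ᵣ c ⟶ d'}
    (h : ∀ i, inc d X i ⊵ᵣ c ≫ f = inc d X i ⊵ᵣ c ≫ g) : f = g := by
  have e : ∀ q : (obj d X) ⊙ᵣ c ⟶ d',
      q = ∑ i, prj d X i ⊵ᵣ c ≫ inc d X i ⊵ᵣ c ≫ q := by
    intro q
    simp only [← Category.assoc, ← MonoidalRightAction.comp_actionHomLeft,
      ← Preadditive.sum_comp, ← left_sum, biproduct_total]
    simp
  rw [e f, e g]
  exact Finset.sum_congr rfl fun i _ => by rw [h i]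

theorem ext_inc₂ {d d' : D} {X Y : Mat_ E} {f g : obj (obj d X) Y ⟶ d'}
    (h : ∀ i j, inc₂ d X Y i j ≫ f = inc₂ d X Y i j ≫ g) : f = g := by
  refine ext_inc fun j => ext_inc_left fun i => ?_
  have := h i j
  simpa only [inc₂, Category.assoc] using this

theorem inc₂_assocInv (d : D) (X Y : Mat_ E) (i : X.ι) (j : Y.ι) :
    inc₂ d X Y i j ≫ assocInv d X Y =
      (αᵣ d (X.X i) (Y.X j)).inv ≫ inc d (X ⊗ Y) ((i, j) : X.ι × Y.ι) := by
  classical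
  rw [inc₂, assocInv, Category.assoc, biproduct.ι_desc, Preadditive.comp_sum,
    Finset.sum_eq_single i]
  · rw [← Category.assoc, ← MonoidalRightAction.comp_actionHomLeft, biproduct.ι_π_self]
    simp
  · intro k _ hk
    rw [← Category.assoc, ← MonoidalRightAction.comp_actionHomLeft, biproduct.ι_π_ne _ hk.symm,
      left_zero, zero_comp]
  · simp

theorem inc_assocHom (d : D) (X Y : Mat_ E) (i : X.ι) (j : Y.ι) :
    inc d (X ⊗ Y) ((i, j) : X.ι × Y.ι) ≫ assocHom d X Y =
      (αᵣ d (X.X i) (Y.X j)).hom ≫ inc₂ d X Y i j :=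
  biproduct.ι_desc _ _

/-- The associativity constraint, as an isomorphism. -/
def assocIso (d : D) (X Y : Mat_ E) : obj d (X ⊗ Y) ≅ obj (obj d X) Y where
  hom := assocHom d X Y
  inv := assocInv d X Y
  hom_inv_id := ext_inc fun p => by
    obtain ⟨i, j⟩ := p
    rw [reassoc_of% (inc_assocHom d X Y i j), inc₂_assocInv]
    simp
  inv_hom_id := ext_inc₂ fun i j => by
    rw [reassoc_of% (inc₂_assocInv d X Y i j), inc_assocHom]
    simp

/-- The unit constraint. -/
def unitIso (d : D) : obj d (𝟙_ (Mat_ E)) ≅ d where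
  hom := biproduct.desc fun _ => (ρᵣ[E] d).hom
  inv := (ρᵣ[E] d).inv ≫ inc d (𝟙_ (Mat_ E)) PUnit.unit
  hom_inv_id := ext_inc fun i => by
    cases i
    rw [← Category.assoc, biproduct.ι_desc]
    simp
  inv_hom_id := by
    rw [Category.assoc, biproduct.ι_desc]
    simp

theorem inc_unitIso (d : D) (i : PUnit) :
    inc d (𝟙_ (Mat_ E)) i ≫ (unitIso (E := E) d).hom = (ρᵣ[E] d).hom :=
  biproduct.ι_desc _ _

theorem inc_mapR_tensor (d : D) {X X' Y Y' : Mat_ E} (f : X ⟶ X') (g : Y ⟶ Y') (i : X.ι)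
    (j : Y.ι) : inc d (X ⊗ Y) ((i, j) : X.ι × Y.ι) ≫ mapR d (f ⊗ₘ g) =
      ∑ i', ∑ j', d ⊴ᵣ (f i i' ⊗ₘ g j j') ≫ inc d (X' ⊗ Y') ((i', j') : X'.ι × Y'.ι) := by
  rw [inc_mapR]
  exact Fintype.sum_prod_type _

theorem id_apply_sum {X : Mat_ E} {A : Type*} [AddCommMonoid A] (i : X.ι)
    (F : ∀ j, (X.X i ⟶ X.X j) → A) (hF : ∀ j, F j 0 = 0) :
    ∑ j, F j ((𝟙 X : X ⟶ X) i j) = F i (𝟙 _) := by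
  rw [Finset.sum_eq_single i]
  · rw [Mat_.id_apply_self]
  · intro j _ hj
    rw [Mat_.id_apply_of_ne _ _ _ hj.symm, hF]
  · simp

theorem inc_mapR_whiskerRight (d : D) {X X' : Mat_ E} (f : X ⟶ X') (Y : Mat_ E) (i : X.ι)
    (j : Y.ι) : inc d (X ⊗ Y) ((i, j) : X.ι × Y.ι) ≫ mapR d (f ▷ Y) =
      ∑ i', d ⊴ᵣ (f i i' ▷ Y.X j) ≫ inc d (X' ⊗ Y) ((i', j) : X'.ι × Y.ι) := by
  refine (inc_mapR_tensor d f (𝟙 Y) i j).trans (Finset.sum_congr rfl fun i' _ => ?_)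
  refine (id_apply_sum j (fun j' t => d ⊴ᵣ (f i i' ⊗ₘ t) ≫
    inc d (X' ⊗ Y) ((i', j') : X'.ι × Y.ι)) fun j' => ?_).trans ?_
  · simp [right_zero]
  · simp

theorem inc_mapR_whiskerLeft (d : D) (Y : Mat_ E) {X X' : Mat_ E} (f : X ⟶ X') (j : Y.ι)
    (i : X.ι) : inc d (Y ⊗ X) ((j, i) : Y.ι × X.ι) ≫ mapR d (Y ◁ f) =
      ∑ i', d ⊴ᵣ (Y.X j ◁ f i i') ≫ inc d (Y ⊗ X') ((j, i') : Y.ι × X'.ι) := by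
  refine (inc_mapR_tensor d (𝟙 Y) f j i).trans ?_
  rw [Finset.sum_comm]
  refine Finset.sum_congr rfl fun i' _ => ?_
  refine (id_apply_sum j (fun j' t => d ⊴ᵣ (t ⊗ₘ f i i') ≫
    inc d (Y ⊗ X') ((j', i') : Y.ι × X'.ι)) fun j' => ?_).trans ?_
  · simp [right_zero]
  · simp

theorem inc₂_mapL_mapL {d d' : D} (f : d ⟶ d') (X Y : Mat_ E) (i : X.ι) (j : Y.ι) :
    inc₂ d X Y i j ≫ mapL (mapL f X) Y = (f ⊵ᵣ X.X i) ⊵ᵣ Y.X j ≫ inc₂ d' X Y i j := by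
  rw [inc₂, Category.assoc, inc_mapL, ← Category.assoc, ← MonoidalRightAction.comp_actionHomLeft,
    inc_mapL]
  simp [inc₂]

theorem inc₂_mapL_mapR (d : D) {X X' : Mat_ E} (f : X ⟶ X') (Y : Mat_ E) (i : X.ι) (j : Y.ι) :
    inc₂ d X Y i j ≫ mapL (mapR d f) Y =
      ∑ i', (d ⊴ᵣ f i i') ⊵ᵣ Y.X j ≫ inc₂ d X' Y i' j := by
  rw [inc₂, Category.assoc, inc_mapL, ← Category.assoc, ← MonoidalRightAction.comp_actionHomLeft,
    inc_mapR, left_sum, Preadditive.sum_comp]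
  simp [inc₂]

theorem inc₂_mapR (d : D) (X : Mat_ E) {Y Y' : Mat_ E} (f : Y ⟶ Y') (i : X.ι) (j : Y.ι) :
    inc₂ d X Y i j ≫ mapR (obj d X) f =
      ∑ j', (d ⊙ᵣ X.X i) ⊴ᵣ f j j' ≫ inc₂ d X Y' i j' := by
  rw [inc₂, Category.assoc, inc_mapR, Preadditive.comp_sum]
  refine Finset.sum_congr rfl fun j' _ => ?_
  rw [inc₂, ← Category.assoc, ← Category.assoc, ← MonoidalRightAction.actionHom_def,
    ← MonoidalRightAction.actionHom_def']

theorem assoc_nat₁ {d d' : D} (f : d ⟶ d') (X Y : Mat_ E) :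
    mapL (mapL f X) Y ≫ assocInv d' X Y = assocInv d X Y ≫ mapL f (X ⊗ Y) :=
  ext_inc₂ fun i j => by
    rw [reassoc_of% (inc₂_mapL_mapL f X Y i j), inc₂_assocInv,
      reassoc_of% (inc₂_assocInv d X Y i j), inc_mapL]
    change _ = (αᵣ d (X.X i) (Y.X j)).inv ≫ f ⊵ᵣ (X.X i ⊗ Y.X j) ≫ _
    simp

theorem assoc_nat₂ (d : D) {X X' : Mat_ E} (f : X ⟶ X') (Y : Mat_ E) :
    mapL (mapR d f) Y ≫ assocInv d X' Y = assocInv d X Y ≫ mapR d (f ▷ Y) :=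
  ext_inc₂ fun i j => by
    rw [← Category.assoc, inc₂_mapL_mapR, reassoc_of% (inc₂_assocInv d X Y i j),
      inc_mapR_whiskerRight, Preadditive.sum_comp, Preadditive.comp_sum]
    refine Finset.sum_congr rfl fun i' _ => ?_
    rw [Category.assoc, inc₂_assocInv]
    simp

theorem assoc_nat₃ (d : D) (X : Mat_ E) {Y Y' : Mat_ E} (f : Y ⟶ Y') :
    mapR (obj d X) f ≫ assocInv d X Y' = assocInv d X Y ≫ mapR d (X ◁ f) :=
  ext_inc₂ fun i j => by
    rw [← Category.assoc, inc₂_mapR, reassoc_of% (inc₂_assocInv d X Y i j),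
      inc_mapR_whiskerLeft, Preadditive.sum_comp, Preadditive.comp_sum]
    refine Finset.sum_congr rfl fun i' _ => ?_
    rw [Category.assoc, inc₂_assocInv]
    simp

theorem ext_inc_left₂ {d d' : D} {X Y : Mat_ E} {c : E} {f g : (obj (obj d X) Y) ⊙ᵣ c ⟶ d'}
    (h : ∀ i j, inc₂ d X Y i j ⊵ᵣ c ≫ f = inc₂ d X Y i j ⊵ᵣ c ≫ g) : f = g := by
  refine ext_inc_left fun j => ?_
  have e : ∀ q : (obj d X ⊙ᵣ Y.X j) ⊙ᵣ c ⟶ d',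
      q = ∑ i, (prj d X i ⊵ᵣ Y.X j) ⊵ᵣ c ≫ (inc d X i ⊵ᵣ Y.X j) ⊵ᵣ c ≫ q := by
    intro q
    simp only [← Category.assoc, ← MonoidalRightAction.comp_actionHomLeft,
      ← Preadditive.sum_comp, ← left_sum, biproduct_total]
    simp
  rw [e (_ ≫ f), e (_ ≫ g)]
  refine Finset.sum_congr rfl fun i _ => ?_
  have := h i j
  simp only [inc₂, MonoidalRightAction.comp_actionHomLeft, Category.assoc] at this
  rw [this]

theorem inc₂_inc (d : D) (X Y : Mat_ E) (Z : Mat_ E) (i : X.ι) (j : Y.ι) (k : Z.ι) :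
    inc₂ d X Y i j ⊵ᵣ Z.X k ≫ inc _ Z k =
      (inc d X i ⊵ᵣ Y.X j) ⊵ᵣ Z.X k ≫ inc₂ (obj d X) Y Z j k := by
  simp [inc₂]

theorem pentagon_inv (d : D) (a b c : E) : (αᵣ (d ⊙ᵣ a) b c).inv ≫ (αᵣ d a (b ⊗ c)).inv =
    (αᵣ d a b).inv ⊵ᵣ c ≫ (αᵣ d (a ⊗ b) c).inv ≫ d ⊴ᵣ (α_ a b c).hom := by
  have := MonoidalRightAction.actionHom_associator a b c d
  rw [← Iso.inv_comp_eq] at this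
  rw [← cancel_epi ((αᵣ d a b).hom ⊵ᵣ c), ← MonoidalRightAction.comp_actionHomLeft_assoc, ← this]
  simp only [Iso.hom_inv_id, Category.assoc, Iso.hom_inv_id_assoc, Category.comp_id,
    MonoidalRightAction.id_actionHomLeft, Category.id_comp]

theorem pentagon (d : D) (X Y Z : Mat_ E) :
    assocInv (obj d X) Y Z ≫ assocInv d X (Y ⊗ Z) =
      mapL (assocInv d X Y) Z ≫ assocInv d (X ⊗ Y) Z ≫ mapR d (α_ X Y Z).hom := by
  refine ext_inc fun k => ext_inc_left₂ fun i j => ?_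
  have h₁ := inc₂_inc d X Y Z i j k
  have h₂ := inc₂_assocInv (obj d X) Y Z j k
  have h₃ : (inc d X i ⊵ᵣ Y.X j) ⊵ᵣ Z.X k ≫ (αᵣ (obj d X) (Y.X j) (Z.X k)).inv ≫
      inc (obj d X) (Y ⊗ Z) ((j, k) : Y.ι × Z.ι) = (αᵣ _ (Y.X j) (Z.X k)).inv ≫
        inc₂ d X (Y ⊗ Z) i ((j, k) : Y.ι × Z.ι) := by
    change _ = _ ≫ inc d X i ⊵ᵣ (Y.X j ⊗ Z.X k) ≫ _
    simp
  have h₄ := inc₂_assocInv d X (Y ⊗ Z) i ((j, k) : Y.ι × Z.ι)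
  have h₅ : inc₂ d X Y i j ⊵ᵣ Z.X k ≫ inc _ Z k ≫ mapL (assocInv d X Y) Z =
      (αᵣ d (X.X i) (Y.X j)).inv ⊵ᵣ Z.X k ≫ inc₂ d (X ⊗ Y) Z ((i, j) : X.ι × Y.ι) k := by
    rw [inc_mapL, ← MonoidalRightAction.comp_actionHomLeft_assoc, inc₂_assocInv, inc₂]
    simp only [MonoidalRightAction.comp_actionHomLeft, Category.assoc]
  have h₆ := inc₂_assocInv d (X ⊗ Y) Z ((i, j) : X.ι × Y.ι) k
  have h₇ := inc_mapR_mono d (X := (X ⊗ Y) ⊗ Z) (Y := X ⊗ (Y ⊗ Z)) (Equiv.prodAssoc X.ι Y.ι Z.ι)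
    (fun p => (α_ (X.X p.1.1) (Y.X p.1.2) (Z.X p.2)).hom) ((i, j), k)
  rw [reassoc_of% h₁, reassoc_of% h₂, reassoc_of% h₃, h₄, reassoc_of% h₅, reassoc_of% h₆]
  refine Eq.trans ?_ (congrArg (fun t => (αᵣ d (X.X i) (Y.X j)).inv ⊵ᵣ Z.X k ≫
    (αᵣ d (X.X i ⊗ Y.X j) (Z.X k)).inv ≫ t) h₇).symm
  exact (reassoc_of% (pentagon_inv d (X.X i) (Y.X j) (Z.X k))) _

theorem leftUnit (d : D) (X : Mat_ E) :
    assocInv d (𝟙_ (Mat_ E)) X ≫ mapR d (λ_ X).hom = mapL (unitIso (E := E) d).hom X :=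
  ext_inc₂ fun i j => by
    rw [reassoc_of% (inc₂_assocInv d (𝟙_ (Mat_ E)) X i j)]
    cases i
    have h := inc_mapR_mono d (X := 𝟙_ (Mat_ E) ⊗ X) (Equiv.punitProd X.ι)
      (fun p => (λ_ (X.X p.2)).hom) (PUnit.unit, j)
    have h' := inc_unitIso (E := E) d PUnit.unit
    refine (congrArg (fun t => (αᵣ d (𝟙_ E) (X.X j)).inv ≫ t) h).trans ?_
    rw [inc₂, Category.assoc, inc_mapL, ← MonoidalRightAction.comp_actionHomLeft_assoc, h',
      ← Category.assoc]
    congr 1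
    have gen : ∀ c : E, (αᵣ d (𝟙_ E) c).inv ≫ d ⊴ᵣ (λ_ c).hom = (ρᵣ[E] d).hom ⊵ᵣ c := by
      intro c; simp
    exact gen _

theorem rightUnit (d : D) (X : Mat_ E) :
    assocInv d X (𝟙_ (Mat_ E)) ≫ mapR d (ρ_ X).hom = (unitIso (E := E) (obj d X)).hom :=
  ext_inc₂ fun i j => by
    rw [reassoc_of% (inc₂_assocInv d X (𝟙_ (Mat_ E)) i j)]
    cases j
    have h := inc_mapR_mono d (X := X ⊗ 𝟙_ (Mat_ E)) (Equiv.prodPUnit X.ι)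
      (fun p => (ρ_ (X.X p.1)).hom) (i, PUnit.unit)
    have h' := inc_unitIso (E := E) (obj d X) PUnit.unit
    refine (congrArg (fun t => (αᵣ d (X.X i) (𝟙_ E)).inv ≫ t) h).trans ?_
    rw [inc₂, Category.assoc, h']
    change (αᵣ d (X.X i) (𝟙_ E)).inv ≫ d ⊴ᵣ (ρ_ (X.X i)).hom ≫ inc d X i = inc d X i ⊵ᵣ 𝟙_ E ≫ _
    simp

end MatAction

instance : MonoidalRightActionStruct (Mat_ E) D where
  actionObj d X := MatAction.obj d X
  actionHomLeft f X := MatAction.mapL f X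
  actionHomRight d _ _ f := MatAction.mapR d f
  actionAssocIso d X Y := MatAction.assocIso d X Y
  actionUnitIso d := MatAction.unitIso d

instance : MonoidalRightAction (Mat_ E) D :=
  rightActionOfWhisker (fun _ _ => rfl)
    (fun X d => MatAction.mapR_id d X)
    (fun X d => MatAction.mapL_id d X)
    (fun d _ _ _ f g => MatAction.mapR_comp d f g)
    (fun f g X => MatAction.mapL_comp f g X)
    (fun f g => MatAction.exchange f g)
    (fun f X Y => MatAction.assoc_nat₁ f X Y)
    (fun d _ _ f X => MatAction.assoc_nat₂ d f X)
    (fun d X _ _ f => MatAction.assoc_nat₃ d X f)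
    (fun {d d'} f => MatAction.ext_inc fun i => by
      cases i
      refine ((reassoc_of% (MatAction.inc_unitIso (E := E) d PUnit.unit)) f).trans ?_
      refine Eq.trans ?_ ((reassoc_of% (MatAction.inc_mapL f (𝟙_ (Mat_ E)) PUnit.unit)) _).symm
      refine Eq.trans ?_ (congrArg (fun t => f ⊵ᵣ (𝟙_ E) ≫ t)
        (MatAction.inc_unitIso (E := E) d' PUnit.unit)).symm
      exact MonoidalRightAction.actionUnitIso_hom_naturality f)
    (fun X Y Z d => MatAction.pentagon d X Y Z)
    (fun X d => MatAction.leftUnit d X)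
    (fun X d => MatAction.rightUnit d X)

end MatAction

section MatLinear

open scoped MonoidalRightAction

/-- An additive action which is linear in the module variable. -/
class LinearAction (𝕜 : Type*) [Field 𝕜] (E : Type*) [Category E] [Preadditive E]
    [MonoidalCategory E] (D : Type*) [Category D] [Preadditive D] [Linear 𝕜 D]
    [MonoidalRightAction E D] : Prop extends AdditiveAction E D where
  left_smul : ∀ {d d' : D} (a : 𝕜) (f : d ⟶ d') (c : E), (a • f) ⊵ᵣ c = a • f ⊵ᵣ c

variable {E : Type*} [Category E] [Preadditive E] [MonoidalCategory E] [MonoidalPreadditive E]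
  {D : Type u} [Category.{v} D] [Preadditive D] [HasFiniteBiproducts D]
  [MonoidalRightAction E D]

instance [AdditiveAction E D] : AdditiveAction (Mat_ E) D where
  right_add d X Y f f' := MatAction.ext_inc fun i => by
    change MatAction.inc d X i ≫ MatAction.mapR d (f + f') =
      MatAction.inc d X i ≫ (MatAction.mapR d f + MatAction.mapR d f')
    rw [Preadditive.comp_add]
    simp only [MatAction.inc_mapR, Mat_.add_apply, AdditiveAction.right_add,
      Preadditive.add_comp, Finset.sum_add_distrib]
  left_add {d d'} f f' X := MatAction.ext_inc fun i => by
    change MatAction.inc d X i ≫ MatAction.mapL (f + f') X =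
      MatAction.inc d X i ≫ (MatAction.mapL f X + MatAction.mapL f' X)
    rw [Preadditive.comp_add]
    simp only [MatAction.inc_mapL, AdditiveAction.left_add, Preadditive.add_comp]

instance {𝕜 : Type*} [Field 𝕜] [Linear 𝕜 D] [LinearAction 𝕜 E D] :
    LinearAction 𝕜 (Mat_ E) D where
  left_smul {d d'} a f X := MatAction.ext_inc fun i => by
    change MatAction.inc d X i ≫ MatAction.mapL (a • f) X =
      MatAction.inc d X i ≫ (a • MatAction.mapL f X)
    rw [Linear.comp_smul]
    simp only [MatAction.inc_mapL, LinearAction.left_smul, Linear.smul_comp]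

namespace MatAction

variable [AdditiveAction E D] (F : D ⥤ D) [F.Additive] [F.RightLinear E]

open Functor.LaxRightLinear Functor.OplaxRightLinear

theorem ext_map_inc {d d' : D} {X : Mat_ E} {f g : F.obj (obj d X) ⟶ d'}
    (h : ∀ i, F.map (inc d X i) ≫ f = F.map (inc d X i) ≫ g) : f = g := by
  have e : ∀ q : F.obj (obj d X) ⟶ d', q = ∑ i, F.map (prj d X i) ≫ F.map (inc d X i) ≫ q := by
    intro q
    simp only [← Category.assoc, ← F.map_comp, ← Preadditive.sum_comp, ← F.map_sum,
      biproduct_total]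
    simp
  rw [e f, e g]
  exact Finset.sum_congr rfl fun i _ => by rw [h i]

/-- The constraint of a module functor on formal sums. -/
def linDelta (d : D) (X : Mat_ E) : F.obj (obj d X) ⟶ obj (F.obj d) X :=
  ∑ i, F.map (prj d X i) ≫ δᵣ F d (X.X i) ≫ inc (F.obj d) X i

/-- The inverse constraint of a module functor on formal sums. -/
def linMu (d : D) (X : Mat_ E) : obj (F.obj d) X ⟶ F.obj (obj d X) :=
  biproduct.desc fun i => μᵣ F d (X.X i) ≫ F.map (inc d X i)

theorem inc_linDelta (d : D) (X : Mat_ E) (i : X.ι) :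
    F.map (inc d X i) ≫ linDelta F d X = δᵣ F d (X.X i) ≫ inc (F.obj d) X i := by
  classical
  rw [linDelta, Preadditive.comp_sum, Finset.sum_eq_single i]
  · rw [← Category.assoc, ← F.map_comp, biproduct.ι_π_self]
    simp
  · intro j _ hj
    rw [← Category.assoc, ← F.map_comp, biproduct.ι_π_ne _ hj.symm]
    simp
  · simp

theorem inc_linMu (d : D) (X : Mat_ E) (i : X.ι) :
    inc (F.obj d) X i ≫ linMu F d X = μᵣ F d (X.X i) ≫ F.map (inc d X i) :=
  biproduct.ι_desc _ _

theorem delta_mu (d : D) (X : Mat_ E) : linDelta F d X ≫ linMu F d X = 𝟙 _ :=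
  ext_map_inc F fun i => by
    rw [reassoc_of% (inc_linDelta F d X i), inc_linMu]
    simp

theorem mu_delta (d : D) (X : Mat_ E) : linMu F d X ≫ linDelta F d X = 𝟙 _ :=
  ext_inc fun i => by
    rw [reassoc_of% (inc_linMu F d X i), inc_linDelta]
    simp

theorem delta_nat_right (d : D) {X Y : Mat_ E} (f : X ⟶ Y) :
    F.map (mapR d f) ≫ linDelta F d Y = linDelta F d X ≫ mapR (F.obj d) f :=
  ext_map_inc F fun i => by
    rw [reassoc_of% (inc_linDelta F d X i), inc_mapR, ← Category.assoc, ← F.map_comp, inc_mapR,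
      F.map_sum, Preadditive.sum_comp, Preadditive.comp_sum]
    refine Finset.sum_congr rfl fun j _ => ?_
    rw [F.map_comp, Category.assoc, inc_linDelta]
    simp

theorem delta_nat_left {d d' : D} (f : d ⟶ d') (X : Mat_ E) :
    F.map (mapL f X) ≫ linDelta F d' X = linDelta F d X ≫ mapL (F.map f) X :=
  ext_map_inc F fun i => by
    rw [reassoc_of% (inc_linDelta F d X i), inc_mapL, ← Category.assoc, ← F.map_comp, inc_mapL]
    rw [F.map_comp, Category.assoc, inc_linDelta]
    simp

theorem ext_map_inc₂ {d d' : D} {X Y : Mat_ E} {f g : F.obj (obj (obj d X) Y) ⟶ d'}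
    (h : ∀ i j, F.map (inc₂ d X Y i j) ≫ f = F.map (inc₂ d X Y i j) ≫ g) : f = g := by
  refine ext_map_inc F fun j => ?_
  have e : ∀ q : F.obj ((obj d X) ⊙ᵣ Y.X j) ⟶ d',
      q = ∑ i, F.map (prj d X i ⊵ᵣ Y.X j) ≫ F.map (inc d X i ⊵ᵣ Y.X j) ≫ q := by
    intro q
    simp only [← Category.assoc, ← F.map_comp, ← MonoidalRightAction.comp_actionHomLeft,
      ← Preadditive.sum_comp, ← F.map_sum, ← left_sum, biproduct_total]
    simp
  rw [e (_ ≫ f), e (_ ≫ g)]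
  refine Finset.sum_congr rfl fun i _ => ?_
  have := h i j
  simp only [inc₂, F.map_comp, Category.assoc] at this
  rw [this]

theorem map_inc₂_delta (d : D) (X Y : Mat_ E) (i : X.ι) (j : Y.ι) :
    F.map (inc₂ d X Y i j) ≫ linDelta F (obj d X) Y ≫ mapL (linDelta F d X) Y =
      δᵣ F (d ⊙ᵣ X.X i) (Y.X j) ≫ δᵣ F d (X.X i) ⊵ᵣ Y.X j ≫ inc₂ (F.obj d) X Y i j := by
  rw [inc₂, F.map_comp, Category.assoc, reassoc_of% (inc_linDelta F (obj d X) Y j), inc_mapL,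
    δᵣ_naturality_left_assoc, ← MonoidalRightAction.comp_actionHomLeft_assoc, inc_linDelta]
  simp [inc₂]

theorem delta_assoc (d : D) (X Y : Mat_ E) :
    linDelta F (obj d X) Y ≫ mapL (linDelta F d X) Y ≫ assocInv (F.obj d) X Y =
      F.map (assocInv d X Y) ≫ linDelta F d (X ⊗ Y) :=
  ext_map_inc₂ F fun i j => by
    have h := map_inc₂_delta F d X Y i j
    have h₁ := inc_linDelta F d (X ⊗ Y) ((i, j) : X.ι × Y.ι)
    rw [reassoc_of% h, inc₂_assocInv, ← F.map_comp_assoc, inc₂_assocInv, F.map_comp,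
      Category.assoc, h₁]
    have := δᵣ_associativity_inv F d (X.X i) (Y.X j)
    exact (reassoc_of% this) _

theorem delta_unit (d : D) :
    linDelta F d (𝟙_ (Mat_ E)) ≫ (unitIso (E := E) (F.obj d)).hom =
      F.map (unitIso (E := E) d).hom :=
  ext_map_inc F fun i => by
    cases i
    rw [reassoc_of% (inc_linDelta F d (𝟙_ (Mat_ E)) PUnit.unit), inc_unitIso, ← F.map_comp,
      inc_unitIso]
    exact δᵣ_unitality_hom F d

end MatAction

end MatLinear

section RightLinear

open scoped MonoidalRightAction

variable {E : Type*} [Category E] [MonoidalCategory E] {D : Type*} [Category D]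
  [MonoidalRightAction E D]

/-- A module functor from its (invertible) constraint `F (d ⊗ c) ≅ F d ⊗ c`. -/
abbrev rightLinearOfIso (F : D ⥤ D) (δ : ∀ (d : D) (c : E), F.obj (d ⊙ᵣ c) ≅ F.obj d ⊙ᵣ c)
    (nat_right : ∀ (d : D) {c c' : E} (f : c ⟶ c'),
      F.map (d ⊴ᵣ f) ≫ (δ d c').hom = (δ d c).hom ≫ F.obj d ⊴ᵣ f)
    (nat_left : ∀ {d d' : D} (f : d ⟶ d') (c : E),
      F.map (f ⊵ᵣ c) ≫ (δ d' c).hom = (δ d c).hom ≫ F.map f ⊵ᵣ c)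
    (assoc : ∀ (d : D) (c c' : E), (δ (d ⊙ᵣ c) c').hom ≫ (δ d c).hom ⊵ᵣ c' ≫
      (αᵣ (F.obj d) c c').inv = F.map (αᵣ d c c').inv ≫ (δ d (c ⊗ c')).hom)
    (unit : ∀ d : D, (δ d (𝟙_ E)).hom ≫ (ρᵣ[E] (F.obj d)).hom = F.map (ρᵣ[E] d).hom) :
    F.RightLinear E :=
  have hδ : ∀ (d : D) (c c' : E), (δ d (c ⊗ c')).hom = F.map (αᵣ d c c').hom ≫
      (δ (d ⊙ᵣ c) c').hom ≫ (δ d c).hom ⊵ᵣ c' ≫ (αᵣ (F.obj d) c c').inv := by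
    intro d c c'
    rw [assoc, ← F.map_comp_assoc]
    simp
  { μᵣ := fun d c => (δ d c).inv
    δᵣ := fun d c => (δ d c).hom
    μᵣ_naturality_right := fun d _ _ f => by
      rw [Iso.eq_inv_comp, ← reassoc_of% (nat_right d f)]; simp
    μᵣ_naturality_left := fun f c => by
      rw [Iso.eq_inv_comp, ← reassoc_of% (nat_left f c)]; simp
    μᵣ_associativity := fun d c c' => by
      rw [Iso.inv_comp_eq, hδ]; simp
    μᵣ_unitality := fun d => by rw [Iso.eq_inv_comp, unit]
    δᵣ_naturality_right := fun d _ _ f => nat_right d f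
    δᵣ_naturality_left := fun f c => nat_left f c
    δᵣ_associativity := fun d c c' => by rw [hδ]; simp
    δᵣ_unitality_inv := fun d => by
      rw [← cancel_mono (ρᵣ[E] (F.obj d)).hom, Category.assoc, unit, ← F.map_comp]; simp
    μᵣ_comp_δᵣ := by simp
    δᵣ_comp_μᵣ := by simp }

end RightLinear

section MatLinear

variable {E : Type*} [Category E] [Preadditive E] [MonoidalCategory E] [MonoidalPreadditive E]
  {D : Type u} [Category.{v} D] [Preadditive D] [HasFiniteBiproducts D]
  [MonoidalRightAction E D] [AdditiveAction E D]

/-- A module functor for the action of `E` is a module functor for the action of `Mat_ E`. -/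
abbrev rightLinearMat (F : D ⥤ D) [F.Additive] [F.RightLinear E] : F.RightLinear (Mat_ E) :=
  rightLinearOfIso F
    (fun d X => ⟨MatAction.linDelta F d X, MatAction.linMu F d X, MatAction.delta_mu F d X,
      MatAction.mu_delta F d X⟩)
    (fun d _ _ f => MatAction.delta_nat_right F d f)
    (fun f X => MatAction.delta_nat_left F f X)
    (fun d X Y => MatAction.delta_assoc F d X Y)
    (fun d => MatAction.delta_unit F d)

end MatLinear

section ModEndo

open scoped MonoidalRightAction

/-- An endofunctor of the module category `D` over the monoidal category `E`: a `𝕜`-linear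
functor `F` with a natural isomorphism `F (M ⊗ X) ≅ F M ⊗ X` satisfying the usual axioms. -/
structure ModEndo (𝕜 : Type*) [Field 𝕜] (E : Type*) [Category E] [MonoidalCategory E]
    (D : Type u) [Category.{v} D] [Preadditive D] [Linear 𝕜 D] [MonoidalRightAction E D] where
  F : D ⥤ D
  [additive : F.Additive]
  [linear : F.Linear 𝕜]
  [rightLinear : F.RightLinear E]

attribute [instance] ModEndo.additive ModEndo.linear ModEndo.rightLinear

namespace ModEndo

open Functor.LaxRightLinear Functor.OplaxRightLinear

variable {𝕜 : Type*} [Field 𝕜] {E : Type*} [Category E] [MonoidalCategory E]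
  {D : Type u} [Category.{v} D] [Preadditive D] [Linear 𝕜 D] [MonoidalRightAction E D]

/-- The constraint of a module functor. -/
abbrev s (F : ModEndo 𝕜 E D) (d : D) (c : E) : F.F.obj (d ⊙ᵣ c) ⟶ F.F.obj d ⊙ᵣ c := δᵣ F.F d c

/-- Morphisms of module functors. -/
@[ext]
structure Hom (F F' : ModEndo 𝕜 E D) where
  val : F.F ⟶ F'.F
  comm : ∀ (d : D) (c : E), val.app (d ⊙ᵣ c) ≫ F'.s d c = F.s d c ≫ val.app d ⊵ᵣ c

@[simps]
instance : Category (ModEndo 𝕜 E D) where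
  Hom := Hom
  id F := ⟨𝟙 _, by simp⟩
  comp f f' := ⟨f.val ≫ f'.val, fun d c => by
    simp only [NatTrans.comp_app, Category.assoc, f'.comm, reassoc_of% (f.comm d c),
      MonoidalRightAction.comp_actionHomLeft]⟩

@[ext]
theorem hom_ext {F F' : ModEndo 𝕜 E D} {f f' : F ⟶ F'} (h : ∀ d, f.val.app d = f'.val.app d) :
    f = f' := Hom.ext (NatTrans.ext (funext h))

/-- An isomorphism of module functors. -/
def mkIso {F F' : ModEndo 𝕜 E D} (e : F.F ≅ F'.F)
    (h : ∀ (d : D) (c : E), e.hom.app (d ⊙ᵣ c) ≫ F'.s d c = F.s d c ≫ e.hom.app d ⊵ᵣ c) :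
    F ≅ F' where
  hom := ⟨e.hom, h⟩
  inv := ⟨e.inv, fun d c => by
    rw [← cancel_epi (e.hom.app (d ⊙ᵣ c)), reassoc_of% (h d c)]
    simp [← MonoidalRightAction.comp_actionHomLeft]⟩
  hom_inv_id := by ext; simp
  inv_hom_id := by ext; simp

section Linear

variable [Preadditive E] [LinearAction 𝕜 E D]

/-- The vector space of morphisms of module functors. -/
def homSubmodule (F F' : ModEndo 𝕜 E D) : Submodule 𝕜 (F.F ⟶ F'.F) where
  carrier := {t | ∀ (d : D) (c : E), t.app (d ⊙ᵣ c) ≫ F'.s d c = F.s d c ≫ t.app d ⊵ᵣ c}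
  zero_mem' d c := by
    have h : (0 : F.F.obj d ⟶ F'.F.obj d) ⊵ᵣ c = 0 :=
      (AddMonoidHom.mk' (fun f : F.F.obj d ⟶ F'.F.obj d => f ⊵ᵣ c)
        (fun a b => AdditiveAction.left_add a b c)).map_zero
    simp [h]
  add_mem' {a b} ha hb d c := by
    simp only [NatTrans.app_add, Preadditive.add_comp, AdditiveAction.left_add,
      Preadditive.comp_add, ha d c, hb d c]
  smul_mem' a t h d c := by
    simp only [NatTrans.app_smul, Linear.smul_comp, LinearAction.left_smul, Linear.comp_smul,
      h d c]

/-- Morphisms of module functors as elements of a vector space. -/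
def homEquiv (F F' : ModEndo 𝕜 E D) : (F ⟶ F') ≃ homSubmodule F F' where
  toFun f := ⟨f.val, f.comm⟩
  invFun f := ⟨f.1, f.2⟩

instance (F F' : ModEndo 𝕜 E D) : AddCommGroup (F ⟶ F') := (homEquiv F F').addCommGroup

instance (F F' : ModEndo 𝕜 E D) : Module 𝕜 (F ⟶ F') := (homEquiv F F').module 𝕜

@[simp]
theorem zero_val (F F' : ModEndo 𝕜 E D) : (0 : F ⟶ F').val = 0 := rfl

@[simp]
theorem add_val {F F' : ModEndo 𝕜 E D} (f f' : F ⟶ F') : (f + f').val = f.val + f'.val := rfl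

@[simp]
theorem smul_val {F F' : ModEndo 𝕜 E D} (a : 𝕜) (f : F ⟶ F') : (a • f).val = a • f.val := rfl

instance : Preadditive (ModEndo 𝕜 E D) where
  add_comp _ _ _ _ _ _ := by ext; simp
  comp_add _ _ _ _ _ _ := by ext; simp

instance : Linear 𝕜 (ModEndo 𝕜 E D) where
  smul_comp _ _ _ _ _ _ := by ext; simp
  comp_smul _ _ _ _ _ _ := by ext; simp

end Linear

/-- The constraint of a composition of module functors. -/
def compIso (F F' : D ⥤ D) [F.RightLinear E] [F'.RightLinear E] (d : D) (c : E) :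
    F.obj (F'.obj (d ⊙ᵣ c)) ≅ F.obj (F'.obj d) ⊙ᵣ c where
  hom := F.map (δᵣ F' d c) ≫ δᵣ F (F'.obj d) c
  inv := μᵣ F (F'.obj d) c ≫ F.map (μᵣ F' d c)
  hom_inv_id := by simp [← F.map_comp]
  inv_hom_id := by simp [← F.map_comp_assoc]

/-- The composition of module functors. -/
abbrev compLinear (F F' : D ⥤ D) [F.RightLinear E] [F'.RightLinear E] :
    (F' ⋙ F).RightLinear E :=
  rightLinearOfIso (F' ⋙ F) (fun d c => compIso F F' d c)
    (fun d c c' f => by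
      change F.map (F'.map (d ⊴ᵣ f)) ≫ F.map (δᵣ F' d c') ≫ δᵣ F (F'.obj d) c' =
        (F.map (δᵣ F' d c) ≫ δᵣ F (F'.obj d) c) ≫ F.obj (F'.obj d) ⊴ᵣ f
      rw [← F.map_comp_assoc, δᵣ_naturality_right, F.map_comp_assoc, δᵣ_naturality_right,
        Category.assoc])
    (fun {d d'} f c => by
      change F.map (F'.map (f ⊵ᵣ c)) ≫ F.map (δᵣ F' d' c) ≫ δᵣ F (F'.obj d') c =
        (F.map (δᵣ F' d c) ≫ δᵣ F (F'.obj d) c) ≫ F.map (F'.map f) ⊵ᵣ c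
      rw [← F.map_comp_assoc, δᵣ_naturality_left, F.map_comp_assoc, δᵣ_naturality_left,
        Category.assoc])
    (fun d c c' => by
      have h := δᵣ_associativity_inv F (F'.obj d) c c'
      have h' := congrArg F.map (δᵣ_associativity_inv F' d c c')
      simp only [F.map_comp] at h'
      change (F.map (δᵣ F' (d ⊙ᵣ c) c') ≫ δᵣ F (F'.obj (d ⊙ᵣ c)) c') ≫
        (F.map (δᵣ F' d c) ≫ δᵣ F (F'.obj d) c) ⊵ᵣ c' ≫ (αᵣ (F.obj (F'.obj d)) c c').inv =
          F.map (F'.map (αᵣ d c c').inv) ≫ F.map (δᵣ F' d (c ⊗ c')) ≫ δᵣ F (F'.obj d) (c ⊗ c')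
      rw [← reassoc_of% h', ← h, MonoidalRightAction.comp_actionHomLeft, Category.assoc,
        Category.assoc, δᵣ_naturality_left_assoc])
    (fun d => by
      change (F.map (δᵣ F' d (𝟙_ E)) ≫ δᵣ F (F'.obj d) (𝟙_ E)) ≫ (ρᵣ[E] (F.obj (F'.obj d))).hom =
        F.map (F'.map (ρᵣ[E] d).hom)
      rw [Category.assoc, δᵣ_unitality_hom, ← F.map_comp, δᵣ_unitality_hom])

/-- The identity module functor. -/
abbrev idLinear : (𝟭 D).RightLinear E :=
  rightLinearOfIso (𝟭 D) (fun d c => Iso.refl (d ⊙ᵣ c))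
    (fun _ _ _ f => (Category.comp_id _).trans (Category.id_comp _).symm)
    (fun _ _ => (Category.comp_id _).trans (Category.id_comp _).symm)
    (fun d c c' => by
      change 𝟙 _ ≫ 𝟙 (d ⊙ᵣ c) ⊵ᵣ c' ≫ (αᵣ d c c').inv = (αᵣ d c c').inv ≫ 𝟙 _
      simp)
    (fun d => Category.id_comp _)

/-- The tensor product of module endofunctors is given by composition. -/
instance : MonoidalCategoryStruct (ModEndo 𝕜 E D) where
  tensorObj F F' := { F := F'.F ⋙ F.F, rightLinear := compLinear F.F F'.F }
  whiskerLeft F F₁ F₂ f := ⟨Functor.whiskerRight f.val F.F, fun d c => by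
    change F.F.map (f.val.app (d ⊙ᵣ c)) ≫ F.F.map (F₂.s d c) ≫ F.s (F₂.F.obj d) c =
      (F.F.map (F₁.s d c) ≫ F.s (F₁.F.obj d) c) ≫ F.F.map (f.val.app d) ⊵ᵣ c
    rw [← F.F.map_comp_assoc, f.comm, F.F.map_comp_assoc, δᵣ_naturality_left, Category.assoc]⟩
  whiskerRight {F₁ F₂} f F := ⟨Functor.whiskerLeft F.F f.val, fun d c => by
    change f.val.app (F.F.obj (d ⊙ᵣ c)) ≫ F₂.F.map (F.s d c) ≫ F₂.s (F.F.obj d) c =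
      (F₁.F.map (F.s d c) ≫ F₁.s (F.F.obj d) c) ≫ f.val.app (F.F.obj d) ⊵ᵣ c
    rw [← f.val.naturality_assoc, f.comm, Category.assoc]⟩
  tensorUnit := { F := 𝟭 D, rightLinear := idLinear }
  associator F F' F'' := mkIso (Iso.refl _) (fun d c => by
    change 𝟙 _ ≫ F.F.map (F'.F.map (F''.s d c) ≫ F'.s (F''.F.obj d) c) ≫ F.s _ c =
      (F.F.map (F'.F.map (F''.s d c)) ≫ F.F.map (F'.s (F''.F.obj d) c) ≫ F.s _ c) ≫ 𝟙 _ ⊵ᵣ c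
    simp)
  leftUnitor F := mkIso (Iso.refl _) (fun d c => by
    change 𝟙 _ ≫ F.s d c = (F.s d c ≫ 𝟙 _) ≫ 𝟙 _ ⊵ᵣ c
    simp)
  rightUnitor F := mkIso (Iso.refl _) (fun d c => by
    change 𝟙 _ ≫ F.s d c = (F.F.map (𝟙 _) ≫ F.s d c) ≫ 𝟙 _ ⊵ᵣ c
    simp)

theorem tensor_s (F F' : ModEndo 𝕜 E D) (d : D) (c : E) :
    (F ⊗ F').s d c = F.F.map (F'.s d c) ≫ F.s (F'.F.obj d) c := rfl

theorem whiskerLeft_app (F : ModEndo 𝕜 E D) {F₁ F₂ : ModEndo 𝕜 E D} (f : F₁ ⟶ F₂) (d : D) :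
    (F ◁ f).val.app d = F.F.map (f.val.app d) := rfl

theorem whiskerRight_app {F₁ F₂ : ModEndo 𝕜 E D} (f : F₁ ⟶ F₂) (F : ModEndo 𝕜 E D) (d : D) :
    (f ▷ F).val.app d = f.val.app (F.F.obj d) := rfl

instance : MonoidalCategory (ModEndo 𝕜 E D) :=
  monoidalOfWhisker (fun _ _ => rfl)
    (fun F _ => hom_ext fun _ => F.F.map_id _)
    (fun _ _ => hom_ext fun _ => rfl)
    (fun F _ _ _ f g => hom_ext fun _ => F.F.map_comp _ _)
    (fun _ _ _ => hom_ext fun _ => rfl)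
    (fun f g => hom_ext fun d => f.val.naturality (g.val.app d))
    (fun f _ _ => hom_ext fun _ => (Category.comp_id _).trans (Category.id_comp _).symm)
    (fun _ _ _ f _ => hom_ext fun _ => (Category.comp_id _).trans (Category.id_comp _).symm)
    (fun _ _ _ _ f => hom_ext fun _ => (Category.comp_id _).trans (Category.id_comp _).symm)
    (fun f => hom_ext fun _ => (Category.comp_id _).trans (Category.id_comp _).symm)
    (fun f => hom_ext fun _ => (Category.comp_id _).trans (Category.id_comp _).symm)
    (fun W X Y Z => hom_ext fun d => by
      change 𝟙 _ ≫ 𝟙 _ ≫ W.F.map (𝟙 _) = 𝟙 _ ≫ 𝟙 _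
      simp)
    (fun X Y => hom_ext fun d => by
      change 𝟙 _ ≫ X.F.map (𝟙 _) = 𝟙 _
      simp)

end ModEndo

end ModEndo

section Equivariantization

variable {𝕜 : Type*} [Field 𝕜] {G Γ : Type*} [Group G] [Group Γ] [Fintype Γ]
  {P : MatchedPair G Γ} {C : Type u} [Category.{v} C] [Preadditive C] [HasFiniteBiproducts C]
  [Linear 𝕜 C] [MonoidalCategory C] [MonoidalPreadditive C]

/-- The objects of the `(G, Γ)`-crossed extension `C^(G,Γ)`: the equivariant objects
`(X, {u_g : X ◁ g ≅ X})`. -/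
structure Equivariant (A : CrossedAction 𝕜 P C) where
  obj : C
  u : ∀ g, (A.T.act g).obj obj ≅ obj
  u_mul : ∀ g h, (A.T.R2 g h).hom.app obj ≫ (u (g * h)).hom =
    (A.T.act h).map (u g).hom ≫ (u h).hom

namespace Equivariant

variable {A : CrossedAction 𝕜 P C}

/-- Equivariant morphisms. -/
@[ext]
structure Hom (X Y : Equivariant A) where
  val : X.obj ⟶ Y.obj
  comm : ∀ g, (X.u g).hom ≫ val = (A.T.act g).map val ≫ (Y.u g).hom

@[simps]
instance : Category (Equivariant A) where
  Hom := Hom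
  id X := ⟨𝟙 _, by simp⟩
  comp f f' := ⟨f.val ≫ f'.val, fun g => by
    rw [reassoc_of% (f.comm g), f'.comm g, Functor.map_comp, Category.assoc]⟩

@[ext]
theorem hom_ext {X Y : Equivariant A} {f f' : X ⟶ Y} (h : f.val = f'.val) : f = f' := Hom.ext h

/-- An isomorphism of equivariant objects. -/
def mkIso {X Y : Equivariant A} (e : X.obj ≅ Y.obj)
    (h : ∀ g, (X.u g).hom ≫ e.hom = (A.T.act g).map e.hom ≫ (Y.u g).hom) : X ≅ Y where
  hom := ⟨e.hom, h⟩
  inv := ⟨e.inv, fun g => by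
    rw [← cancel_epi ((A.T.act g).map e.hom), ← reassoc_of% (h g), ← Functor.map_comp_assoc]
    simp⟩
  hom_inv_id := by ext; simp
  inv_hom_id := by ext; simp

/-- The vector space of equivariant morphisms. -/
def homSubmodule (X Y : Equivariant A) : Submodule 𝕜 (X.obj ⟶ Y.obj) where
  carrier := {f | ∀ g, (X.u g).hom ≫ f = (A.T.act g).map f ≫ (Y.u g).hom}
  zero_mem' g := by simp
  add_mem' {a b} ha hb g := by
    rw [Preadditive.comp_add, ha g, hb g, Functor.map_add, Preadditive.add_comp]
  smul_mem' a f h g := by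
    rw [Linear.comp_smul, h g, Functor.map_smul, Linear.smul_comp]

/-- Equivariant morphisms as elements of a vector space. -/
def homEquiv (X Y : Equivariant A) : (X ⟶ Y) ≃ homSubmodule X Y where
  toFun f := ⟨f.val, f.comm⟩
  invFun f := ⟨f.1, f.2⟩

instance (X Y : Equivariant A) : AddCommGroup (X ⟶ Y) := (homEquiv X Y).addCommGroup

instance (X Y : Equivariant A) : Module 𝕜 (X ⟶ Y) := (homEquiv X Y).module 𝕜

@[simp]
theorem zero_val (X Y : Equivariant A) : (0 : X ⟶ Y).val = 0 := rfl

@[simp]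
theorem add_val {X Y : Equivariant A} (f f' : X ⟶ Y) : (f + f').val = f.val + f'.val := rfl

@[simp]
theorem smul_val {X Y : Equivariant A} (a : 𝕜) (f : X ⟶ Y) : (a • f).val = a • f.val := rfl

instance : Preadditive (Equivariant A) where
  add_comp _ _ _ _ _ _ := by ext; simp
  comp_add _ _ _ _ _ _ := by ext; simp

instance : Linear 𝕜 (Equivariant A) where
  smul_comp _ _ _ _ _ _ := by ext; simp
  comp_smul _ _ _ _ _ _ := by ext; simp

theorem mulIso_u (X : Equivariant A) (g h p : G) (e : g * h = p) :
    (A.T.mulIso X.obj g h p e).hom ≫ (X.u p).hom =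
      (A.T.act h).map (X.u g).hom ≫ (X.u h).hom := by
  subst e
  rw [← X.u_mul]
  simp [RightAction.mulIso]

theorem tr_u (X : Equivariant A) {g h : G} (e : g = h) :
    A.T.tr X.obj g h ≫ (X.u h).hom = (X.u g).hom := by
  subst e; simp

theorem oneIso_u (X : Equivariant A) : (A.T.oneIso X.obj).hom ≫ (X.u 1).hom = 𝟙 _ := by
  have h := X.mulIso_u 1 1 1 (mul_one 1)
  have h₁ := A.T.one_mulIso X.obj 1 (one_mul 1)
  have h₂ := A.T.oneIso_nat (X.u 1).hom
  rw [← cancel_epi (X.u 1).hom, reassoc_of% h₂, ← h, reassoc_of% (A.T.mulIso_one X.obj 1)]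
  simp

/-- The isomorphism `(X ⊗ Y) ◁ g ≅ X ⊗ Y ◁ g` for an equivariant object `X`. If `Y` is homogeneous
of degree `k`, it is the composition of the constraint `η` with `u_{k ▶ g} ⊗ id`; in general it is
the direct sum of these isomorphisms over the homogeneous components of `Y`. -/
def tauHom (X : Equivariant A) (g : G) (Y : C) :
    (A.T.act g).obj (X.obj ⊗ Y) ⟶ X.obj ⊗ (A.T.act g).obj Y :=
  ∑ k, (A.T.act g).map (X.obj ◁ A.gr.proj Y k) ≫ (A.η g X.obj (A.gr.deg_comp Y k)).hom ≫
    (X.u (P.l k g)).hom ▷ _ ≫ X.obj ◁ (A.T.act g).map (A.gr.incl Y k)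

/-- The inverse of `tauHom`. -/
def tauInv (X : Equivariant A) (g : G) (Y : C) :
    X.obj ⊗ (A.T.act g).obj Y ⟶ (A.T.act g).obj (X.obj ⊗ Y) :=
  ∑ k, X.obj ◁ (A.T.act g).map (A.gr.proj Y k) ≫ (X.u (P.l k g)).inv ▷ _ ≫
    (A.η g X.obj (A.gr.deg_comp Y k)).inv ≫ (A.T.act g).map (X.obj ◁ A.gr.incl Y k)

theorem ext_act {X Y Z : C} {g : G} {f f' : (A.T.act g).obj (X ⊗ Y) ⟶ Z}
    (h : ∀ k, (A.T.act g).map (X ◁ A.gr.incl Y k) ≫ f =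
      (A.T.act g).map (X ◁ A.gr.incl Y k) ≫ f') : f = f' :=
  A.gr.hom_ext_incl (tensorLeft X ⋙ A.T.act g) h

theorem incl_tauHom (X : Equivariant A) (g : G) (Y : C) (k : Γ) :
    (A.T.act g).map (X.obj ◁ A.gr.incl Y k) ≫ X.tauHom g Y =
      (A.η g X.obj (A.gr.deg_comp Y k)).hom ≫ (X.u (P.l k g)).hom ▷ _ ≫
        X.obj ◁ (A.T.act g).map (A.gr.incl Y k) := by
  rw [tauHom, Preadditive.comp_sum, Finset.sum_eq_single k]
  · rw [← Functor.map_comp_assoc, ← MonoidalCategory.whiskerLeft_comp, A.gr.incl_proj]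
    simp
  · intro l _ hl
    rw [← Functor.map_comp_assoc, ← MonoidalCategory.whiskerLeft_comp,
      A.gr.incl_proj_ne _ hl.symm]
    simp
  · simp

theorem incl_tauInv (X : Equivariant A) (g : G) (Y : C) (k : Γ) :
    X.obj ◁ (A.T.act g).map (A.gr.incl Y k) ≫ X.tauInv g Y =
      (X.u (P.l k g)).inv ▷ _ ≫ (A.η g X.obj (A.gr.deg_comp Y k)).inv ≫
        (A.T.act g).map (X.obj ◁ A.gr.incl Y k) := by
  rw [tauInv, Preadditive.comp_sum, Finset.sum_eq_single k]
  · rw [← MonoidalCategory.whiskerLeft_comp_assoc, ← Functor.map_comp, A.gr.incl_proj]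
    simp
  · intro l _ hl
    rw [← MonoidalCategory.whiskerLeft_comp_assoc, ← Functor.map_comp,
      A.gr.incl_proj_ne _ hl.symm]
    simp
  · simp

/-- The isomorphism `(X ⊗ Y) ◁ g ≅ X ⊗ Y ◁ g` for an equivariant object `X`. -/
def tau (X : Equivariant A) (g : G) (Y : C) :
    (A.T.act g).obj (X.obj ⊗ Y) ≅ X.obj ⊗ (A.T.act g).obj Y where
  hom := X.tauHom g Y
  inv := X.tauInv g Y
  hom_inv_id := ext_act fun k => by
    rw [reassoc_of% (X.incl_tauHom g Y k), incl_tauInv]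
    simp
  inv_hom_id := A.gr.hom_ext_incl (A.T.act g ⋙ tensorLeft X.obj) fun k => by
    change X.obj ◁ (A.T.act g).map (A.gr.incl Y k) ≫ _ =
      X.obj ◁ (A.T.act g).map (A.gr.incl Y k) ≫ _
    rw [reassoc_of% (X.incl_tauInv g Y k), incl_tauHom]
    simp

theorem incl_tau (X : Equivariant A) (g : G) (Y : C) (k : Γ) :
    (A.T.act g).map (X.obj ◁ A.gr.incl Y k) ≫ (X.tau g Y).hom =
      (A.η g X.obj (A.gr.deg_comp Y k)).hom ≫ (X.u (P.l k g)).hom ▷ _ ≫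
        X.obj ◁ (A.T.act g).map (A.gr.incl Y k) := X.incl_tauHom g Y k

theorem tau_nat_right (X : Equivariant A) (g : G) {Y Y' : C} (f : Y ⟶ Y') :
    (A.T.act g).map (X.obj ◁ f) ≫ (X.tau g Y').hom =
      (X.tau g Y).hom ≫ X.obj ◁ (A.T.act g).map f :=
  ext_act fun k => by
    rw [reassoc_of% (X.incl_tau g Y k), ← Functor.map_comp_assoc,
      ← MonoidalCategory.whiskerLeft_comp, A.gr.incl_comp, MonoidalCategory.whiskerLeft_comp,
      Functor.map_comp_assoc, X.incl_tau,
      reassoc_of% (A.η_nat_right g X.obj (A.gr.deg_comp Y k) (A.gr.deg_comp Y' k) (A.gr.compMap f k)),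
      whisker_exchange_assoc, ← MonoidalCategory.whiskerLeft_comp, ← Functor.map_comp,
      ← A.gr.incl_comp]
    simp

theorem tau_homog (X : Equivariant A) (g : G) {Y : C} {k : Γ} (hY : A.gr.deg k Y) :
    (X.tau g Y).hom = (A.η g X.obj hY).hom ≫ (X.u (P.l k g)).hom ▷ _ := by
  have h : (X.tau g Y).hom = (A.T.act g).map (X.obj ◁ (A.gr.proj Y k ≫ A.gr.incl Y k)) ≫
      (X.tau g Y).hom := by
    rw [A.gr.proj_incl hY]; simp
  rw [h, MonoidalCategory.whiskerLeft_comp, Functor.map_comp_assoc, incl_tau,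
    reassoc_of% (A.η_nat_right g X.obj hY (A.gr.deg_comp Y k) (A.gr.proj Y k)),
    whisker_exchange_assoc, ← MonoidalCategory.whiskerLeft_comp, ← Functor.map_comp,
    A.gr.proj_incl hY]
  simp

/-- To compare `f` with `f'`, it is enough to consider homogeneous `Y`. -/
theorem ext_homog {F F' : C ⥤ C} [F.Additive] (f f' : ∀ Y : C, F.obj Y ⟶ F'.obj Y)
    (nat : ∀ {Y Y' : C} (q : Y ⟶ Y'), F.map q ≫ f Y' = f Y ≫ F'.map q)
    (nat' : ∀ {Y Y' : C} (q : Y ⟶ Y'), F.map q ≫ f' Y' = f' Y ≫ F'.map q)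
    (h : ∀ {Y : C} {k : Γ}, A.gr.deg k Y → f Y = f' Y) (Y : C) : f Y = f' Y :=
  A.gr.hom_ext_incl F fun k => by
    rw [nat, nat', h (A.gr.deg_comp Y k)]

theorem tau_nat_left {X X' : Equivariant A} (f : X ⟶ X') (g : G) (Y : C) :
    (A.T.act g).map (f.val ▷ Y) ≫ (X'.tau g Y).hom =
      (X.tau g Y).hom ≫ f.val ▷ (A.T.act g).obj Y := by
  refine ext_homog (A := A) (F := tensorLeft X.obj ⋙ A.T.act g)
    (F' := A.T.act g ⋙ tensorLeft X'.obj)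
    (fun Y => (A.T.act g).map (f.val ▷ Y) ≫ (X'.tau g Y).hom)
    (fun Y => (X.tau g Y).hom ≫ f.val ▷ (A.T.act g).obj Y)
    (fun {Y Y'} q => ?_) (fun {Y Y'} q => ?_) (fun {Y k} hY => ?_) Y
  · change (A.T.act g).map (X.obj ◁ q) ≫ _ ≫ _ = (_ ≫ _) ≫ X'.obj ◁ (A.T.act g).map q
    rw [Category.assoc, ← tau_nat_right, ← Functor.map_comp_assoc, whisker_exchange,
      Functor.map_comp_assoc]
  · change (A.T.act g).map (X.obj ◁ q) ≫ _ ≫ _ = (_ ≫ _) ≫ X'.obj ◁ (A.T.act g).map q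
    rw [Category.assoc, ← whisker_exchange, reassoc_of% (X.tau_nat_right g q)]
  · simp only [X.tau_homog g hY, X'.tau_homog g hY]
    rw [reassoc_of% (A.η_nat_left g hY f.val), Category.assoc, ← comp_whiskerRight,
      ← comp_whiskerRight, f.comm]

theorem tau_mul (X : Equivariant A) (g h p : G) (e : g * h = p) (Y : C) :
    (A.T.mulIso (X.obj ⊗ Y) g h p e).hom ≫ (X.tau p Y).hom =
      (A.T.act h).map (X.tau g Y).hom ≫ (X.tau h _).hom ≫
        X.obj ◁ (A.T.mulIso Y g h p e).hom := by
  refine ext_homog (A := A) (F := tensorLeft X.obj ⋙ A.T.act g ⋙ A.T.act h)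
    (F' := A.T.act p ⋙ tensorLeft X.obj)
    (fun Y => (A.T.mulIso (X.obj ⊗ Y) g h p e).hom ≫ (X.tau p Y).hom)
    (fun Y => (A.T.act h).map (X.tau g Y).hom ≫ (X.tau h _).hom ≫
        X.obj ◁ (A.T.mulIso Y g h p e).hom)
    (fun {Y Y'} q => ?_) (fun {Y Y'} q => ?_) (fun {Y k} hY => ?_) Y
  · change (A.T.act h).map ((A.T.act g).map (X.obj ◁ q)) ≫ _ ≫ _ =
      (_ ≫ _) ≫ X.obj ◁ (A.T.act p).map q
    rw [Category.assoc, ← tau_nat_right, reassoc_of% (A.T.mulIso_nat (X.obj ◁ q) g h p e)]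
  · change (A.T.act h).map ((A.T.act g).map (X.obj ◁ q)) ≫ _ ≫ _ ≫ _ =
      (_ ≫ _ ≫ _) ≫ X.obj ◁ (A.T.act p).map q
    rw [Category.assoc, Category.assoc, ← MonoidalCategory.whiskerLeft_comp, ← A.T.mulIso_nat,
      MonoidalCategory.whiskerLeft_comp, ← reassoc_of% (X.tau_nat_right h),
      ← Functor.map_comp_assoc, ← Functor.map_comp_assoc, tau_nat_right]
  · have h₁ := A.η_mul g h p X.obj hY e (by rw [← e, P.l_mul])
    have h₂ := A.η_nat_left h (A.deg_act g hY) (X.u (P.l k g)).hom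
    simp only [X.tau_homog g hY, X.tau_homog p hY, X.tau_homog h (A.deg_act g hY)]
    rw [← reassoc_of% h₁, Functor.map_comp, Category.assoc, Category.assoc, reassoc_of% h₂,
      MonoidalCategory.tensorHom_def, Category.assoc, whisker_exchange,
      ← comp_whiskerRight_assoc, mulIso_u]
    simp

theorem tau_one (X : Equivariant A) (Y : C) :
    (A.T.oneIso (X.obj ⊗ Y)).hom ≫ (X.tau 1 Y).hom = X.obj ◁ (A.T.oneIso Y).hom := by
  refine ext_homog (A := A) (F := tensorLeft X.obj)
    (F' := A.T.act 1 ⋙ tensorLeft X.obj)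
    (fun Y => (A.T.oneIso (X.obj ⊗ Y)).hom ≫ (X.tau 1 Y).hom)
    (fun Y => X.obj ◁ (A.T.oneIso Y).hom)
    (fun {Y Y'} q => ?_) (fun {Y Y'} q => ?_) (fun {Y k} hY => ?_) Y
  · change X.obj ◁ q ≫ _ ≫ _ = (_ ≫ _) ≫ X.obj ◁ (A.T.act 1).map q
    rw [Category.assoc, ← tau_nat_right, reassoc_of% (A.T.oneIso_nat (X.obj ◁ q))]
  · change X.obj ◁ q ≫ _ = _ ≫ X.obj ◁ (A.T.act 1).map q
    rw [← MonoidalCategory.whiskerLeft_comp, ← MonoidalCategory.whiskerLeft_comp,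
      A.T.oneIso_nat]
  · have h₁ := A.η_one X.obj hY
    simp only [X.tau_homog 1 hY]
    rw [reassoc_of% h₁, whisker_exchange, ← comp_whiskerRight_assoc, Category.assoc,
      X.tr_u (P.l_one k).symm, oneIso_u]
    simp

theorem tau_η (X : Equivariant A) (g : G) (Y : C) {Z : C} {k : Γ} (hZ : A.gr.deg k Z) :
    (A.η g (X.obj ⊗ Y) hZ).hom ≫ (X.tau (P.l k g) Y).hom ▷ _ ≫ (α_ _ _ _).hom =
      (A.T.act g).map (α_ X.obj Y Z).hom ≫ (X.tau g (Y ⊗ Z)).hom ≫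
        X.obj ◁ (A.η g Y hZ).hom := by
  refine ext_homog (A := A) (F := tensorLeft X.obj ⋙ tensorRight Z ⋙ A.T.act g)
    (F' := A.T.act (P.l k g) ⋙ tensorRight ((A.T.act g).obj Z) ⋙ tensorLeft X.obj)
    (fun Y => (A.η g (X.obj ⊗ Y) hZ).hom ≫ (X.tau (P.l k g) Y).hom ▷ _ ≫ (α_ _ _ _).hom)
    (fun Y => (A.T.act g).map (α_ X.obj Y Z).hom ≫ (X.tau g (Y ⊗ Z)).hom ≫
        X.obj ◁ (A.η g Y hZ).hom)
    (fun {Y Y'} q => ?_) (fun {Y Y'} q => ?_) (fun {Y l} hY => ?_) Y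
  · change (A.T.act g).map ((X.obj ◁ q) ▷ Z) ≫ _ ≫ _ ≫ _ =
      (_ ≫ _ ≫ _) ≫ X.obj ◁ (A.T.act (P.l k g)).map q ▷ _
    rw [Category.assoc, Category.assoc, ← associator_naturality_middle,
      reassoc_of% (A.η_nat_left g hZ (X.obj ◁ q)), ← comp_whiskerRight_assoc,
      ← comp_whiskerRight_assoc, tau_nat_right]
  · change (A.T.act g).map ((X.obj ◁ q) ▷ Z) ≫ _ ≫ _ ≫ _ =
      (_ ≫ _ ≫ _) ≫ X.obj ◁ (A.T.act (P.l k g)).map q ▷ _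
    rw [Category.assoc, Category.assoc, ← MonoidalCategory.whiskerLeft_comp, ← A.η_nat_left,
      MonoidalCategory.whiskerLeft_comp, ← reassoc_of% (X.tau_nat_right g (q ▷ Z)),
      ← Functor.map_comp_assoc, ← Functor.map_comp_assoc, associator_naturality_middle]
  · have h₁ := A.η_assoc_tr g X.obj hY hZ
    simp only [X.tau_homog _ hY, X.tau_homog g (A.gr.deg_tensor hY hZ)]
    rw [← X.tr_u (P.mul_l l k g)]
    simp only [comp_whiskerRight, Category.assoc]
    rw [← whisker_exchange, ← reassoc_of% h₁]
    simp

/-- The tensor product of equivariant objects: on the summand `(X ⊗ Y_k) ◁ g`, the isomorphism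
`u_g` is given by `(u_{k ▶ g} ⊗ u_g) ∘ η`. -/
abbrev tensor (X Y : Equivariant A) : Equivariant A where
  obj := X.obj ⊗ Y.obj
  u g := X.tau g Y.obj ≪≫ whiskerLeftIso X.obj (Y.u g)
  u_mul g h := by
    have h₁ := X.tau_mul g h _ rfl Y.obj
    have h₂ := Y.mulIso_u g h _ rfl
    simp only [RightAction.mulIso, eqToIso_refl, Iso.trans_refl, Iso.app_hom] at h₁ h₂
    simp only [Iso.trans_hom, whiskerLeftIso_hom]
    rw [reassoc_of% h₁, ← MonoidalCategory.whiskerLeft_comp, h₂,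
      MonoidalCategory.whiskerLeft_comp, ← reassoc_of% (X.tau_nat_right h (Y.u g).hom),
      Functor.map_comp, Category.assoc]

/-- The unit equivariant object. -/
abbrev unit : Equivariant A where
  obj := 𝟙_ C
  u g := A.η0 g
  u_mul g h := A.η0_R2 g h

theorem tau_assoc (X Y : Equivariant A) (g : G) (Z : C) :
    ((X.tensor Y).tau g Z).hom ≫ (α_ _ _ _).hom =
      (A.T.act g).map (α_ X.obj Y.obj Z).hom ≫ (X.tau g (Y.obj ⊗ Z)).hom ≫
        X.obj ◁ (Y.tau g Z).hom := by
  refine ext_homog (A := A) (F := tensorLeft (X.obj ⊗ Y.obj) ⋙ A.T.act g)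
    (F' := A.T.act g ⋙ tensorLeft Y.obj ⋙ tensorLeft X.obj)
    (fun Z => ((X.tensor Y).tau g Z).hom ≫ (α_ _ _ _).hom)
    (fun Z => (A.T.act g).map (α_ X.obj Y.obj Z).hom ≫ (X.tau g (Y.obj ⊗ Z)).hom ≫
        X.obj ◁ (Y.tau g Z).hom)
    (fun {Z Z'} q => ?_) (fun {Z Z'} q => ?_) (fun {Z k} hZ => ?_) Z
  · change (A.T.act g).map ((X.tensor Y).obj ◁ q) ≫ _ ≫ _ =
      (_ ≫ _) ≫ X.obj ◁ Y.obj ◁ (A.T.act g).map q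
    rw [Category.assoc, ← associator_naturality_right,
      reassoc_of% ((X.tensor Y).tau_nat_right g q)]
  · change (A.T.act g).map ((X.tensor Y).obj ◁ q) ≫ _ ≫ _ ≫ _ =
      (_ ≫ _ ≫ _) ≫ X.obj ◁ Y.obj ◁ (A.T.act g).map q
    rw [Category.assoc, Category.assoc, ← MonoidalCategory.whiskerLeft_comp, ← tau_nat_right,
      MonoidalCategory.whiskerLeft_comp, ← reassoc_of% (X.tau_nat_right g (Y.obj ◁ q)),
      ← Functor.map_comp_assoc, ← Functor.map_comp_assoc, associator_naturality_right]
  · have h₁ := X.tau_η g Y.obj hZ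
    simp only [(X.tensor Y).tau_homog g hZ, Y.tau_homog g hZ]
    simp only [MonoidalCategory.whiskerLeft_comp, ← reassoc_of% h₁, Iso.trans_hom,
      whiskerLeftIso_hom, comp_whiskerRight, Category.assoc]
    simp

theorem tau_unit_left (g : G) (Y : C) :
    ((unit (A := A)).tau g Y).hom ≫ (λ_ _).hom = (A.T.act g).map (λ_ Y).hom := by
  refine ext_homog (A := A) (F := tensorLeft (𝟙_ C) ⋙ A.T.act g) (F' := A.T.act g)
    (fun Y => ((unit (A := A)).tau g Y).hom ≫ (λ_ _).hom)
    (fun Y => (A.T.act g).map (λ_ Y).hom)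
    (fun {Y Y'} q => ?_) (fun {Y Y'} q => ?_) (fun {Y k} hY => ?_) Y
  · change (A.T.act g).map ((unit (A := A)).obj ◁ q) ≫ _ ≫ _ = (_ ≫ _) ≫ (A.T.act g).map q
    rw [reassoc_of% ((unit (A := A)).tau_nat_right g q), Category.assoc, leftUnitor_naturality]
  · change (A.T.act g).map (𝟙_ C ◁ q) ≫ _ = _ ≫ (A.T.act g).map q
    rw [← Functor.map_comp, ← Functor.map_comp, leftUnitor_naturality]
  · simp only [(unit (A := A)).tau_homog g hY]
    rw [Category.assoc]
    exact A.η_left_unit g hY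

theorem tau_unit_right (X : Equivariant A) (g : G) :
    (X.tau g (𝟙_ C)).hom ≫ X.obj ◁ (A.η0 g).hom ≫ (ρ_ _).hom =
      (A.T.act g).map (ρ_ X.obj).hom ≫ (X.u g).hom := by
  rw [X.tau_homog g A.gr.deg_unit, ← A.η_unit_right, ← X.tr_u (P.one_l g)]
  simp only [Category.assoc]
  rw [← rightUnitor_naturality_assoc, whisker_exchange_assoc]
  simp only [comp_whiskerRight, Category.assoc]
  rw [← rightUnitor_naturality (X.u g).hom, whisker_exchange_assoc]

instance : MonoidalCategoryStruct (Equivariant A) where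
  tensorObj X Y := X.tensor Y
  whiskerLeft X Y Y' f := ⟨X.obj ◁ f.val, fun g => by
    simp only [Iso.trans_hom, whiskerLeftIso_hom, Category.assoc]
    rw [← MonoidalCategory.whiskerLeft_comp, f.comm, MonoidalCategory.whiskerLeft_comp,
      reassoc_of% (X.tau_nat_right g f.val)]⟩
  whiskerRight {X X'} f Y := ⟨f.val ▷ Y.obj, fun g => by
    simp only [Iso.trans_hom, whiskerLeftIso_hom, Category.assoc]
    rw [reassoc_of% (tau_nat_left f g Y.obj), whisker_exchange]⟩
  tensorUnit := unit
  associator X Y Z := mkIso (α_ X.obj Y.obj Z.obj) (fun g => by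
    have h := X.tau_assoc Y g Z.obj
    simp only [Iso.trans_hom, whiskerLeftIso_hom, Category.assoc,
      MonoidalCategory.whiskerLeft_comp]
    rw [associator_naturality_right, ← reassoc_of% h])
  leftUnitor X := mkIso (λ_ X.obj) (fun g => by
    simp only [Iso.trans_hom, whiskerLeftIso_hom, Category.assoc]
    rw [leftUnitor_naturality, reassoc_of% (tau_unit_left (A := A) g X.obj)])
  rightUnitor X := mkIso (ρ_ X.obj) (fun g => by
    simp only [Iso.trans_hom, whiskerLeftIso_hom, Category.assoc]
    exact X.tau_unit_right g)

/-- The crossed extension `C^(G,Γ)` as a monoidal category. -/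
instance : MonoidalCategory (Equivariant A) :=
  monoidalOfWhisker (fun _ _ => rfl)
    (fun X Y => hom_ext (MonoidalCategory.whiskerLeft_id X.obj Y.obj))
    (fun X Y => hom_ext (MonoidalCategory.id_whiskerRight X.obj Y.obj))
    (fun X _ _ _ f g => hom_ext (MonoidalCategory.whiskerLeft_comp X.obj f.val g.val))
    (fun f g X => hom_ext (MonoidalCategory.comp_whiskerRight f.val g.val X.obj))
    (fun f g => hom_ext (MonoidalCategory.whisker_exchange f.val g.val))
    (fun f Y Z => hom_ext (associator_naturality_left f.val Y.obj Z.obj))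
    (fun X _ _ f Z => hom_ext (associator_naturality_middle X.obj f.val Z.obj))
    (fun X Y _ _ f => hom_ext (associator_naturality_right X.obj Y.obj f.val))
    (fun f => hom_ext (leftUnitor_naturality f.val))
    (fun f => hom_ext (rightUnitor_naturality f.val))
    (fun W X Y Z => hom_ext (MonoidalCategory.pentagon W.obj X.obj Y.obj Z.obj))
    (fun X Y => hom_ext (MonoidalCategory.triangle X.obj Y.obj))

/-- The forgetful functor `C^(G,Γ) ⥤ C`. -/
@[simps]
def forget (A : CrossedAction 𝕜 P C) : Equivariant A ⥤ C where
  obj X := X.obj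
  map f := f.val

instance : (forget A).Monoidal :=
  Functor.CoreMonoidal.toMonoidal
    { εIso := Iso.refl _
      μIso := fun X Y => Iso.refl _
      μIso_hom_natural_left := fun f Y =>
        (Category.comp_id _).trans (Category.id_comp _).symm
      μIso_hom_natural_right := fun f Y =>
        (Category.comp_id _).trans (Category.id_comp _).symm
      associativity := fun X Y Z => by
        change 𝟙 (X.obj ⊗ Y.obj) ▷ Z.obj ≫ 𝟙 _ ≫ (α_ _ _ _).hom = (α_ _ _ _).hom ≫ X.obj ◁ 𝟙 _ ≫ 𝟙 _
        simp
      left_unitality := fun X => by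
        change (λ_ X.obj).hom = 𝟙 _ ▷ X.obj ≫ 𝟙 _ ≫ (λ_ X.obj).hom
        simp
      right_unitality := fun X => by
        change (ρ_ X.obj).hom = X.obj ◁ 𝟙 _ ≫ 𝟙 _ ≫ (ρ_ X.obj).hom
        simp }

end Equivariant

end Equivariantization

section ToMat

open scoped MonoidalRightAction
open Functor.LaxRightLinear Functor.OplaxRightLinear

variable {𝕜 : Type*} [Field 𝕜] {E : Type*} [Category E] [Preadditive E] [MonoidalCategory E]
  [MonoidalPreadditive E] {D : Type u} [Category.{v} D] [Preadditive D] [HasFiniteBiproducts D]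
  [Linear 𝕜 D] [MonoidalRightAction E D] [AdditiveAction E D]

namespace ModEndo

theorem inc_s_comm {F F' : ModEndo 𝕜 E D} (f : F ⟶ F') (d : D) (X : Mat_ E) :
    f.val.app (MatAction.obj d X) ≫ MatAction.linDelta F'.F d X =
      MatAction.linDelta F.F d X ≫ MatAction.mapL (f.val.app d) X :=
  MatAction.ext_map_inc F.F fun i => by
    rw [f.val.naturality_assoc, MatAction.inc_linDelta,
      reassoc_of% (MatAction.inc_linDelta F.F d X i), MatAction.inc_mapL,
      reassoc_of% (f.comm d (X.X i))]

/-- The extension of a module functor to formal direct sums of objects of the acting category. -/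
@[simps]
def toMat (𝕜 : Type*) [Field 𝕜] (E : Type*) [Category E] [Preadditive E] [MonoidalCategory E]
    [MonoidalPreadditive E] (D : Type u) [Category.{v} D] [Preadditive D] [HasFiniteBiproducts D]
    [Linear 𝕜 D] [MonoidalRightAction E D] [AdditiveAction E D] :
    ModEndo 𝕜 E D ⥤ ModEndo 𝕜 (Mat_ E) D where
  obj F := { F := F.F, rightLinear := rightLinearMat F.F }
  map f := ⟨f.val, fun d X => inc_s_comm f d X⟩

theorem toMat_s (F : ModEndo 𝕜 E D) (d : D) (X : Mat_ E) :
    ((toMat 𝕜 E D).obj F).s d X = MatAction.linDelta F.F d X := rfl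

theorem linDelta_unit (d : D) (X : Mat_ E) :
    MatAction.linDelta (𝟙_ (ModEndo 𝕜 E D)).F d X = 𝟙 (MatAction.obj d X) :=
  MatAction.ext_inc fun i => by
    refine (MatAction.inc_linDelta (𝟙_ (ModEndo 𝕜 E D)).F d X i).trans ?_
    change 𝟙 _ ≫ _ = _
    rw [Category.id_comp, Category.comp_id]
    rfl

theorem linDelta_tensor (F F' : ModEndo 𝕜 E D) (d : D) (X : Mat_ E) :
    MatAction.linDelta (F ⊗ F').F d X =
      F.F.map (MatAction.linDelta F'.F d X) ≫ MatAction.linDelta F.F (F'.F.obj d) X :=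
  MatAction.ext_map_inc (F ⊗ F').F fun i => by
    refine (MatAction.inc_linDelta (F ⊗ F').F d X i).trans ?_
    change (F.F.map (F'.s d (X.X i)) ≫ F.s (F'.F.obj d) (X.X i)) ≫ _ =
      F.F.map (F'.F.map (MatAction.inc d X i)) ≫ _
    rw [← F.F.map_comp_assoc, MatAction.inc_linDelta, F.F.map_comp_assoc,
      MatAction.inc_linDelta, Category.assoc]
    rfl

instance : (toMat 𝕜 E D).Monoidal :=
  Functor.CoreMonoidal.toMonoidal
    { εIso := mkIso (Iso.refl _) (fun d X => by
        change 𝟙 _ ≫ MatAction.linDelta (𝟙_ (ModEndo 𝕜 E D)).F d X =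
          𝟙 _ ≫ MatAction.mapL (𝟙 d) X
        rw [linDelta_unit, MatAction.mapL_id]
        rfl)
      μIso := fun F F' => mkIso (Iso.refl _) (fun d X => by
        change 𝟙 _ ≫ MatAction.linDelta (F ⊗ F').F d X =
          (F.F.map (MatAction.linDelta F'.F d X) ≫ MatAction.linDelta F.F (F'.F.obj d) X) ≫
            MatAction.mapL (𝟙 _) X
        rw [linDelta_tensor, MatAction.mapL_id, Category.id_comp, Category.comp_id])
      μIso_hom_natural_left := fun f F => hom_ext fun d =>
        (Category.comp_id _).trans (Category.id_comp _).symm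
      μIso_hom_natural_right := fun F f => hom_ext fun d =>
        (Category.comp_id _).trans (Category.id_comp _).symm
      associativity := fun F F' F'' => hom_ext fun d => by
        change 𝟙 _ ≫ 𝟙 _ ≫ 𝟙 _ = 𝟙 _ ≫ F.F.map (𝟙 _) ≫ 𝟙 _
        simp
      left_unitality := fun F => hom_ext fun d => by
        change 𝟙 _ = 𝟙 _ ≫ 𝟙 _ ≫ 𝟙 _
        simp
      right_unitality := fun F => hom_ext fun d => by
        change 𝟙 _ = F.F.map (𝟙 _) ≫ 𝟙 _ ≫ 𝟙 _
        simp }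

end ModEndo

end ToMat

section FunctorS

open scoped MonoidalRightAction

variable {𝕜 : Type*} [Field 𝕜] {G Γ : Type*} [Group G] [Group Γ] [Fintype Γ]
  {P : MatchedPair G Γ} {C : Type u} [Category.{v} C] [Preadditive C] [HasFiniteBiproducts C]
  [Linear 𝕜 C] [MonoidalCategory C] [MonoidalPreadditive C]

instance (A : CrossedAction 𝕜 P C) : AdditiveAction (CrossedAction.Homog A) C where
  right_add M _ _ f f' := A.mactR_add M f f'
  left_add f f' W := A.mactL_add f f' W

variable [MonoidalLinear 𝕜 C]

instance (A : CrossedAction 𝕜 P C) : LinearAction 𝕜 (CrossedAction.Homog A) C where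
  left_smul a f W := by
    change A.mactL (a • f) W = a • A.mactL f W
    simp [CrossedAction.mactL, Functor.map_smul, MonoidalLinear.smul_whiskerRight]

namespace Equivariant

open CrossedAction

variable {A : CrossedAction 𝕜 P C}

/-- The constraint `X ⊗ (M ◁ g ⊗ Y) ≅ (X ⊗ M) ◁ g ⊗ Y` of the module functor `X ⊗ -`, for an
equivariant object `X`. -/
def sIso (X : Equivariant A) (M : C) (W : Homog A) :
    X.obj ⊗ A.mact M W ≅ A.mact (X.obj ⊗ M) W :=
  (α_ _ _ _).symm ≪≫ whiskerRightIso (X.tau W.g M).symm W.obj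

theorem s_nat_right (X : Equivariant A) (M : C) {W W' : Homog A} (f : W ⟶ W') :
    X.obj ◁ A.mactR M f ≫ (X.sIso M W').hom = (X.sIso M W).hom ≫ A.mactR (X.obj ⊗ M) f := by
  rcases Homog.cases_hom f with h | ⟨h, h'⟩
  · simp [mactR, h]
  · obtain ⟨g, d⟩ := W
    obtain ⟨g', d'⟩ := W'
    dsimp only at h h'
    subst h h'
    simp only [mactR, sIso, RightAction.tr_self, id_whiskerRight, Category.id_comp,
      Iso.trans_hom, Iso.symm_hom, whiskerRightIso_hom, Category.assoc]
    rw [← whisker_exchange]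
    simp

theorem tau_inv_nat_right (X : Equivariant A) (g : G) {Y Y' : C} (f : Y ⟶ Y') :
    X.obj ◁ (A.T.act g).map f ≫ (X.tau g Y').inv =
      (X.tau g Y).inv ≫ (A.T.act g).map (X.obj ◁ f) := by
  rw [← cancel_epi (X.tau g Y).hom, ← reassoc_of% (X.tau_nat_right g f)]
  simp

theorem s_nat_left (X : Equivariant A) {M M' : C} (f : M ⟶ M') (W : Homog A) :
    X.obj ◁ A.mactL f W ≫ (X.sIso M' W).hom = (X.sIso M W).hom ≫ A.mactL (X.obj ◁ f) W := by
  simp only [mactL, sIso, Iso.trans_hom, Iso.symm_hom, whiskerRightIso_hom, Category.assoc,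
    ← comp_whiskerRight, ← tau_inv_nat_right]
  simp

theorem s_assoc (X : Equivariant A) (M : C) (W W' : Homog A) :
    (X.sIso (A.mact M W) W').hom ≫ A.mactL (X.sIso M W).hom W' ≫
      (A.mactAssoc (X.obj ⊗ M) W W').inv =
        X.obj ◁ (A.mactAssoc M W W').inv ≫ (X.sIso M (W.tensor W')).hom := by
  have h₁ := X.tau_η W'.g ((A.T.act W.g).obj M) W.deg
  have h₂ := X.tau_mul W.g (P.l W.k W'.g) _ rfl M
  have h₃ := A.η_nat_left W'.g W.deg (X.tau W.g M).hom
  have h₄ : (A.T.act W'.g).map ((X.tau W.g M).hom ▷ W.obj ≫ (α_ _ _ _).hom) ≫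
      (X.tau W'.g (A.mact M W)).hom ≫ X.obj ◁ ((A.η W'.g ((A.T.act W.g).obj M) W.deg).hom ≫
        (A.T.mulIso M W.g (P.l W.k W'.g) _ rfl).hom ▷ _) =
      (A.η W'.g ((A.T.act W.g).obj (X.obj ⊗ M)) W.deg).hom ≫
        ((A.T.mulIso (X.obj ⊗ M) W.g (P.l W.k W'.g) _ rfl).hom ≫ (X.tau _ M).hom) ▷ _ ≫
          (α_ _ _ _).hom := by
    rw [h₂, Functor.map_comp, MonoidalCategory.whiskerLeft_comp, Category.assoc,
      ← reassoc_of% h₁, reassoc_of% h₃]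
    simp
  have h₅ : (X.sIso (A.mact M W) W').inv = (X.tau W'.g (A.mact M W)).hom ▷ W'.obj ≫
      (α_ _ _ _).hom := by simp [sIso]
  have h₆ : A.mactL (X.sIso M W).inv W' = (A.T.act W'.g).map ((X.tau W.g M).hom ▷ W.obj ≫
      (α_ _ _ _).hom) ▷ W'.obj := by simp [sIso, mactL]
  have h₇ : A.mactL (X.sIso M W).inv W' ≫ A.mactL (X.sIso M W).hom W' = 𝟙 _ := by
    rw [← mactL_comp, Iso.inv_hom_id, mactL_id]
  have h₈ : A.mactL (X.sIso M W).inv W' ≫ (X.sIso (A.mact M W) W').inv ≫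
      X.obj ◁ (A.mactAssoc M W W').inv = (A.mactAssoc (X.obj ⊗ M) W W').inv ≫
        (X.sIso M (W.tensor W')).inv := by
    have h := congrArg (fun t => t ▷ W'.obj ≫ (α_ _ _ _).hom ≫ X.obj ◁ (α_ _ _ _).hom) h₄
    rw [h₅, h₆]
    simp only [mactAssoc_inv, sIso, Iso.trans_inv, Iso.symm_inv, whiskerRightIso_inv]
    refine Eq.trans ?_ (h.trans ?_)
    · simp
    · simp
  have h₉ : X.obj ◁ (A.mactAssoc M W W').inv ≫ (X.sIso M (W.tensor W')).hom =
      (X.sIso (A.mact M W) W').hom ≫ A.mactL (X.sIso M W).hom W' ≫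
        (A.mactL (X.sIso M W).inv W' ≫ (X.sIso (A.mact M W) W').inv ≫
          X.obj ◁ (A.mactAssoc M W W').inv) ≫ (X.sIso M (W.tensor W')).hom := by
    have h₇' : A.mactL (X.sIso M W).hom W' ≫ A.mactL (X.sIso M W).inv W' = 𝟙 _ := by
      rw [← mactL_comp, Iso.hom_inv_id, mactL_id]
    simp only [Category.assoc, reassoc_of% h₇', Iso.hom_inv_id_assoc]
  rw [h₉, h₈]
  simp

theorem s_unit (X : Equivariant A) (M : C) :
    (X.sIso M (Homog.unit A)).hom ≫ (A.mactUnit (X.obj ⊗ M)).hom =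
      X.obj ◁ (A.mactUnit M).hom := by
  have h : X.obj ◁ (A.T.oneIso M).inv = (X.tau 1 M).inv ≫ (A.T.oneIso (X.obj ⊗ M)).inv := by
    rw [← cancel_epi (X.obj ◁ (A.T.oneIso M).hom)]
    nth_rewrite 2 [← X.tau_one M]
    simp
  simp [sIso, mactUnit, h]

theorem s_tensor (X Y : Equivariant A) (M : C) (W : Homog A) :
    (α_ X.obj Y.obj (A.mact M W)).inv ≫ ((X.tensor Y).sIso M W).hom =
      (X.obj ◁ (Y.sIso M W).hom ≫ (X.sIso (Y.obj ⊗ M) W).hom) ≫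
        A.mactL (α_ X.obj Y.obj M).inv W := by
  have h : ((X.tensor Y).tau W.g M).inv = (α_ _ _ _).hom ≫ X.obj ◁ (Y.tau W.g M).inv ≫
      (X.tau W.g (Y.obj ⊗ M)).inv ≫ (A.T.act W.g).map (α_ X.obj Y.obj M).inv := by
    rw [← cancel_epi ((X.tensor Y).tau W.g M).hom, reassoc_of% (X.tau_assoc Y W.g M)]
    simp [← Functor.map_comp, ← MonoidalCategory.whiskerLeft_comp_assoc]
  simp [sIso, h, mactL]

theorem s_tensorUnit (M : C) (W : Homog A) :
    (λ_ (A.mact M W)).inv ≫ ((unit (A := A)).sIso M W).hom =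
      A.mactL (λ_ M).inv W := by
  have h : ((unit (A := A)).tau W.g M).inv = (λ_ _).hom ≫ (A.T.act W.g).map (λ_ M).inv := by
    rw [← cancel_epi ((unit (A := A)).tau W.g M).hom,
      reassoc_of% (tau_unit_left (A := A) W.g M)]
    simp [← Functor.map_comp]
  simp [sIso, h, mactL]

theorem s_map {X X' : Equivariant A} (f : X ⟶ X') (M : C) (W : Homog A) :
    f.val ▷ A.mact M W ≫ (X'.sIso M W).hom =
      (X.sIso M W).hom ≫ A.mactL (f.val ▷ M) W := by
  have h : f.val ▷ _ ≫ (X'.tau W.g M).inv = (X.tau W.g M).inv ≫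
      (A.T.act W.g).map (f.val ▷ M) := by
    rw [← cancel_epi (X.tau W.g M).hom, ← reassoc_of% (tau_nat_left f W.g M)]
    simp
  simp only [sIso, mactL, Iso.trans_hom, Iso.symm_hom, whiskerRightIso_hom, Category.assoc,
    ← comp_whiskerRight, ← h]
  simp

/-- The module functor `X ⊗ -` with its constraint, for the action of homogeneous objects. -/
abbrev tensorLinear (X : Equivariant A) : (tensorLeft X.obj).RightLinear (Homog A) :=
  rightLinearOfIso (tensorLeft X.obj) (fun M W => X.sIso M W)
    (fun M _ _ f => X.s_nat_right M f) (fun f W => X.s_nat_left f W)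
    (fun M W W' => X.s_assoc M W W') (fun M => X.s_unit M)

instance (X : C) : (tensorLeft X).Linear 𝕜 where
  map_smul f r := MonoidalLinear.whiskerLeft_smul X r f

/-- The functor `(X, u) ↦ (X ⊗ -, s)`, with respect to the action of homogeneous objects. -/
@[simps]
def functorSHomog (A : CrossedAction 𝕜 P C) : Equivariant A ⥤ ModEndo 𝕜 (Homog A) C where
  obj X := { F := tensorLeft X.obj, rightLinear := X.tensorLinear }
  map f := ⟨(tensoringLeft C).map f.val, fun M W => s_map f M W⟩

instance : (functorSHomog A).Monoidal :=
  Functor.CoreMonoidal.toMonoidal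
    { εIso := ModEndo.mkIso (NatIso.ofComponents (fun M => (λ_ M).symm)
          (fun f => leftUnitor_inv_naturality f)) (fun M W => by
        refine (s_tensorUnit M W).trans ?_
        exact (Category.id_comp _).symm)
      μIso := fun X Y => ModEndo.mkIso (NatIso.ofComponents (fun M => (α_ X.obj Y.obj M).symm)
          (fun f => associator_inv_naturality_right X.obj Y.obj f))
        (fun M W => s_tensor X Y M W)
      μIso_hom_natural_left := fun f F => ModEndo.hom_ext fun M =>
        associator_inv_naturality_left f.val _ _
      μIso_hom_natural_right := fun F f => ModEndo.hom_ext fun M =>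
        associator_inv_naturality_middle _ f.val _
      associativity := fun X Y Z => ModEndo.hom_ext fun M => by
        change (α_ X.obj Y.obj (Z.obj ⊗ M)).inv ≫ (α_ (X.obj ⊗ Y.obj) Z.obj M).inv ≫
          (α_ X.obj Y.obj Z.obj).hom ▷ M =
            𝟙 _ ≫ X.obj ◁ (α_ Y.obj Z.obj M).inv ≫ (α_ X.obj (Y.obj ⊗ Z.obj) M).inv
        simp
      left_unitality := fun X => ModEndo.hom_ext fun M => by
        change 𝟙 _ = (λ_ (X.obj ⊗ M)).inv ≫ (α_ (𝟙_ C) X.obj M).inv ≫ (λ_ X.obj).hom ▷ M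
        simp
      right_unitality := fun X => ModEndo.hom_ext fun M => by
        change 𝟙 _ = X.obj ◁ (λ_ M).inv ≫ (α_ X.obj (𝟙_ C) M).inv ≫ (ρ_ X.obj).hom ▷ M
        simp }

end Equivariant

/-- The tensor category `B = vec_G ⋈ C`: formal finite direct sums of the homogeneous objects
`g ⋈ X`. -/
abbrev Bicrossed (A : CrossedAction 𝕜 P C) := Mat_ (CrossedAction.Homog A)

/-- The dual category `B*_C` of `𝕜`-linear `B`-module endofunctors of `C`. -/
abbrev DualCat (A : CrossedAction 𝕜 P C) := ModEndo 𝕜 (Bicrossed A) C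

/-- The functor `S : C^(G,Γ) ⥤ B*_C`, which sends `(X, u)` to the functor `X ⊗ -` with constraint
`s = (η⁻¹ ⊗ id) (u⁻¹ ⊗ id ⊗ id) α⁻¹ : X ⊗ (M ◁ g ⊗ Y) ⟶ (X ⊗ M) ◁ g ⊗ Y`. Its monoidal structure
is given by the inverses of the associativity constraints. -/
def functorS (A : CrossedAction 𝕜 P C) : Equivariant A ⥤ DualCat A :=
  Equivariant.functorSHomog A ⋙ ModEndo.toMat 𝕜 (CrossedAction.Homog A) C

instance (A : CrossedAction 𝕜 P C) : (functorS A).Monoidal :=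
  inferInstanceAs (Equivariant.functorSHomog A ⋙
    ModEndo.toMat 𝕜 (CrossedAction.Homog A) C).Monoidal

end FunctorS

section OfMat

open scoped MonoidalRightAction
open Functor.LaxRightLinear Functor.OplaxRightLinear

variable {𝕜 : Type*} [Field 𝕜] {E : Type*} [Category E] [Preadditive E] [MonoidalCategory E]
  [MonoidalPreadditive E] {D : Type u} [Category.{v} D] [Preadditive D] [HasFiniteBiproducts D]
  [Linear 𝕜 D] [MonoidalRightAction E D] [AdditiveAction E D]

namespace ModEndo

/-- A formal sum with one summand. -/
abbrev sgl (c : E) : Mat_ E := ⟨PUnit, fun _ => c⟩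

/-- A morphism of formal sums with one summand. -/
def sglMap {c c' : E} (f : c ⟶ c') : sgl c ⟶ sgl c' := fun _ _ => f

/-- The canonical morphism to the formal sum with one summand `c ⊗ c'`. -/
def sglMul (c c' : E) : sgl c ⊗ sgl c' ⟶ sgl (c ⊗ c') :=
  MatAux.mono (M := sgl c ⊗ sgl c') (N := sgl (c ⊗ c')) (fun _ => PUnit.unit) (fun _ => 𝟙 (c ⊗ c'))

/-- The action of a formal sum with one summand. -/
def sglIso (d : D) (c : E) : d ⊙ᵣ c ≅ MatAction.obj d (sgl c) where
  hom := MatAction.inc d (sgl c) PUnit.unit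
  inv := MatAction.prj d (sgl c) PUnit.unit
  hom_inv_id := biproduct.ι_π_self _ _
  inv_hom_id := by
    refine Eq.trans ?_ (biproduct_total fun i => d ⊙ᵣ (sgl c).X i)
    exact (Fintype.sum_unique fun j : PUnit => biproduct.π (fun i => d ⊙ᵣ (sgl c).X i) j ≫
      biproduct.ι (fun i => d ⊙ᵣ (sgl c).X i) j).symm

theorem sglIso_nat_right (d : D) {c c' : E} (f : c ⟶ c') :
    d ⊴ᵣ f ≫ (sglIso d c').hom = (sglIso d c).hom ≫ MatAction.mapR d (sglMap f) := by
  refine Eq.trans ?_ (MatAction.inc_mapR d (sglMap f) PUnit.unit).symm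
  exact (Fintype.sum_unique (fun _ : PUnit => d ⊴ᵣ f ≫ (sglIso d c').hom)).symm

theorem sglIso_nat_left {d d' : D} (f : d ⟶ d') (c : E) :
    f ⊵ᵣ c ≫ (sglIso d' c).hom = (sglIso d c).hom ≫ MatAction.mapL f (sgl c) :=
  (MatAction.inc_mapL f (sgl c) PUnit.unit).symm

theorem sglIso_assoc (d : D) (c c' : E) :
    (sglIso d c).hom ⊵ᵣ c' ≫ (sglIso _ c').hom ≫ MatAction.assocInv d (sgl c) (sgl c') ≫
      MatAction.mapR d (sglMul c c') = (αᵣ d c c').inv ≫ (sglIso d (c ⊗ c')).hom := by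
  have h₁ := MatAction.inc₂_assocInv d (sgl c) (sgl c') PUnit.unit PUnit.unit
  have h₂ := MatAction.inc_mapR_mono d (X := sgl c ⊗ sgl c') (Y := sgl (c ⊗ c'))
    (fun _ => PUnit.unit) (fun _ => 𝟙 (c ⊗ c')) (PUnit.unit, PUnit.unit)
  have h₃ : (sglIso d c).hom ⊵ᵣ c' ≫ (sglIso _ c').hom =
    MatAction.inc₂ d (sgl c) (sgl c') PUnit.unit PUnit.unit := rfl
  rw [reassoc_of% h₃, reassoc_of% h₁]
  refine (congrArg (fun t => (αᵣ d c c').inv ≫ t) h₂).trans ?_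
  exact congrArg (fun t => (αᵣ d c c').inv ≫ t)
    ((congrArg (fun t => t ≫ (sglIso d (c ⊗ c')).hom)
      (MonoidalRightAction.actionHomRight_id (c ⊗ c') d)).trans (Category.id_comp _))

theorem sglIso_assoc_left {d d' : D} (c c' : E) (h : d ⟶ MatAction.obj d' (sgl c)) :
    MatAction.mapL h (sgl c') ≫ MatAction.assocInv d' (sgl c) (sgl c') ≫
      MatAction.mapR d' (sglMul c c') ≫ (sglIso d' (c ⊗ c')).inv =
        (sglIso d c').inv ≫ (h ≫ (sglIso d' c).inv) ⊵ᵣ c' ≫ (αᵣ d' c c').inv := by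
  rw [← cancel_epi (sglIso d c').hom, ← reassoc_of% (sglIso_nat_left h c')]
  have e : h = (h ≫ (sglIso d' c).inv) ≫ (sglIso d' c).hom := by simp
  conv_lhs => rw [e]
  rw [MonoidalRightAction.comp_actionHomLeft, Category.assoc,
    reassoc_of% (sglIso_assoc d' c c')]
  simp

/-- The restriction of the constraint of a module functor. -/
def ofMatIso (F : ModEndo 𝕜 (Mat_ E) D) (d : D) (c : E) : F.F.obj (d ⊙ᵣ c) ≅ F.F.obj d ⊙ᵣ c :=
  F.F.mapIso (sglIso d c) ≪≫ (Functor.RightLinear.μᵣIso F.F d (sgl c)).symm ≪≫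
    (sglIso (F.F.obj d) c).symm

theorem ofMatIso_hom (F : ModEndo 𝕜 (Mat_ E) D) (d : D) (c : E) : (ofMatIso F d c).hom =
    F.F.map (sglIso d c).hom ≫ F.s d (sgl c) ≫ (sglIso (F.F.obj d) c).inv := rfl

theorem s_mapL (F : ModEndo 𝕜 (Mat_ E) D) {d d' : D} (f : d ⟶ d') (X : Mat_ E) :
    F.F.map (MatAction.mapL f X) ≫ F.s d' X = F.s d X ≫ MatAction.mapL (F.F.map f) X :=
  δᵣ_naturality_left F.F f X

theorem s_mapR (F : ModEndo 𝕜 (Mat_ E) D) (d : D) {X Y : Mat_ E} (f : X ⟶ Y) :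
    F.F.map (MatAction.mapR d f) ≫ F.s d Y = F.s d X ≫ MatAction.mapR (F.F.obj d) f :=
  δᵣ_naturality_right F.F d f

theorem s_assocInv (F : ModEndo 𝕜 (Mat_ E) D) (d : D) (X Y : Mat_ E) :
    F.s (MatAction.obj d X) Y ≫ MatAction.mapL (F.s d X) Y ≫
      MatAction.assocInv (F.F.obj d) X Y =
        F.F.map (MatAction.assocInv d X Y) ≫ F.s d (X ⊗ Y) :=
  δᵣ_associativity_inv F.F d X Y

/-- A module functor for the action of `Mat_ E` is a module functor for the action of `E`. -/
abbrev ofMatLinear (F : ModEndo 𝕜 (Mat_ E) D) : F.F.RightLinear E :=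
  rightLinearOfIso F.F (fun d c => ofMatIso F d c)
    (fun d c c' f => by
      rw [ofMatIso_hom, ofMatIso_hom, ← F.F.map_comp_assoc, sglIso_nat_right, F.F.map_comp_assoc,
        reassoc_of% (s_mapR F d (sglMap f)), Category.assoc, Category.assoc,
        ← cancel_mono (sglIso (F.F.obj d) c').hom]
      simp only [Category.assoc, Iso.inv_hom_id, Category.comp_id]
      rw [sglIso_nat_right, Iso.inv_hom_id_assoc])
    (fun {d d'} f c => by
      rw [ofMatIso_hom, ofMatIso_hom, ← F.F.map_comp_assoc, sglIso_nat_left, F.F.map_comp_assoc,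
        reassoc_of% (s_mapL F f (sgl c)), Category.assoc, Category.assoc,
        ← cancel_mono (sglIso (F.F.obj d') c).hom]
      simp only [Category.assoc, Iso.inv_hom_id, Category.comp_id]
      rw [sglIso_nat_left, Iso.inv_hom_id_assoc])
    (fun d c c' => by
      simp only [ofMatIso_hom]
      have h₁ := congrArg F.F.map (sglIso_assoc d c c')
      have h₂ := sglIso_assoc_left c c' (F.F.map (sglIso d c).hom ≫ F.s d (sgl c))
      rw [← F.F.map_comp_assoc, ← h₁]
      simp only [Functor.map_comp, Category.assoc] at h₂ ⊢
      rw [reassoc_of% (s_mapR F d (sglMul c c')), ← reassoc_of% (s_assocInv F d (sgl c) (sgl c')),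
        ← h₂, MatAction.mapL_comp, Category.assoc, ← reassoc_of% (s_mapL F (sglIso d c).hom),
        ← F.F.map_comp_assoc, ← sglIso_nat_left, F.F.map_comp_assoc])
    (fun d => by
      have h := δᵣ_unitality_hom (C := Mat_ E) F.F d
      have h₁ := MatAction.inc_unitIso (E := E) d PUnit.unit
      have h₂ := MatAction.inc_unitIso (E := E) (F.F.obj d) PUnit.unit
      have h₃ : (sglIso (F.F.obj d) (𝟙_ E)).inv ≫ (ρᵣ[E] (F.F.obj d)).hom =
          (MatAction.unitIso (E := E) (F.F.obj d)).hom := by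
        rw [Iso.inv_comp_eq]
        exact h₂.symm
      rw [ofMatIso_hom, Category.assoc, Category.assoc, h₃, ← h₁, F.F.map_comp]
      exact congrArg (fun t => F.F.map (sglIso d (𝟙_ E)).hom ≫ t) h)

/-- The restriction of module functors along `E ⥤ Mat_ E`. -/
@[simps]
def ofMat (𝕜 : Type*) [Field 𝕜] (E : Type*) [Category E] [Preadditive E] [MonoidalCategory E]
    [MonoidalPreadditive E] (D : Type u) [Category.{v} D] [Preadditive D] [HasFiniteBiproducts D]
    [Linear 𝕜 D] [MonoidalRightAction E D] [AdditiveAction E D] :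
    ModEndo 𝕜 (Mat_ E) D ⥤ ModEndo 𝕜 E D where
  obj F := { F := F.F, rightLinear := ofMatLinear F }
  map {F F'} f := ⟨f.val, fun d c => by
    change f.val.app (d ⊙ᵣ c) ≫ (ofMatIso F' d c).hom = (ofMatIso F d c).hom ≫ f.val.app d ⊵ᵣ c
    have h : f.val.app (MatAction.obj d (sgl c)) ≫ F'.s d (sgl c) =
      F.s d (sgl c) ≫ MatAction.mapL (f.val.app d) (sgl c) := f.comm d (sgl c)
    rw [ofMatIso_hom, ofMatIso_hom, ← f.val.naturality_assoc, reassoc_of% h,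
      ← cancel_mono (sglIso (F'.F.obj d) c).hom]
    simp only [Category.assoc, Iso.inv_hom_id, Category.comp_id]
    rw [sglIso_nat_left, Iso.inv_hom_id_assoc]⟩

instance : (ofMat 𝕜 E D).Monoidal :=
  Functor.CoreMonoidal.toMonoidal
    { εIso := mkIso (Iso.refl _) (fun d c => by
        change 𝟙 _ ≫ (sglIso d c).hom ≫ 𝟙 _ ≫ (sglIso d c).inv = 𝟙 _ ≫ 𝟙 d ⊵ᵣ c
        simp)
      μIso := fun F F' => mkIso (Iso.refl _) (fun d c => by
        change 𝟙 _ ≫ F.F.map (F'.F.map (sglIso d c).hom) ≫ (F.F.map (F'.s d (sgl c)) ≫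
          F.s (F'.F.obj d) (sgl c)) ≫ (sglIso (F.F.obj (F'.F.obj d)) c).inv =
            (F.F.map (F'.F.map (sglIso d c).hom ≫ F'.s d (sgl c) ≫ (sglIso (F'.F.obj d) c).inv) ≫
              F.F.map (sglIso (F'.F.obj d) c).hom ≫ F.s (F'.F.obj d) (sgl c) ≫
                (sglIso (F.F.obj (F'.F.obj d)) c).inv) ≫ 𝟙 _ ⊵ᵣ c
        have h : F.F.map (sglIso (F'.F.obj d) c).inv ≫ F.F.map (sglIso (F'.F.obj d) c).hom =
          𝟙 _ := by rw [← F.F.map_comp]; simp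
        simp only [Category.id_comp, Functor.map_comp, Category.assoc, reassoc_of% h,
          MonoidalRightAction.id_actionHomLeft, Category.comp_id])
      μIso_hom_natural_left := fun f F => hom_ext fun d =>
        (Category.comp_id _).trans (Category.id_comp _).symm
      μIso_hom_natural_right := fun F f => hom_ext fun d =>
        (Category.comp_id _).trans (Category.id_comp _).symm
      associativity := fun F F' F'' => hom_ext fun d => by
        change 𝟙 _ ≫ 𝟙 _ ≫ 𝟙 _ = 𝟙 _ ≫ F.F.map (𝟙 _) ≫ 𝟙 _
        simp
      left_unitality := fun F => hom_ext fun d => by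
        change 𝟙 _ = 𝟙 _ ≫ 𝟙 _ ≫ 𝟙 _
        simp
      right_unitality := fun F => hom_ext fun d => by
        change 𝟙 _ = F.F.map (𝟙 _) ≫ 𝟙 _ ≫ 𝟙 _
        simp }

end ModEndo

end OfMat

section EvalUnit

open Functor.LaxRightLinear Functor.OplaxRightLinear

variable {𝕜 : Type*} [Field 𝕜] {C : Type u} [Category.{v} C] [Preadditive C]
  [Linear 𝕜 C] [MonoidalCategory C]

namespace ModEndo

theorem reg_nat_left (F : ModEndo 𝕜 C C) {X X' : C} (f : X ⟶ X') (Y : C) :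
    F.F.map (f ▷ Y) ≫ F.s X' Y = F.s X Y ≫ F.F.map f ▷ Y :=
  δᵣ_naturality_left F.F f Y

theorem reg_nat_right (F : ModEndo 𝕜 C C) (X : C) {Y Y' : C} (f : Y ⟶ Y') :
    F.F.map (X ◁ f) ≫ F.s X Y' = F.s X Y ≫ F.F.obj X ◁ f :=
  δᵣ_naturality_right F.F X f

theorem reg_assoc (F : ModEndo 𝕜 C C) (X Y Z : C) :
    F.s (X ⊗ Y) Z ≫ F.s X Y ▷ Z ≫ (α_ (F.F.obj X) Y Z).hom =
      F.F.map (α_ X Y Z).hom ≫ F.s X (Y ⊗ Z) :=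
  δᵣ_associativity_inv F.F X Y Z

theorem reg_unit (F : ModEndo 𝕜 C C) (X : C) :
    F.s X (𝟙_ C) ≫ (ρ_ (F.F.obj X)).hom = F.F.map (ρ_ X).hom :=
  δᵣ_unitality_hom F.F X

/-- The isomorphism `F (F' 1) ≅ F 1 ⊗ F' 1`. -/
def evalIso (F : ModEndo 𝕜 C C) (X : C) : F.F.obj (𝟙_ C) ⊗ X ≅ F.F.obj X :=
  Functor.RightLinear.μᵣIso F.F (𝟙_ C) X ≪≫ F.F.mapIso (λ_ X)

theorem evalIso_inv (F : ModEndo 𝕜 C C) (X : C) :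
    (evalIso F X).inv = F.F.map (λ_ X).inv ≫ F.s (𝟙_ C) X := rfl

/-- The equivalence between module endofunctors of the regular module category `C` and `C`,
which sends `F` to `F 1`. -/
@[simps]
def evalUnit (𝕜 : Type*) [Field 𝕜] (C : Type u) [Category.{v} C] [Preadditive C]
    [Linear 𝕜 C] [MonoidalCategory C] : ModEndo 𝕜 C C ⥤ C where
  obj F := F.F.obj (𝟙_ C)
  map f := f.val.app (𝟙_ C)

theorem evalIso_nat_right (F : ModEndo 𝕜 C C) {X Y : C} (f : X ⟶ Y) :
    F.F.obj (𝟙_ C) ◁ f ≫ (evalIso F Y).hom = (evalIso F X).hom ≫ F.F.map f := by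
  rw [← Iso.inv_comp_eq, ← Category.assoc, ← Iso.eq_comp_inv, evalIso_inv, evalIso_inv,
    Category.assoc, ← reg_nat_right, ← F.F.map_comp_assoc, ← F.F.map_comp_assoc,
    leftUnitor_inv_naturality]

theorem evalIso_nat_left {F F' : ModEndo 𝕜 C C} (f : F ⟶ F') (X : C) :
    f.val.app (𝟙_ C) ▷ X ≫ (evalIso F' X).hom = (evalIso F X).hom ≫ f.val.app X := by
  have h : f.val.app (𝟙_ C ⊗ X) ≫ F'.s (𝟙_ C) X = F.s (𝟙_ C) X ≫ f.val.app (𝟙_ C) ▷ X :=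
    f.comm (𝟙_ C) X
  rw [← Iso.inv_comp_eq, ← Category.assoc, ← Iso.eq_comp_inv, evalIso_inv, evalIso_inv,
    Category.assoc, ← h, f.val.naturality_assoc]

theorem evalIso_assoc (F F' : ModEndo 𝕜 C C) (X : C) :
    (evalIso F (F'.F.obj (𝟙_ C))).hom ▷ X ≫ (evalIso (F ⊗ F') X).hom =
      (α_ _ _ _).hom ≫ F.F.obj (𝟙_ C) ◁ (evalIso F' X).hom ≫ (evalIso F (F'.F.obj X)).hom := by
  have h : (evalIso (F ⊗ F') X).inv ≫ (evalIso F (F'.F.obj (𝟙_ C))).inv ▷ X ≫ (α_ _ _ _).hom =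
      (evalIso F (F'.F.obj X)).inv ≫ F.F.obj (𝟙_ C) ◁ (evalIso F' X).inv := by
    have h₁ := reg_assoc F (𝟙_ C) (F'.F.obj (𝟙_ C)) X
    rw [evalIso_inv F, evalIso_inv F, Category.assoc, ← reg_nat_right, ← F.F.map_comp_assoc,
      comp_whiskerRight, Category.assoc]
    have h₂ : (evalIso (F ⊗ F') X).inv = F.F.map (evalIso F' X).inv ≫
        F.s (F'.F.obj (𝟙_ C)) X := by
      rw [evalIso_inv, evalIso_inv, F.F.map_comp, Category.assoc]
      rfl
    rw [h₂, Category.assoc, ← reassoc_of% (reg_nat_left F), h₁, ← F.F.map_comp_assoc,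
      ← F.F.map_comp_assoc]
    congr 2
    simp
  rw [← cancel_epi (α_ _ _ _).inv, ← cancel_epi (F.F.obj (𝟙_ C) ◁ (evalIso F' X).inv),
    ← cancel_epi (evalIso F (F'.F.obj X)).inv, ← reassoc_of% h]
  simp [← MonoidalCategory.whiskerLeft_comp_assoc, ← comp_whiskerRight_assoc]
  rfl

instance : (evalUnit 𝕜 C).Monoidal :=
  Functor.CoreMonoidal.toMonoidal
    { εIso := Iso.refl _
      μIso := fun F F' => evalIso F (F'.F.obj (𝟙_ C))
      μIso_hom_natural_left := fun f F => evalIso_nat_left f _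
      μIso_hom_natural_right := fun F f => evalIso_nat_right F (f.val.app (𝟙_ C))
      associativity := fun F F' F'' => by
        have := evalIso_assoc F F' (F''.F.obj (𝟙_ C))
        refine Eq.trans ?_ this
        exact congrArg (fun t => _ ≫ t) (Category.comp_id _)
      left_unitality := fun F => by
        change (λ_ (F.F.obj (𝟙_ C))).hom = 𝟙 _ ▷ _ ≫ (𝟙 _ ≫ (λ_ (F.F.obj (𝟙_ C))).hom) ≫ 𝟙 _
        simp
      right_unitality := fun F => by
        change (ρ_ (F.F.obj (𝟙_ C))).hom = _ ◁ 𝟙 _ ≫ (evalIso F (𝟙_ C)).hom ≫ 𝟙 _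
        have h := reg_unit F (𝟙_ C)
        rw [← cancel_epi (evalIso F (𝟙_ C)).inv, evalIso_inv, Category.assoc, h]
        rw [← F.F.map_comp, ← unitors_equal, ← evalIso_inv]
        simp }

end ModEndo

end EvalUnit

section Restrict

open scoped MonoidalRightAction
open Functor.LaxRightLinear Functor.OplaxRightLinear

variable {𝕜 : Type*} [Field 𝕜] {G Γ : Type*} [Group G] [Group Γ] [Fintype Γ]
  {P : MatchedPair G Γ} {C : Type u} [Category.{v} C] [Preadditive C] [HasFiniteBiproducts C]
  [Linear 𝕜 C] [MonoidalCategory C] [MonoidalPreadditive C] {A : CrossedAction 𝕜 P C}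

namespace CrossedAction

/-- The homogeneous object `1 ⋈ X`. -/
abbrev Homog.one {X : C} {k : Γ} (hX : A.gr.deg k X) : Homog A := ⟨1, hX⟩

/-- The canonical isomorphism `M ⊗ X ≅ M ◁ 1 ⊗ X = M ⊗ (1 ⋈ X)`. -/
def oneAct (A : CrossedAction 𝕜 P C) (M X : C) : M ⊗ X ≅ (A.T.act 1).obj M ⊗ X :=
  whiskerRightIso (A.T.oneIso M) X

/-- The canonical morphism `(1 ⋈ X) ⊗ (1 ⋈ Y) ⟶ 1 ⋈ (X ⊗ Y)`. -/
def oneMul {X Y : C} {k l : Γ} (hX : A.gr.deg k X) (hY : A.gr.deg l Y) :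
    (Homog.one hX).tensor (Homog.one hY) ⟶ Homog.one (A.gr.deg_tensor hX hY) :=
  ⟨(A.oneAct X Y).inv, fun h => (h (by simp [P.l_one])).elim⟩

theorem oneAct_nat_left {M M' : C} (f : M ⟶ M') {X : C} {k : Γ} (hX : A.gr.deg k X) :
    f ▷ X ≫ (A.oneAct M' X).hom = (A.oneAct M X).hom ≫ A.mactL f (Homog.one hX) := by
  simp [oneAct, mactL, ← comp_whiskerRight, A.T.oneIso_nat]

theorem oneAct_mul (M : C) {X Y : C} {k l : Γ} (hX : A.gr.deg k X) (hY : A.gr.deg l Y) :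
    (A.oneAct M X).hom ▷ Y ≫ (A.oneAct ((A.T.act 1).obj M ⊗ X) Y).hom ≫
      (A.mactAssoc M (Homog.one hX) (Homog.one hY)).inv ≫ A.mactR M (oneMul hX hY) =
        (α_ M X Y).hom ≫ (A.oneAct M (X ⊗ Y)).hom := by
  have h₁ := A.η_one ((A.T.act 1).obj M) hX
  have h₂ : A.T.tr ((A.T.act 1).obj M) 1 (P.l k 1) ≫ (A.T.mulIso M 1 (P.l k 1) _ rfl).hom ≫
      A.T.tr M _ 1 = (A.T.mulIso M 1 1 1 (mul_one 1)).hom := by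
    rw [A.T.mulIso_tr _ _ _ _ _ _ (by rw [P.l_one, mul_one]), A.T.tr_mulIso]
  have h₃ : (A.T.oneIso ((A.T.act 1).obj M ⊗ X)).hom ≫ (A.η 1 ((A.T.act 1).obj M) hX).hom ≫
      ((A.T.mulIso M 1 (P.l k 1) _ rfl).hom ≫
      A.T.tr M _ 1) ▷ _ ≫ _ ◁ (A.T.oneIso X).inv = 𝟙 _ := by
    rw [reassoc_of% h₁,
      ← whisker_exchange_assoc, ← comp_whiskerRight_assoc, Category.assoc, h₂, A.T.mulIso_one]
    simp
  have h₄ := congrArg (fun t => (A.oneAct M X).hom ▷ Y ≫ t ▷ Y ≫ (α_ _ _ _).hom) h₃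
  simp only [mactAssoc_inv, mactR, oneMul]
  refine Eq.trans ?_ (h₄.trans ?_)
  · simp [oneAct]
  · simp [oneAct]

end CrossedAction

namespace ModEndo

open CrossedAction

theorem hs_mactL (F : ModEndo 𝕜 (Homog A) C) {M M' : C} (f : M ⟶ M') (W : Homog A) :
    F.F.map (A.mactL f W) ≫ F.s M' W = F.s M W ≫ A.mactL (F.F.map f) W :=
  δᵣ_naturality_left F.F f W

theorem hs_mactR (F : ModEndo 𝕜 (Homog A) C) (M : C) {W W' : Homog A} (f : W ⟶ W') :
    F.F.map (A.mactR M f) ≫ F.s M W' = F.s M W ≫ A.mactR (F.F.obj M) f :=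
  δᵣ_naturality_right F.F M f

theorem hs_assoc (F : ModEndo 𝕜 (Homog A) C) (M : C) (W W' : Homog A) :
    F.s (A.mact M W) W' ≫ A.mactL (F.s M W) W' ≫ (A.mactAssoc (F.F.obj M) W W').inv =
      F.F.map (A.mactAssoc M W W').inv ≫ F.s M (W.tensor W') :=
  δᵣ_associativity_inv F.F M W W'

theorem hs_unit (F : ModEndo 𝕜 (Homog A) C) (M : C) :
    F.s M (Homog.unit A) ≫ (A.mactUnit (F.F.obj M)).hom = F.F.map (A.mactUnit M).hom :=
  δᵣ_unitality_hom F.F M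

/-- The restriction of the constraint of a `B`-module functor to the homogeneous objects of
`C ⊆ B`. -/
def resHomog (F : ModEndo 𝕜 (Homog A) C) (M : C) {X : C} {k : Γ} (hX : A.gr.deg k X) :
    F.F.obj (M ⊗ X) ≅ F.F.obj M ⊗ X :=
  F.F.mapIso (A.oneAct M X) ≪≫ (Functor.RightLinear.μᵣIso F.F M (Homog.one hX)).symm ≪≫
    (A.oneAct (F.F.obj M) X).symm

theorem resHomog_hom (F : ModEndo 𝕜 (Homog A) C) (M : C) {X : C} {k : Γ} (hX : A.gr.deg k X) :
    (resHomog F M hX).hom = F.F.map (A.oneAct M X).hom ≫ F.s M (Homog.one hX) ≫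
      (A.oneAct (F.F.obj M) X).inv := rfl

theorem resHomog_nat_left (F : ModEndo 𝕜 (Homog A) C) {M M' : C} (f : M ⟶ M') {X : C} {k : Γ}
    (hX : A.gr.deg k X) : F.F.map (f ▷ X) ≫ (resHomog F M' hX).hom =
      (resHomog F M hX).hom ≫ F.F.map f ▷ X := by
  rw [resHomog_hom, resHomog_hom, ← F.F.map_comp_assoc, oneAct_nat_left f hX, F.F.map_comp_assoc,
    reassoc_of% (hs_mactL F f (Homog.one hX)), ← cancel_mono (A.oneAct (F.F.obj M') X).hom]
  simp only [Category.assoc, Iso.inv_hom_id, Category.comp_id]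
  rw [oneAct_nat_left _ hX, Iso.inv_hom_id_assoc]

theorem resHomog_nat_right (F : ModEndo 𝕜 (Homog A) C) (M : C) {X Y : C} {k : Γ}
    (hX : A.gr.deg k X) (hY : A.gr.deg k Y) (f : X ⟶ Y) :
    F.F.map (M ◁ f) ≫ (resHomog F M hY).hom = (resHomog F M hX).hom ≫ F.F.obj M ◁ f := by
  let q : Homog.one hX ⟶ Homog.one hY := ⟨f, fun h => (h rfl).elim⟩
  have e : ∀ N : C, N ◁ f ≫ (A.oneAct N Y).hom = (A.oneAct N X).hom ≫ A.mactR N q := by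
    intro N
    simp [oneAct, mactR, q, whisker_exchange]
  rw [resHomog_hom, resHomog_hom, ← F.F.map_comp_assoc, e, F.F.map_comp_assoc,
    reassoc_of% (hs_mactR F M q), ← cancel_mono (A.oneAct (F.F.obj M) Y).hom]
  simp only [Category.assoc, Iso.inv_hom_id, Category.comp_id]
  rw [e, Iso.inv_hom_id_assoc]

theorem resHomog_assoc (F : ModEndo 𝕜 (Homog A) C) (M : C) {X Y : C} {k l : Γ}
    (hX : A.gr.deg k X) (hY : A.gr.deg l Y) :
    (resHomog F (M ⊗ X) hY).hom ≫ (resHomog F M hX).hom ▷ Y ≫ (α_ _ _ _).hom =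
      F.F.map (α_ M X Y).hom ≫ (resHomog F M (A.gr.deg_tensor hX hY)).hom := by
  have h₁ := congrArg F.F.map (oneAct_mul M hX hY)
  have h₂ := oneAct_mul (F.F.obj M) hX hY
  have h₃ := hs_assoc F M (Homog.one hX) (Homog.one hY)
  have h₄ := hs_mactR F M (oneMul hX hY)
  have h₅ := oneAct_nat_left (A := A) (A.oneAct M X).hom hY
  have h₆ := hs_mactL F (A.oneAct M X).hom (Homog.one hY)
  have h₇ : (F.F.map (A.oneAct M X).hom ≫ F.s M (Homog.one hX) ≫
      (A.oneAct (F.F.obj M) X).inv) ▷ Y =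
      (A.oneAct _ Y).hom ≫ A.mactL (F.F.map (A.oneAct M X).hom ≫ F.s M (Homog.one hX))
        (Homog.one hY) ≫ (A.oneAct _ Y).inv ≫ (A.oneAct (F.F.obj M) X).inv ▷ Y := by
    rw [← reassoc_of% (oneAct_nat_left (A := A) (F.F.map (A.oneAct M X).hom ≫
      F.s M (Homog.one hX)) hY)]
    simp
  have h₈ : (A.oneAct _ Y).inv ≫ (A.oneAct (F.F.obj M) X).inv ▷ Y ≫ (α_ _ X Y).hom =
      (A.mactAssoc (F.F.obj M) (Homog.one hX) (Homog.one hY)).inv ≫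
        A.mactR (F.F.obj M) (oneMul hX hY) ≫ (A.oneAct (F.F.obj M) (X ⊗ Y)).inv := by
    rw [Iso.inv_comp_eq, ← cancel_epi ((A.oneAct (F.F.obj M) X).hom ▷ Y), reassoc_of% h₂,
      Iso.hom_inv_id, Category.comp_id, hom_inv_whiskerRight_assoc]
  simp only [resHomog_hom, h₇, Category.assoc, Iso.inv_hom_id_assoc]
  rw [← F.F.map_comp_assoc (α_ M X Y).hom, ← h₁]
  simp only [Functor.map_comp, Category.assoc, mactL_comp]
  rw [reassoc_of% h₄, ← reassoc_of% h₃, ← reassoc_of% h₆, ← F.F.map_comp_assoc, ← h₅,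
    F.F.map_comp_assoc, ← h₈]
  rfl

theorem resHomog_unit (F : ModEndo 𝕜 (Homog A) C) (M : C) :
    (resHomog F M A.gr.deg_unit).hom ≫ (ρ_ _).hom = F.F.map (ρ_ M).hom := by
  have h : ∀ N : C, (A.oneAct N (𝟙_ C)).hom ≫ (A.mactUnit N).hom = (ρ_ N).hom := by
    intro N; simp [oneAct, mactUnit]
  rw [resHomog_hom, ← h, ← h, Category.assoc, Category.assoc, Iso.inv_hom_id_assoc, hs_unit,
    ← F.F.map_comp]

/-- The restriction of the constraint of a `B`-module functor to `C ⊆ B`. -/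
def resHom (F : ModEndo 𝕜 (Homog A) C) (M X : C) : F.F.obj (M ⊗ X) ⟶ F.F.obj M ⊗ X :=
  ∑ k, F.F.map (M ◁ A.gr.proj X k) ≫ (resHomog F M (A.gr.deg_comp X k)).hom ≫
    F.F.obj M ◁ A.gr.incl X k

/-- The inverse of `resHom`. -/
def resInv (F : ModEndo 𝕜 (Homog A) C) (M X : C) : F.F.obj M ⊗ X ⟶ F.F.obj (M ⊗ X) :=
  ∑ k, F.F.obj M ◁ A.gr.proj X k ≫ (resHomog F M (A.gr.deg_comp X k)).inv ≫
    F.F.map (M ◁ A.gr.incl X k)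

theorem incl_resHom (F : ModEndo 𝕜 (Homog A) C) (M X : C) (k : Γ) :
    F.F.map (M ◁ A.gr.incl X k) ≫ resHom F M X =
      (resHomog F M (A.gr.deg_comp X k)).hom ≫ F.F.obj M ◁ A.gr.incl X k := by
  rw [resHom, Preadditive.comp_sum, Finset.sum_eq_single k]
  · rw [← F.F.map_comp_assoc, ← MonoidalCategory.whiskerLeft_comp, A.gr.incl_proj]
    simp
  · intro l _ hl
    rw [← F.F.map_comp_assoc, ← MonoidalCategory.whiskerLeft_comp, A.gr.incl_proj_ne _ hl.symm]
    simp
  · simp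

theorem incl_resInv (F : ModEndo 𝕜 (Homog A) C) (M X : C) (k : Γ) :
    F.F.obj M ◁ A.gr.incl X k ≫ resInv F M X =
      (resHomog F M (A.gr.deg_comp X k)).inv ≫ F.F.map (M ◁ A.gr.incl X k) := by
  rw [resInv, Preadditive.comp_sum, Finset.sum_eq_single k]
  · rw [← MonoidalCategory.whiskerLeft_comp_assoc, A.gr.incl_proj]
    simp
  · intro l _ hl
    rw [← MonoidalCategory.whiskerLeft_comp_assoc, A.gr.incl_proj_ne _ hl.symm]
    simp
  · simp

/-- The restriction of the constraint of a `B`-module functor to `C ⊆ B`. -/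
def resIso (F : ModEndo 𝕜 (Homog A) C) (M X : C) : F.F.obj (M ⊗ X) ≅ F.F.obj M ⊗ X where
  hom := resHom F M X
  inv := resInv F M X
  hom_inv_id := A.gr.hom_ext_incl (tensorLeft M ⋙ F.F) fun k => by
    change F.F.map (M ◁ A.gr.incl X k) ≫ _ = F.F.map (M ◁ A.gr.incl X k) ≫ _
    rw [reassoc_of% (incl_resHom F M X k), incl_resInv]
    simp
  inv_hom_id := A.gr.hom_ext_incl (tensorLeft (F.F.obj M)) fun k => by
    change F.F.obj M ◁ A.gr.incl X k ≫ _ = F.F.obj M ◁ A.gr.incl X k ≫ _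
    rw [reassoc_of% (incl_resInv F M X k), incl_resHom]
    simp

theorem incl_res (F : ModEndo 𝕜 (Homog A) C) (M X : C) (k : Γ) :
    F.F.map (M ◁ A.gr.incl X k) ≫ (resIso F M X).hom =
      (resHomog F M (A.gr.deg_comp X k)).hom ≫ F.F.obj M ◁ A.gr.incl X k :=
  incl_resHom F M X k

theorem res_nat_right (F : ModEndo 𝕜 (Homog A) C) (M : C) {X Y : C} (f : X ⟶ Y) :
    F.F.map (M ◁ f) ≫ (resIso F M Y).hom = (resIso F M X).hom ≫ F.F.obj M ◁ f :=
  A.gr.hom_ext_incl (tensorLeft M ⋙ F.F) fun k => by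
    change F.F.map (M ◁ A.gr.incl X k) ≫ _ = F.F.map (M ◁ A.gr.incl X k) ≫ _
    rw [reassoc_of% (incl_res F M X k), ← F.F.map_comp_assoc,
      ← MonoidalCategory.whiskerLeft_comp, A.gr.incl_comp, MonoidalCategory.whiskerLeft_comp,
      F.F.map_comp_assoc, incl_res,
      reassoc_of% (resHomog_nat_right F M (A.gr.deg_comp X k) (A.gr.deg_comp Y k)
        (A.gr.compMap f k)), ← MonoidalCategory.whiskerLeft_comp, ← A.gr.incl_comp]
    simp

theorem res_homog (F : ModEndo 𝕜 (Homog A) C) (M : C) {X : C} {k : Γ} (hX : A.gr.deg k X) :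
    (resIso F M X).hom = (resHomog F M hX).hom := by
  have h : (resIso F M X).hom = F.F.map (M ◁ (A.gr.proj X k ≫ A.gr.incl X k)) ≫
      (resIso F M X).hom := by
    rw [A.gr.proj_incl hX]; simp
  rw [h, MonoidalCategory.whiskerLeft_comp, F.F.map_comp_assoc, incl_res,
    reassoc_of% (resHomog_nat_right F M hX (A.gr.deg_comp X k) (A.gr.proj X k)),
    ← MonoidalCategory.whiskerLeft_comp, A.gr.proj_incl hX]
  simp

theorem res_nat_left (F : ModEndo 𝕜 (Homog A) C) {M M' : C} (f : M ⟶ M') (X : C) :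
    F.F.map (f ▷ X) ≫ (resIso F M' X).hom = (resIso F M X).hom ≫ F.F.map f ▷ X := by
  refine Equivariant.ext_homog (A := A) (F := tensorLeft M ⋙ F.F)
    (F' := tensorLeft (F.F.obj M')) (fun X => F.F.map (f ▷ X) ≫ (resIso F M' X).hom)
    (fun X => (resIso F M X).hom ≫ F.F.map f ▷ X)
    (fun {X Y} q => ?_) (fun {X Y} q => ?_) (fun {X k} hX => ?_) X
  · change F.F.map (M ◁ q) ≫ _ ≫ _ = (_ ≫ _) ≫ F.F.obj M' ◁ q
    rw [Category.assoc, ← res_nat_right, ← F.F.map_comp_assoc, whisker_exchange,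
      F.F.map_comp_assoc]
  · change F.F.map (M ◁ q) ≫ _ ≫ _ = (_ ≫ _) ≫ F.F.obj M' ◁ q
    rw [Category.assoc, ← whisker_exchange, reassoc_of% (res_nat_right F M q)]
  · simp only [res_homog F _ hX]
    exact resHomog_nat_left F f hX

theorem res_assoc (F : ModEndo 𝕜 (Homog A) C) (M X Y : C) :
    (resIso F (M ⊗ X) Y).hom ≫ (resIso F M X).hom ▷ Y ≫ (α_ _ _ _).hom =
      F.F.map (α_ M X Y).hom ≫ (resIso F M (X ⊗ Y)).hom := by
  refine Equivariant.ext_homog (A := A) (F := tensorLeft (M ⊗ X) ⋙ F.F)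
    (F' := tensorLeft X ⋙ tensorLeft (F.F.obj M))
    (fun Y => (resIso F (M ⊗ X) Y).hom ≫ (resIso F M X).hom ▷ Y ≫ (α_ _ _ _).hom)
    (fun Y => F.F.map (α_ M X Y).hom ≫ (resIso F M (X ⊗ Y)).hom)
    (fun {Y Y'} q => ?_) (fun {Y Y'} q => ?_) (fun {Y l} hY => ?_) Y
  · change F.F.map ((M ⊗ X) ◁ q) ≫ _ ≫ _ ≫ _ = (_ ≫ _ ≫ _) ≫ F.F.obj M ◁ X ◁ q
    rw [Category.assoc, Category.assoc, ← associator_naturality_right, ← whisker_exchange_assoc,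
      reassoc_of% (res_nat_right F (M ⊗ X) q)]
  · change F.F.map ((M ⊗ X) ◁ q) ≫ _ ≫ _ = (_ ≫ _) ≫ F.F.obj M ◁ X ◁ q
    rw [Category.assoc, ← res_nat_right, ← F.F.map_comp_assoc, ← F.F.map_comp_assoc,
      associator_naturality_right]
  refine Equivariant.ext_homog (A := A) (F := tensorLeft M ⋙ tensorRight Y ⋙ F.F)
    (F' := tensorRight Y ⋙ tensorLeft (F.F.obj M))
    (fun X => (resIso F (M ⊗ X) Y).hom ≫ (resIso F M X).hom ▷ Y ≫ (α_ _ _ _).hom)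
    (fun X => F.F.map (α_ M X Y).hom ≫ (resIso F M (X ⊗ Y)).hom)
    (fun {X X'} q => ?_) (fun {X X'} q => ?_) (fun {X k} hX => ?_) X
  · change F.F.map ((M ◁ q) ▷ Y) ≫ _ ≫ _ ≫ _ = (_ ≫ _ ≫ _) ≫ F.F.obj M ◁ q ▷ Y
    rw [Category.assoc, Category.assoc, ← associator_naturality_middle,
      reassoc_of% (res_nat_left F (M ◁ q) Y), ← comp_whiskerRight_assoc,
      ← comp_whiskerRight_assoc, res_nat_right]
  · change F.F.map ((M ◁ q) ▷ Y) ≫ _ ≫ _ = (_ ≫ _) ≫ F.F.obj M ◁ q ▷ Y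
    rw [Category.assoc, ← res_nat_right, ← F.F.map_comp_assoc, ← F.F.map_comp_assoc,
      associator_naturality_middle]
  · simp only [res_homog F _ hX, res_homog F _ hY, res_homog F _ (A.gr.deg_tensor hX hY)]
    exact resHomog_assoc F M hX hY

theorem res_unit (F : ModEndo 𝕜 (Homog A) C) (M : C) :
    (resIso F M (𝟙_ C)).hom ≫ (ρ_ _).hom = F.F.map (ρ_ M).hom := by
  rw [res_homog F M A.gr.deg_unit, resHomog_unit]

theorem res_map {F F' : ModEndo 𝕜 (Homog A) C} (f : F ⟶ F') (M X : C) :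
    f.val.app (M ⊗ X) ≫ (resIso F' M X).hom = (resIso F M X).hom ≫ f.val.app M ▷ X := by
  refine Equivariant.ext_homog (A := A) (F := tensorLeft M ⋙ F.F)
    (F' := tensorLeft (F'.F.obj M)) (fun X => f.val.app (M ⊗ X) ≫ (resIso F' M X).hom)
    (fun X => (resIso F M X).hom ≫ f.val.app M ▷ X)
    (fun {X Y} q => ?_) (fun {X Y} q => ?_) (fun {X k} hX => ?_) X
  · change F.F.map (M ◁ q) ≫ _ ≫ _ = (_ ≫ _) ≫ F'.F.obj M ◁ q
    rw [Category.assoc, ← res_nat_right, f.val.naturality_assoc]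
  · change F.F.map (M ◁ q) ≫ _ ≫ _ = (_ ≫ _) ≫ F'.F.obj M ◁ q
    rw [Category.assoc, ← whisker_exchange, reassoc_of% (res_nat_right F M q)]
  · simp only [res_homog F _ hX, res_homog F' _ hX]
    have h : f.val.app ((A.T.act 1).obj M ⊗ X) ≫ F'.s M (Homog.one hX) =
      F.s M (Homog.one hX) ≫ A.mactL (f.val.app M) (Homog.one hX) := f.comm M (Homog.one hX)
    rw [resHomog_hom, resHomog_hom, ← f.val.naturality_assoc, reassoc_of% h,
      ← cancel_mono (A.oneAct (F'.F.obj M) X).hom]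
    simp only [Category.assoc, Iso.inv_hom_id, Category.comp_id]
    rw [oneAct_nat_left _ hX, Iso.inv_hom_id_assoc]

theorem res_comp (F F' : ModEndo 𝕜 (Homog A) C) (M X : C) :
    (resIso (F ⊗ F') M X).hom =
      F.F.map (resIso F' M X).hom ≫ (resIso F (F'.F.obj M) X).hom := by
  refine Equivariant.ext_homog (A := A) (F := tensorLeft M ⋙ F'.F ⋙ F.F)
    (F' := tensorLeft (F.F.obj (F'.F.obj M))) (fun X => (resIso (F ⊗ F') M X).hom)
    (fun X => F.F.map (resIso F' M X).hom ≫ (resIso F (F'.F.obj M) X).hom)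
    (fun {X Y} q => ?_) (fun {X Y} q => ?_) (fun {X k} hX => ?_) X
  · exact res_nat_right (F ⊗ F') M q
  · change F.F.map (F'.F.map (M ◁ q)) ≫ _ ≫ _ = (_ ≫ _) ≫ F.F.obj (F'.F.obj M) ◁ q
    rw [Category.assoc, ← res_nat_right, ← F.F.map_comp_assoc, ← F.F.map_comp_assoc,
      res_nat_right]
  · simp only [res_homog F _ hX, res_homog F' _ hX, res_homog (F ⊗ F') _ hX, resHomog_hom]
    have h : F.F.map (A.oneAct (F'.F.obj M) X).inv ≫ F.F.map (A.oneAct (F'.F.obj M) X).hom =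
      𝟙 _ := by rw [← F.F.map_comp]; simp
    change F.F.map (F'.F.map (A.oneAct M X).hom) ≫ (F.F.map (F'.s M (Homog.one hX)) ≫
      F.s (F'.F.obj M) (Homog.one hX)) ≫ (A.oneAct (F.F.obj (F'.F.obj M)) X).inv = _
    simp only [Functor.map_comp, Category.assoc, reassoc_of% h]

theorem res_id (M X : C) : (resIso (𝟙_ (ModEndo 𝕜 (Homog A) C)) M X).hom = 𝟙 (M ⊗ X) := by
  refine Equivariant.ext_homog (A := A) (F := tensorLeft M)
    (F' := tensorLeft M) (fun X => (resIso (𝟙_ (ModEndo 𝕜 (Homog A) C)) M X).hom)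
    (fun X => 𝟙 (M ⊗ X))
    (fun {X Y} q => ?_) (fun {X Y} q => ?_) (fun {X k} hX => ?_) X
  · exact res_nat_right (𝟙_ (ModEndo 𝕜 (Homog A) C)) M q
  · exact (Category.comp_id _).trans (Category.id_comp _).symm
  · simp only [res_homog _ _ hX, resHomog_hom]
    change (A.oneAct M X).hom ≫ 𝟙 _ ≫ (A.oneAct M X).inv = _
    simp

/-- The restriction of module functors along the inclusion `C ⥤ B`, `X ↦ 1 ⋈ X`. -/
@[simps]
def restrict (A : CrossedAction 𝕜 P C) : ModEndo 𝕜 (Homog A) C ⥤ ModEndo 𝕜 C C where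
  obj F :=
    { F := F.F
      rightLinear := rightLinearOfIso F.F (fun M X => resIso F M X)
        (fun M _ _ f => res_nat_right F M f) (fun f X => res_nat_left F f X)
        (fun M X Y => res_assoc F M X Y) (fun M => res_unit F M) }
  map f := ⟨f.val, fun M X => res_map f M X⟩

instance : (restrict A).Monoidal :=
  Functor.CoreMonoidal.toMonoidal
    { εIso := mkIso (Iso.refl _) (fun M X => by
        change 𝟙 _ ≫ (resIso (𝟙_ (ModEndo 𝕜 (Homog A) C)) M X).hom = 𝟙 _ ≫ 𝟙 M ▷ X
        rw [res_id]
        simp)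
      μIso := fun F F' => mkIso (Iso.refl _) (fun M X => by
        change 𝟙 _ ≫ (resIso (F ⊗ F') M X).hom =
          (F.F.map (resIso F' M X).hom ≫ (resIso F (F'.F.obj M) X).hom) ≫ 𝟙 _ ▷ X
        rw [res_comp, id_whiskerRight, Category.id_comp, Category.comp_id])
      μIso_hom_natural_left := fun f F => hom_ext fun d =>
        (Category.comp_id _).trans (Category.id_comp _).symm
      μIso_hom_natural_right := fun F f => hom_ext fun d =>
        (Category.comp_id _).trans (Category.id_comp _).symm
      associativity := fun F F' F'' => hom_ext fun d => by
        change 𝟙 _ ≫ 𝟙 _ ≫ 𝟙 _ = 𝟙 _ ≫ F.F.map (𝟙 _) ≫ 𝟙 _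
        simp
      left_unitality := fun F => hom_ext fun d => by
        change 𝟙 _ = 𝟙 _ ≫ 𝟙 _ ≫ 𝟙 _
        simp
      right_unitality := fun F => hom_ext fun d => by
        change 𝟙 _ = F.F.map (𝟙 _) ≫ 𝟙 _ ≫ 𝟙 _
        simp }

end ModEndo

/-- The functor `B*_C ⥤ C`: a `B`-module endofunctor of `C` is restricted to a module endofunctor
of the regular `C`-module category `C`, and then evaluated at the unit object. -/
def dualToBase [MonoidalLinear 𝕜 C] (A : CrossedAction 𝕜 P C) : DualCat A ⥤ C :=
  ModEndo.ofMat 𝕜 (CrossedAction.Homog A) C ⋙ ModEndo.restrict A ⋙ ModEndo.evalUnit 𝕜 C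

instance [MonoidalLinear 𝕜 C] (A : CrossedAction 𝕜 P C) : (dualToBase A).Monoidal :=
  inferInstanceAs (ModEndo.ofMat 𝕜 (CrossedAction.Homog A) C ⋙ ModEndo.restrict A ⋙
    ModEndo.evalUnit 𝕜 C).Monoidal

end Restrict

section Can

universe w

variable {𝕜 : Type w} [Field 𝕜] {C : Type u} [Category.{v} C] [Preadditive C]
  [HasFiniteBiproducts C] [Linear 𝕜 C] [MonoidalCategory C]

namespace Can

/-- The object `⊕_{i = 1}^{dim V} 1`. -/
abbrev obj (𝕜 : Type w) [Field 𝕜] (C : Type u) [Category.{v} C] [Preadditive C]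
    [HasFiniteBiproducts C] [MonoidalCategory C]
    (V : Type w) [AddCommGroup V] [Module 𝕜 V] : C :=
  ⨁ fun _ : Fin (Module.finrank 𝕜 V) => 𝟙_ C

section Single

variable {V : Type w} [AddCommGroup V] [Module 𝕜 V] [Module.Finite 𝕜 V]

/-- The inclusion of a summand. -/
def inc (C : Type u) [Category.{v} C] [Preadditive C] [HasFiniteBiproducts C]
    [MonoidalCategory C] (V : Type w) [AddCommGroup V] [Module 𝕜 V]
    (i : Fin (Module.finrank 𝕜 V)) : 𝟙_ C ⟶ obj 𝕜 C V :=
  biproduct.ι (fun _ : Fin (Module.finrank 𝕜 V) => 𝟙_ C) i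

/-- The projection to a summand. -/
def prj (C : Type u) [Category.{v} C] [Preadditive C] [HasFiniteBiproducts C]
    [MonoidalCategory C] (V : Type w) [AddCommGroup V] [Module 𝕜 V]
    (i : Fin (Module.finrank 𝕜 V)) : obj 𝕜 C V ⟶ 𝟙_ C :=
  biproduct.π (fun _ : Fin (Module.finrank 𝕜 V) => 𝟙_ C) i

theorem inc_prj_self (i : Fin (Module.finrank 𝕜 V)) : inc C V i ≫ prj C V i = 𝟙 _ :=
  biproduct.ι_π_self _ i

theorem inc_prj_ne {i j : Fin (Module.finrank 𝕜 V)} (h : i ≠ j) : inc C V i ≫ prj C V j = 0 :=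
  biproduct.ι_π_ne _ h

theorem total : ∑ i, prj C V i ≫ inc C V i = 𝟙 (obj 𝕜 C V) :=
  biproduct_total fun _ : Fin (Module.finrank 𝕜 V) => 𝟙_ C

theorem inc_sum {Z : C} (f : Fin (Module.finrank 𝕜 V) → (𝟙_ C ⟶ Z))
    (i : Fin (Module.finrank 𝕜 V)) : inc C V i ≫ ∑ j, prj C V j ≫ f j = f i := by
  rw [Preadditive.comp_sum, Finset.sum_eq_single i]
  · rw [← Category.assoc, inc_prj_self, Category.id_comp]
  · intro j _ hj
    rw [← Category.assoc, inc_prj_ne hj.symm, zero_comp]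
  · simp

/-- The morphism `1 ⟶ ⊕ 1` with entries the coordinates of a vector `v ∈ V`. -/
def ev (C : Type u) [Category.{v} C] [Preadditive C]
    [HasFiniteBiproducts C] [Linear 𝕜 C] [MonoidalCategory C] {V : Type w} [AddCommGroup V]
    [Module 𝕜 V] [Module.Finite 𝕜 V] : V →ₗ[𝕜] (𝟙_ C ⟶ obj 𝕜 C V) :=
  (Module.finBasis 𝕜 V).constr 𝕜 fun i => inc C V i

theorem ev_basis (i : Fin (Module.finrank 𝕜 V)) :
    ev C (Module.finBasis 𝕜 V i) = inc C V i := by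
  simp [ev]

/-- The morphism `⊕ 1 ⟶ X` with entries the images of the basis vectors under `f`. -/
def lift {X : C} (f : V →ₗ[𝕜] (𝟙_ C ⟶ X)) : obj 𝕜 C V ⟶ X :=
  ∑ i, prj C V i ≫ f (Module.finBasis 𝕜 V i)

theorem ev_lift {X : C} (f : V →ₗ[𝕜] (𝟙_ C ⟶ X)) (x : V) : ev C x ≫ lift f = f x := by
  let q : V →ₗ[𝕜] (𝟙_ C ⟶ X) := (Linear.rightComp 𝕜 (𝟙_ C) (lift f)).comp (ev C)
  have h : q = f := by
    refine (Module.finBasis 𝕜 V).ext fun i => ?_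
    change ev C (Module.finBasis 𝕜 V i) ≫ lift f = _
    rw [ev_basis, lift, inc_sum]
  exact LinearMap.congr_fun h x

/-- Two morphisms out of `F (⊕ 1)` agree if they agree on the vectors of `V`. -/
theorem ext_ev {D : Type*} [Category D] [Preadditive D] (F : C ⥤ D) [F.Additive] {Z : D}
    {f f' : F.obj (obj 𝕜 C V) ⟶ Z}
    (h : ∀ x : V, F.map (ev C x) ≫ f = F.map (ev C x) ≫ f') : f = f' := by
  have e : ∀ q : F.obj (obj 𝕜 C V) ⟶ Z,
      q = ∑ i, F.map (prj C V i) ≫ F.map (inc C V i) ≫ q := by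
    intro q
    simp only [← Category.assoc, ← F.map_comp, ← Preadditive.sum_comp, ← F.map_sum, total]
    simp
  rw [e f, e f']
  exact Finset.sum_congr rfl fun i _ => by rw [← ev_basis, h]

theorem hom_ext_ev {Z : C} {f f' : obj 𝕜 C V ⟶ Z} (h : ∀ x : V, ev C x ≫ f = ev C x ≫ f') :
    f = f' := ext_ev (𝟭 C) h

/-- The functoriality of `⊕ 1`: the matrix of a linear map. -/
def map (C : Type u) [Category.{v} C] [Preadditive C] [HasFiniteBiproducts C] [Linear 𝕜 C]
    [MonoidalCategory C] {V W : Type w} [AddCommGroup V] [Module 𝕜 V] [Module.Finite 𝕜 V]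
    [AddCommGroup W] [Module 𝕜 W] [Module.Finite 𝕜 W] (f : V →ₗ[𝕜] W) :
    obj 𝕜 C V ⟶ obj 𝕜 C W :=
  lift ((ev C).comp f)

theorem ev_map {W : Type w} [AddCommGroup W] [Module 𝕜 W] [Module.Finite 𝕜 W] (f : V →ₗ[𝕜] W)
    (x : V) : ev C x ≫ map C f = ev C (f x) := ev_lift _ x

theorem map_id : map C (LinearMap.id : V →ₗ[𝕜] V) = 𝟙 _ :=
  hom_ext_ev fun x => by rw [ev_map, Category.comp_id]; rfl

end Single

section Double

open scoped TensorProduct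

variable [MonoidalPreadditive C] [MonoidalLinear 𝕜 C]
  {V : Type w} [AddCommGroup V] [Module 𝕜 V] [Module.Finite 𝕜 V]
  {W : Type w} [AddCommGroup W] [Module 𝕜 W] [Module.Finite 𝕜 W]

theorem map_comp {U : Type w} [AddCommGroup U] [Module 𝕜 U] [Module.Finite 𝕜 U]
    (f : V →ₗ[𝕜] W) (f' : W →ₗ[𝕜] U) : map C (f'.comp f) = map C f ≫ map C f' :=
  hom_ext_ev fun x => by rw [ev_map, reassoc_of% (ev_map (C := C) f x), ev_map]; rfl

theorem map_add (f f' : V →ₗ[𝕜] W) : map C (f + f') = map C f + map C f' :=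
  hom_ext_ev fun x => by
    rw [Preadditive.comp_add, ev_map, ev_map, ev_map, LinearMap.add_apply, LinearMap.map_add]

theorem map_smul (a : 𝕜) (f : V →ₗ[𝕜] W) : map C (a • f) = a • map C f :=
  hom_ext_ev fun x => by
    rw [Linear.comp_smul, ev_map, ev_map, LinearMap.smul_apply, LinearMap.map_smul]

/-- The morphism `1 ⟶ (⊕ 1) ⊗ (⊕ 1)` corresponding to a pair of vectors. -/
def ev₂ (C : Type u) [Category.{v} C] [Preadditive C] [HasFiniteBiproducts C] [Linear 𝕜 C]
    [MonoidalCategory C] {V W : Type w} [AddCommGroup V] [Module 𝕜 V] [Module.Finite 𝕜 V]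
    [AddCommGroup W] [Module 𝕜 W] [Module.Finite 𝕜 W] (x : V) (y : W) :
    𝟙_ C ⟶ obj 𝕜 C V ⊗ obj 𝕜 C W :=
  ev C y ≫ (λ_ _).inv ≫ ev C x ▷ obj 𝕜 C W

theorem ev₂_eq (x : V) (y : W) :
    ev₂ C x y = ev C x ≫ (ρ_ _).inv ≫ obj 𝕜 C V ◁ ev C y := by
  rw [ev₂, leftUnitor_inv_naturality_assoc, rightUnitor_inv_naturality_assoc, whisker_exchange,
    unitors_inv_equal]

/-- Two morphisms out of `F ((⊕ 1) ⊗ (⊕ 1))` agree if they agree on pairs of vectors. -/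
theorem ext_ev₂ {D : Type*} [Category D] [Preadditive D] (F : C ⥤ D) [F.Additive] {Z : D}
    {f f' : F.obj (obj 𝕜 C V ⊗ obj 𝕜 C W) ⟶ Z}
    (h : ∀ (x : V) (y : W), F.map (ev₂ C x y) ≫ f = F.map (ev₂ C x y) ≫ f') : f = f' :=
  ext_ev (tensorRight (obj 𝕜 C W) ⋙ F) fun x => by
    change F.map (ev C x ▷ obj 𝕜 C W) ≫ f = F.map (ev C x ▷ obj 𝕜 C W) ≫ f'
    have e : ∀ q : F.obj (obj 𝕜 C V ⊗ obj 𝕜 C W) ⟶ Z, F.map (ev C x ▷ obj 𝕜 C W) ≫ q =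
        F.map (λ_ (obj 𝕜 C W)).hom ≫ F.map ((λ_ (obj 𝕜 C W)).inv ≫ ev C x ▷ obj 𝕜 C W) ≫ q := by
      intro q
      rw [← F.map_comp_assoc, Iso.hom_inv_id_assoc]
    rw [e f, e f']
    refine congrArg (fun t => F.map (λ_ (obj 𝕜 C W)).hom ≫ t) (ext_ev F fun y => ?_)
    have := h x y
    rw [ev₂, F.map_comp, Category.assoc, Category.assoc] at this
    exact this

/-- The morphism `(⊕ 1) ⊗ Z ⟶ X` with entries the images of the basis vectors under `f`. -/
def liftL {Z X : C} (f : V →ₗ[𝕜] (Z ⟶ X)) : obj 𝕜 C V ⊗ Z ⟶ X :=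
  ∑ i, prj C V i ▷ Z ≫ (λ_ Z).hom ≫ f (Module.finBasis 𝕜 V i)

theorem ev_liftL {Z X : C} (f : V →ₗ[𝕜] (Z ⟶ X)) (x : V) :
    ev C x ▷ Z ≫ liftL f = (λ_ Z).hom ≫ f x := by
  let q : V →ₗ[𝕜] (𝟙_ C ⊗ Z ⟶ X) :=
    { toFun := fun x => ev C x ▷ Z ≫ liftL f
      map_add' := fun a b => by
        rw [LinearMap.map_add, MonoidalPreadditive.add_whiskerRight, Preadditive.add_comp]
      map_smul' := fun a b => by
        rw [LinearMap.map_smul, MonoidalLinear.smul_whiskerRight, Linear.smul_comp,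
          RingHom.id_apply] }
  have h : q = (Linear.leftComp 𝕜 X (λ_ Z).hom).comp f := by
    refine (Module.finBasis 𝕜 V).ext fun i => ?_
    change ev C (Module.finBasis 𝕜 V i) ▷ Z ≫ liftL f = (λ_ Z).hom ≫ _
    rw [ev_basis, liftL, Preadditive.comp_sum, Finset.sum_eq_single i]
    · rw [← comp_whiskerRight_assoc, inc_prj_self, id_whiskerRight, Category.id_comp]
    · intro j _ hj
      rw [← comp_whiskerRight_assoc, inc_prj_ne hj.symm, MonoidalPreadditive.zero_whiskerRight,
        zero_comp]
    · simp
  exact LinearMap.congr_fun h x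

/-- The canonical morphism `(⊕ 1) ⊗ (⊕ 1) ⟶ ⊕ 1`. -/
def muHom (C : Type u) [Category.{v} C] [Preadditive C] [HasFiniteBiproducts C] [Linear 𝕜 C]
    [MonoidalCategory C] [MonoidalPreadditive C] (V W : Type w) [AddCommGroup V] [Module 𝕜 V]
    [Module.Finite 𝕜 V] [AddCommGroup W] [Module 𝕜 W] [Module.Finite 𝕜 W] :
    obj 𝕜 C V ⊗ obj 𝕜 C W ⟶ obj 𝕜 C (V ⊗[𝕜] W) :=
  liftL (V := V)
    { toFun := fun x => map C (TensorProduct.mk 𝕜 V W x)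
      map_add' := fun a b => hom_ext_ev fun y => by
        rw [Preadditive.comp_add, ev_map, ev_map, ev_map, ← LinearMap.map_add]
        exact congrArg (ev C) (TensorProduct.add_tmul a b y)
      map_smul' := fun a b => hom_ext_ev fun y => by
        rw [Linear.comp_smul, ev_map, ev_map, ← LinearMap.map_smul]
        exact congrArg (ev C) (TensorProduct.smul_tmul' a b y).symm }

theorem ev_mu (x : V) : ev C x ▷ obj 𝕜 C W ≫ muHom C V W =
    (λ_ _).hom ≫ map C (TensorProduct.mk 𝕜 V W x) := ev_liftL _ x

theorem ev₂_mu (x : V) (y : W) : ev₂ C x y ≫ muHom C V W = ev C (x ⊗ₜ[𝕜] y) := by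
  rw [ev₂, Category.assoc, Category.assoc, ev_mu, Iso.inv_hom_id_assoc, ev_map]
  rfl

/-- The isomorphism `(⊕ 1) ⊗ (⊕ 1) ≅ ⊕ 1`. -/
def muIso (C : Type u) [Category.{v} C] [Preadditive C] [HasFiniteBiproducts C] [Linear 𝕜 C]
    [MonoidalCategory C] [MonoidalPreadditive C] [MonoidalLinear 𝕜 C] (V W : Type w)
    [AddCommGroup V] [Module 𝕜 V]
    [Module.Finite 𝕜 V] [AddCommGroup W] [Module 𝕜 W] [Module.Finite 𝕜 W] :
    obj 𝕜 C V ⊗ obj 𝕜 C W ≅ obj 𝕜 C (V ⊗[𝕜] W) where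
  hom := muHom C V W
  inv := lift (TensorProduct.lift (LinearMap.mk₂ 𝕜 (fun (x : V) (y : W) => ev₂ C x y)
    (fun a b y => by
      rw [ev₂, ev₂, ev₂, LinearMap.map_add, MonoidalPreadditive.add_whiskerRight,
        Preadditive.comp_add, Preadditive.comp_add])
    (fun a b y => by
      rw [ev₂, ev₂, LinearMap.map_smul, MonoidalLinear.smul_whiskerRight, Linear.comp_smul,
        Linear.comp_smul])
    (fun a b y => by
      rw [ev₂, ev₂, ev₂, LinearMap.map_add, Preadditive.add_comp])
    (fun a b y => by
      rw [ev₂, ev₂, LinearMap.map_smul, Linear.smul_comp])))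
  hom_inv_id := ext_ev₂ (𝟭 C) fun x y => by
    change ev₂ C x y ≫ muHom C V W ≫ _ = ev₂ C x y ≫ 𝟙 _
    rw [reassoc_of% (ev₂_mu (C := C) x y), ev_lift, Category.comp_id]
    rfl
  inv_hom_id := hom_ext_ev fun z => by
    rw [← Category.assoc, ev_lift, Category.comp_id]
    induction z using TensorProduct.induction_on with
    | zero => rw [LinearMap.map_zero, LinearMap.map_zero, zero_comp]
    | tmul x y =>
      rw [TensorProduct.lift.tmul]
      exact ev₂_mu x y
    | add a b ha hb => rw [LinearMap.map_add, LinearMap.map_add, Preadditive.add_comp, ha, hb]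

/-- The isomorphism `1 ≅ ⊕_{i = 1}^1 1`. -/
def epsIso (𝕜 : Type w) [Field 𝕜] (C : Type u) [Category.{v} C] [Preadditive C]
    [HasFiniteBiproducts C] [Linear 𝕜 C]
    [MonoidalCategory C] : 𝟙_ C ≅ obj 𝕜 C 𝕜 where
  hom := ev C (1 : 𝕜)
  inv := lift (LinearMap.toSpanSingleton 𝕜 _ (𝟙 (𝟙_ C)))
  hom_inv_id := by
    rw [ev_lift]
    exact one_smul _ _
  inv_hom_id := hom_ext_ev fun x => by
    rw [← Category.assoc, ev_lift, Category.comp_id, LinearMap.toSpanSingleton_apply,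
      Linear.smul_comp, Category.id_comp, ← LinearMap.map_smul, smul_eq_mul, mul_one]

theorem mu_nat_left {V' : Type w} [AddCommGroup V'] [Module 𝕜 V'] [Module.Finite 𝕜 V']
    (f : V →ₗ[𝕜] V') : map C f ▷ obj 𝕜 C W ≫ muHom C V' W =
      muHom C V W ≫ map C (TensorProduct.map f LinearMap.id) :=
  ext_ev (tensorRight (obj 𝕜 C W)) fun x => by
    change ev C x ▷ _ ≫ _ = ev C x ▷ _ ≫ _
    rw [← comp_whiskerRight_assoc, ev_map, ev_mu, reassoc_of% (ev_mu (C := C) (W := W) x)]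
    refine congrArg (fun t => (λ_ _).hom ≫ t) (hom_ext_ev fun y => ?_)
    rw [ev_map, reassoc_of% (ev_map (C := C) (TensorProduct.mk 𝕜 V W x) y), ev_map]
    rfl

theorem mu_nat_right {W' : Type w} [AddCommGroup W'] [Module 𝕜 W'] [Module.Finite 𝕜 W']
    (f : W →ₗ[𝕜] W') : obj 𝕜 C V ◁ map C f ≫ muHom C V W' =
      muHom C V W ≫ map C (TensorProduct.map LinearMap.id f) :=
  ext_ev (tensorRight (obj 𝕜 C W)) fun x => by
    change ev C x ▷ _ ≫ _ = ev C x ▷ _ ≫ _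
    rw [← whisker_exchange_assoc, ev_mu, reassoc_of% (ev_mu (C := C) (W := W) x),
      leftUnitor_naturality_assoc]
    refine congrArg (fun t => (λ_ _).hom ≫ t) (hom_ext_ev fun y => ?_)
    rw [reassoc_of% (ev_map (C := C) f y), ev_map,
      reassoc_of% (ev_map (C := C) (TensorProduct.mk 𝕜 V W x) y), ev_map]
    rfl

theorem mu_assoc {U : Type w} [AddCommGroup U] [Module 𝕜 U] [Module.Finite 𝕜 U] :
    muHom C V W ▷ obj 𝕜 C U ≫ muHom C (V ⊗[𝕜] W) U ≫
      map C (TensorProduct.assoc 𝕜 V W U).toLinearMap =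
        (α_ _ _ _).hom ≫ obj 𝕜 C V ◁ muHom C W U ≫ muHom C V (W ⊗[𝕜] U) :=
  ext_ev₂ (tensorRight (obj 𝕜 C U)) fun x y => by
    change ev₂ C x y ▷ _ ≫ _ = ev₂ C x y ▷ _ ≫ _
    rw [← comp_whiskerRight_assoc, ev₂_mu,
      reassoc_of% (ev_mu (C := C) (V := V ⊗[𝕜] W) (W := U) (x ⊗ₜ[𝕜] y))]
    have h : ev₂ C x y ▷ obj 𝕜 C U ≫ (α_ (obj 𝕜 C V) (obj 𝕜 C W) (obj 𝕜 C U)).hom ≫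
        obj 𝕜 C V ◁ muHom C W U ≫ muHom C V (W ⊗[𝕜] U) =
          (λ_ _).hom ≫ map C (TensorProduct.mk 𝕜 W U y) ≫
            map C (TensorProduct.mk 𝕜 V (W ⊗[𝕜] U) x) := by
      rw [ev₂, comp_whiskerRight, comp_whiskerRight, Category.assoc, Category.assoc,
        associator_naturality_left_assoc, ← whisker_exchange_assoc, ev_mu,
        leftUnitor_naturality_assoc, leftUnitor_tensor_hom_assoc]
      simp only [Iso.hom_inv_id_assoc, inv_hom_whiskerRight_assoc]
      rw [reassoc_of% (ev_mu (C := C) (W := U) y)]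
    rw [h]
    refine congrArg (fun t => (λ_ _).hom ≫ t) (hom_ext_ev fun z => ?_)
    rw [reassoc_of% (ev_map (C := C) (TensorProduct.mk 𝕜 (V ⊗[𝕜] W) U (x ⊗ₜ[𝕜] y)) z), ev_map,
      reassoc_of% (ev_map (C := C) (TensorProduct.mk 𝕜 W U y) z), ev_map]
    rfl

theorem mu_left_unit : (λ_ (obj 𝕜 C W)).hom = (epsIso 𝕜 C).hom ▷ obj 𝕜 C W ≫ muHom C 𝕜 W ≫
    map C (TensorProduct.lid 𝕜 W).toLinearMap := by
  change _ = ev (𝕜 := 𝕜) C (1 : 𝕜) ▷ obj 𝕜 C W ≫ _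
  rw [reassoc_of% (ev_mu (𝕜 := 𝕜) (C := C) (W := W) (1 : 𝕜))]
  refine (Category.comp_id _).symm.trans ?_
  refine congrArg (fun t => (λ_ _).hom ≫ t) (hom_ext_ev fun y => ?_)
  rw [reassoc_of% (ev_map (C := C) (TensorProduct.mk 𝕜 𝕜 W 1) y), ev_map, Category.comp_id]
  exact congrArg (ev (𝕜 := 𝕜) C) (one_smul 𝕜 y).symm

theorem mu_right_unit : (ρ_ (obj 𝕜 C V)).hom = obj 𝕜 C V ◁ (epsIso 𝕜 C).hom ≫ muHom C V 𝕜 ≫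
    map C (TensorProduct.rid 𝕜 V).toLinearMap := by
  rw [← cancel_epi (ρ_ (obj 𝕜 C V)).inv, Iso.inv_hom_id]
  refine hom_ext_ev fun x => ?_
  have h := ev₂_eq (𝕜 := 𝕜) (C := C) x (1 : 𝕜)
  change ev C x ≫ 𝟙 _ = ev C x ≫ (ρ_ _).inv ≫ obj 𝕜 C V ◁ ev (𝕜 := 𝕜) C (1 : 𝕜) ≫ _
  have h' := congrArg (fun t => t ≫ muHom C V 𝕜 ≫
    map C (TensorProduct.rid 𝕜 V).toLinearMap) h
  simp only [Category.assoc] at h'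
  rw [← h', reassoc_of% (ev₂_mu (𝕜 := 𝕜) (C := C) x (1 : 𝕜)), ev_map, Category.comp_id]
  exact congrArg (ev (𝕜 := 𝕜) C) (one_smul 𝕜 x).symm

end Double

end Can

variable [MonoidalPreadditive C] [MonoidalLinear 𝕜 C]

/-- The tensor functor `V ↦ ⊕_{i = 1}^{dim V} 1` from finite-dimensional vector spaces to `C`. -/
@[simps]
def can (𝕜 : Type w) [Field 𝕜] (C : Type u) [Category.{v} C] [Preadditive C]
    [HasFiniteBiproducts C] [Linear 𝕜 C] [MonoidalCategory C] [MonoidalPreadditive C]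
    [MonoidalLinear 𝕜 C] : FGModuleCat.{w} 𝕜 ⥤ C where
  obj V := Can.obj 𝕜 C V
  map f := Can.map C f.hom.hom
  map_id V := Can.map_id
  map_comp f f' := Can.map_comp f.hom.hom f'.hom.hom

instance : (can 𝕜 C).Monoidal :=
  Functor.CoreMonoidal.toMonoidal
    { εIso := Can.epsIso 𝕜 C
      μIso := fun V W => Can.muIso C V W
      μIso_hom_natural_left := fun f W => Can.mu_nat_left f.hom.hom
      μIso_hom_natural_right := fun V f => Can.mu_nat_right f.hom.hom
      associativity := fun U V W => Can.mu_assoc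
      left_unitality := fun V => Can.mu_left_unit
      right_unitality := fun V => Can.mu_right_unit }

end Can

section Iota

open CrossedAction

universe w

variable {𝕜 : Type w} [Field 𝕜] {G Γ : Type*} [Group G] [Group Γ] [Fintype Γ]
  {P : MatchedPair G Γ} {C : Type u} [Category.{v} C] [Preadditive C] [HasFiniteBiproducts C]
  [Linear 𝕜 C] [MonoidalCategory C] [MonoidalPreadditive C]

namespace Can

variable {V : Type w} [AddCommGroup V] [Module 𝕜 V] [Module.Finite 𝕜 V]

/-- The isomorphism `(⊕ 1) ◁ g ≅ ⊕ 1`, the direct sum of the isomorphisms `η0 g : 1 ◁ g ≅ 1`. -/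
def sumEta (A : CrossedAction 𝕜 P C) (V : Type w) [AddCommGroup V] [Module 𝕜 V]
    [Module.Finite 𝕜 V] (g : G) : (A.T.act g).obj (obj 𝕜 C V) ≅ obj 𝕜 C V where
  hom := ∑ i, (A.T.act g).map (prj C V i) ≫ (A.η0 g).hom ≫ inc C V i
  inv := ∑ i, prj C V i ≫ (A.η0 g).inv ≫ (A.T.act g).map (inc C V i)
  hom_inv_id := by
    simp only [Preadditive.sum_comp, Category.assoc, inc_sum, Iso.hom_inv_id_assoc]
    simp only [← Functor.map_comp, ← Functor.map_sum, total]
    exact CategoryTheory.Functor.map_id _ _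
  inv_hom_id := by
    have h : ∀ i, (A.T.act g).map (inc (𝕜 := 𝕜) C V i) ≫
        ∑ j, (A.T.act g).map (prj C V j) ≫ (A.η0 g).hom ≫ inc C V j =
          (A.η0 g).hom ≫ inc C V i := by
      intro i
      rw [Preadditive.comp_sum, Finset.sum_eq_single i]
      · rw [← Functor.map_comp_assoc, inc_prj_self, CategoryTheory.Functor.map_id, Category.id_comp]
      · intro j _ hj
        rw [← Functor.map_comp_assoc, inc_prj_ne hj.symm, Functor.map_zero, zero_comp]
      · simp
    rw [Preadditive.sum_comp]
    refine Eq.trans (Finset.sum_congr rfl fun i _ => ?_) total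
    rw [Category.assoc, Category.assoc, h, Iso.inv_hom_id_assoc]

theorem inc_sumEta (A : CrossedAction 𝕜 P C) (g : G) (i : Fin (Module.finrank 𝕜 V)) :
    (A.T.act g).map (inc C V i) ≫ (sumEta A V g).hom = (A.η0 g).hom ≫ inc C V i := by
  have h : inc C V i ≫ (sumEta A V g).inv = (A.η0 g).inv ≫ (A.T.act g).map (inc C V i) :=
    inc_sum _ i
  rw [← Iso.inv_comp_eq, ← Category.assoc, ← h, Category.assoc, Iso.inv_hom_id, Category.comp_id]

theorem ev_sumEta (A : CrossedAction 𝕜 P C) (g : G) (x : V) :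
    (A.T.act g).map (ev C x) ≫ (sumEta A V g).hom = (A.η0 g).hom ≫ ev C x := by
  let q : V →ₗ[𝕜] ((A.T.act g).obj (𝟙_ C) ⟶ obj 𝕜 C V) :=
    (Linear.rightComp 𝕜 _ (sumEta A V g).hom).comp
      (((A.T.act g).mapLinearMap 𝕜).comp (ev C))
  have h : q = (Linear.leftComp 𝕜 _ (A.η0 g).hom).comp (ev C) := by
    refine (Module.finBasis 𝕜 V).ext fun i => ?_
    change (A.T.act g).map (ev C (Module.finBasis 𝕜 V i)) ≫ (sumEta A V g).hom =
      (A.η0 g).hom ≫ ev C (Module.finBasis 𝕜 V i)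
    rw [ev_basis, inc_sumEta]
  exact LinearMap.congr_fun h x

/-- The isomorphism of `⊕ 1` given by the action of a group element. -/
def rhoIso (C : Type u) [Category.{v} C] [Preadditive C] [HasFiniteBiproducts C] [Linear 𝕜 C]
    [MonoidalCategory C] (V : FDRep 𝕜 G) (g : G) : obj 𝕜 C V.V ≅ obj 𝕜 C V.V where
  hom := map C (V.ρ g)
  inv := map C (V.ρ g⁻¹)
  hom_inv_id := hom_ext_ev fun x => by
    rw [reassoc_of% (ev_map (C := C) (V.ρ g) x), ev_map, Category.comp_id,
      ← Module.End.mul_apply, ← map_mul, inv_mul_cancel, _root_.map_one, Module.End.one_apply]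
  inv_hom_id := hom_ext_ev fun x => by
    rw [reassoc_of% (ev_map (C := C) (V.ρ g⁻¹) x), ev_map, Category.comp_id,
      ← Module.End.mul_apply, ← map_mul, mul_inv_cancel, _root_.map_one, Module.End.one_apply]

end Can

open Can

/-- The equivariant object `(⊕ 1, {can (ρ(g)⁻¹) ∘ ⊕ η0 g})` associated with a representation `ρ`.
Since `G` acts from the right on `C`, it is `ρ(g)⁻¹` that enters for a left representation `ρ`. -/
abbrev iotaObj (A : CrossedAction 𝕜 P C) (V : FDRep 𝕜 G) : Equivariant A where
  obj := Can.obj 𝕜 C V.V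
  u g := sumEta A V.V g ≪≫ (rhoIso C V g).symm
  u_mul g h := ext_ev (A.T.act g ⋙ A.T.act h) fun x => by
    change (A.T.act h).map ((A.T.act g).map (ev C x)) ≫ _ ≫ (sumEta A V.V (g * h)).hom ≫
      map C (V.ρ (g * h)⁻¹) = (A.T.act h).map ((A.T.act g).map (ev C x)) ≫
        (A.T.act h).map ((sumEta A V.V g).hom ≫ map C (V.ρ g⁻¹)) ≫ (sumEta A V.V h).hom ≫
          map C (V.ρ h⁻¹)
    have h₁ := (A.T.R2 g h).hom.naturality (ev (𝕜 := 𝕜) C x)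
    have h₂ := A.η0_R2 g h
    simp only [Functor.comp_map] at h₁
    rw [reassoc_of% h₁, reassoc_of% (ev_sumEta A (g * h) x), ev_map, reassoc_of% h₂,
      ← Functor.map_comp_assoc, reassoc_of% (ev_sumEta A g x), ev_map, Functor.map_comp,
      Category.assoc, reassoc_of% (ev_sumEta A h (V.ρ g⁻¹ x)), ev_map, mul_inv_rev, map_mul,
      Module.End.mul_apply]

theorem ev_u (A : CrossedAction 𝕜 P C) (V : FDRep 𝕜 G) (g : G) (x : V.V) :
    (A.T.act g).map (ev C x) ≫ ((iotaObj A V).u g).hom =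
      (A.η0 g).hom ≫ ev C (V.ρ g⁻¹ x) := by
  change (A.T.act g).map (ev C x) ≫ (sumEta A V.V g).hom ≫ map C (V.ρ g⁻¹) = _
  rw [reassoc_of% (ev_sumEta A g x), ev_map]

variable [MonoidalLinear 𝕜 C]

theorem rep_comm {V W : FDRep 𝕜 G} (f : V ⟶ W) (g : G) (x : V.V) :
    f.hom.hom.hom (V.ρ g x) = W.ρ g (f.hom.hom.hom x) :=
  LinearMap.congr_fun (congrArg (fun t => t.hom.hom) (f.comm g)) x

/-- The functor `ι₁ : Rep G ⥤ C^(G,Γ)`. -/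
@[simps]
def iota₁ (A : CrossedAction 𝕜 P C) : FDRep 𝕜 G ⥤ Equivariant A where
  obj V := iotaObj A V
  map {V W} f := ⟨map C f.hom.hom.hom, fun g => ext_ev (A.T.act g) fun x => by
    rw [reassoc_of% (ev_u A V g x), ev_map, ← Functor.map_comp_assoc, ev_map, ev_u, rep_comm]⟩
  map_id V := Equivariant.hom_ext Can.map_id
  map_comp f f' := Equivariant.hom_ext (Can.map_comp f.hom.hom.hom f'.hom.hom.hom)

open scoped TensorProduct in
theorem iota_mu (A : CrossedAction 𝕜 P C) (V W : FDRep 𝕜 G) (g : G) :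
    (((iotaObj A V).tensor (iotaObj A W)).u g).hom ≫ muHom C V.V W.V =
      (A.T.act g).map (muHom C V.V W.V) ≫ ((iotaObj A (V ⊗ W)).u g).hom :=
  ext_ev₂ (A.T.act g) fun x y => by
    have h₁ := ev₂_mu (𝕜 := 𝕜) (C := C) x y
    have h₂ := (iotaObj A V).tau_nat_right g (ev (𝕜 := 𝕜) C y)
    have h₃ := (iotaObj A V).tau_unit_right g
    have h₄ := ev_u A V g x
    have h₅ : (A.T.act g).map (ev C y) ≫ (sumEta A W.V g).hom ≫ (rhoIso C W g).symm.hom =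
      (A.η0 g).hom ≫ ev C (W.ρ g⁻¹ y) := ev_u A W g y
    rw [← Functor.map_comp_assoc, h₁]
    refine Eq.trans ?_ (ev_u A (V ⊗ W) g (x ⊗ₜ[𝕜] y)).symm
    rw [ev₂_eq, Functor.map_comp, Functor.map_comp]
    simp only [Iso.trans_hom, whiskerLeftIso_hom, Category.assoc]
    rw [reassoc_of% h₂, ← MonoidalCategory.whiskerLeft_comp_assoc, h₅,
      MonoidalCategory.whiskerLeft_comp, Category.assoc]
    rw [← Category.assoc (Equivariant.tau _ _ _).hom]
    have h₆ : ((iotaObj A V).tau g (𝟙_ C)).hom ≫ (iotaObj A V).obj ◁ (A.η0 g).hom =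
        (A.T.act g).map (ρ_ (iotaObj A V).obj).hom ≫ ((iotaObj A V).u g).hom ≫ (ρ_ _).inv := by
      rw [← reassoc_of% h₃]; simp
    rw [h₆]
    simp only [Category.assoc]
    rw [← Functor.map_comp_assoc _ (ρ_ _).inv, Iso.inv_hom_id, CategoryTheory.Functor.map_id, Category.id_comp,
      reassoc_of% h₄]
    refine congrArg (fun t => (A.η0 g).hom ≫ t) ?_
    have h₇ := ev₂_eq (𝕜 := 𝕜) (C := C) (V.ρ g⁻¹ x) (W.ρ g⁻¹ y)
    have h₈ := ev₂_mu (𝕜 := 𝕜) (C := C) (V.ρ g⁻¹ x) (W.ρ g⁻¹ y)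
    rw [h₇] at h₈
    simp only [Category.assoc] at h₈
    exact h₈

open scoped TensorProduct in
instance (A : CrossedAction 𝕜 P C) : (iota₁ A).Monoidal :=
  Functor.CoreMonoidal.toMonoidal
    { εIso := Equivariant.mkIso (epsIso 𝕜 C) (fun g => by
        refine Eq.trans ?_ (ev_u A (𝟙_ (FDRep 𝕜 G)) g (1 : 𝕜)).symm
        rfl)
      μIso := fun V W => Equivariant.mkIso (muIso C V.V W.V) (fun g => iota_mu A V W g)
      μIso_hom_natural_left := fun f W => Equivariant.hom_ext (mu_nat_left f.hom.hom.hom)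
      μIso_hom_natural_right := fun V f => Equivariant.hom_ext (mu_nat_right f.hom.hom.hom)
      associativity := fun U V W => Equivariant.hom_ext <| by
        have h : (α_ U V W).hom.hom.hom.hom =
            (TensorProduct.assoc 𝕜 U.V V.V W.V).toLinearMap := by
          rw [Action.associator_hom_hom]
          rfl
        change muHom C U.V V.V ▷ obj 𝕜 C W.V ≫ muHom C (U.V ⊗[𝕜] V.V) W.V ≫
          map C (α_ U V W).hom.hom.hom.hom = (α_ _ _ _).hom ≫ _ ◁ muHom C V.V W.V ≫
            muHom C U.V (V.V ⊗[𝕜] W.V)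
        rw [h]
        exact mu_assoc
      left_unitality := fun V => Equivariant.hom_ext <| by
        have h : (λ_ V).hom.hom.hom.hom = (TensorProduct.lid 𝕜 V.V).toLinearMap := by
          rw [Action.leftUnitor_hom_hom]
          rfl
        change _ = (epsIso 𝕜 C).hom ▷ obj 𝕜 C V.V ≫ muHom C 𝕜 V.V ≫
          map C (λ_ V).hom.hom.hom.hom
        rw [h]
        exact mu_left_unit
      right_unitality := fun V => Equivariant.hom_ext <| by
        have h : (ρ_ V).hom.hom.hom.hom = (TensorProduct.rid 𝕜 V.V).toLinearMap := by
          rw [Action.rightUnitor_hom_hom]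
          rfl
        change _ = obj 𝕜 C V.V ◁ (epsIso 𝕜 C).hom ≫ muHom C V.V 𝕜 ≫
          map C (ρ_ V).hom.hom.hom.hom
        rw [h]
        exact mu_right_unit }

/-- The constraint `can V ⊗ (M ◁ g ⊗ X) ≅ (can V ⊗ M) ◁ g ⊗ X` of the module functor `can V ⊗ -`. On
the homogeneous component `M_k` of `M`, it is given by
`(η⁻¹ ⊗ id) ((⊕ η0 (k ▶ g))⁻¹ ∘ can (ρ(k ▶ g)) ⊗ id ⊗ id) α⁻¹`. -/
def iotaS (A : CrossedAction 𝕜 P C) (V : FDRep 𝕜 G) (M : C) (W : Homog A) :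
    Can.obj 𝕜 C V.V ⊗ A.mact M W ≅ A.mact (Can.obj 𝕜 C V.V ⊗ M) W where
  hom := (α_ _ _ _).inv ≫
    (∑ k, Can.obj 𝕜 C V.V ◁ (A.T.act W.g).map (A.gr.proj M k) ≫
      (Can.map C (V.ρ (P.l k W.g)) ≫ (sumEta A V.V (P.l k W.g)).inv) ▷ _ ≫
        (A.η W.g (Can.obj 𝕜 C V.V) (A.gr.deg_comp M k)).inv ≫
          (A.T.act W.g).map (Can.obj 𝕜 C V.V ◁ A.gr.incl M k)) ▷ W.obj
  inv := ((iotaObj A V).sIso M W).inv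
  hom_inv_id := ((iotaObj A V).sIso M W).hom_inv_id
  inv_hom_id := ((iotaObj A V).sIso M W).inv_hom_id

theorem iotaS_homog (A : CrossedAction 𝕜 P C) (V : FDRep 𝕜 G) {M : C} {k : Γ}
    (hM : A.gr.deg k M) (W : Homog A) :
    (iotaS A V M W).hom = (α_ _ _ _).inv ≫
      ((Can.map C (V.ρ (P.l k W.g)) ≫ (sumEta A V.V (P.l k W.g)).inv) ▷ _ ≫
        (A.η W.g (Can.obj 𝕜 C V.V) hM).inv) ▷ W.obj := by
  have h : ((iotaObj A V).tau W.g M).inv =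
      ((iotaObj A V).u (P.l k W.g)).inv ▷ _ ≫ (A.η W.g (Can.obj 𝕜 C V.V) hM).inv := by
    rw [← cancel_epi ((iotaObj A V).tau W.g M).hom, Iso.hom_inv_id,
      (iotaObj A V).tau_homog W.g hM, Category.assoc, hom_inv_whiskerRight_assoc,
      Iso.hom_inv_id]
  exact congrArg (fun t => (α_ _ _ _).inv ≫ t ▷ W.obj) h

/-- The functor `ι₂ : Rep G ⥤ B*_C`, `V ↦ can V ⊗ -`. -/
def iota₂ (A : CrossedAction 𝕜 P C) : FDRep 𝕜 G ⥤ DualCat A where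
  obj V := (ModEndo.toMat 𝕜 (Homog A) C).obj
    { F := tensorLeft (Can.obj 𝕜 C V.V)
      rightLinear := rightLinearOfIso _ (fun M W => iotaS A V M W)
        (fun M _ _ f => (iotaObj A V).s_nat_right M f) (fun f W => (iotaObj A V).s_nat_left f W)
        (fun M W W' => (iotaObj A V).s_assoc M W W') (fun M => (iotaObj A V).s_unit M) }
  map {V W} f := (ModEndo.toMat 𝕜 (Homog A) C).map
    ⟨(tensoringLeft C).map (map C f.hom.hom.hom), fun M X =>
      Equivariant.s_map ((iota₁ A).map f) M X⟩
  map_id V := (iota₁ A ⋙ functorS A).map_id V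
  map_comp f f' := (iota₁ A ⋙ functorS A).map_comp f f'

instance (A : CrossedAction 𝕜 P C) : (iota₂ A).Monoidal :=
  inferInstanceAs (iota₁ A ⋙ functorS A).Monoidal

end Iota

section Extension

universe w v₁ v₂ v₃ v₄ v₅ v₆ u₁ u₂ u₃ u₄ u₅ u₆

/-- An object is trivial if it is isomorphic to a finite direct sum of copies of the unit object. -/
def IsTrivial {C : Type u} [Category.{v} C] [Preadditive C] [HasFiniteBiproducts C]
    [MonoidalCategory C] (X : C) : Prop :=
  ∃ n : ℕ, Nonempty (X ≅ ⨁ fun _ : Fin n => 𝟙_ C)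

/-- The sequence of tensor functors `B --ι--> D --F--> C` is an extension (an exact sequence) with
respect to the `B`-module category of finite-dimensional vector spaces given by the fibre functor
`ω`. Here the category `C ⊠ End(vec)ᵒᵖ` is identified with `C`, so that its subcategory
`End(vec)ᵒᵖ` is the subcategory of trivial objects of `C`. -/
structure IsExtension (𝕜 : Type w) [Field 𝕜]
    {B : Type u₁} [Category.{v₁} B] [Preadditive B] [Linear 𝕜 B] [MonoidalCategory B]
    {D : Type u₂} [Category.{v₂} D] [Preadditive D] [Linear 𝕜 D] [MonoidalCategory D]
    {C : Type u₃} [Category.{v₃} C] [Preadditive C] [HasFiniteBiproducts C] [Linear 𝕜 C]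
    [MonoidalCategory C] [MonoidalPreadditive C] [MonoidalLinear 𝕜 C]
    (ω : B ⥤ FGModuleCat.{w} 𝕜) [ω.Monoidal] (ι : B ⥤ D) [ι.Monoidal] (F : D ⥤ C) [F.Monoidal] :
    Prop where
  additive_ι : ι.Additive
  linear_ι : ι.Linear 𝕜
  additive_F : F.Additive
  linear_F : F.Linear 𝕜
  /-- The functor `ι` is injective: it identifies `B` with a full subcategory of `D`. -/
  full : ι.Full
  faithful : ι.Faithful
  /-- The functor `F` is surjective: each object of `C` is a subquotient of an object `F X`. -/
  surjective : ∀ Y : C, ∃ (X : D) (Z : C) (i : Z ⟶ F.obj X) (p : Z ⟶ Y), Mono i ∧ Epi p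
  /-- The kernel of `F` is the image of `ι`. -/
  kernel : ∀ X : D, IsTrivial (F.obj X) ↔ ι.essImage X
  /-- The restriction of `F` to the image of `ι` is the given fibre functor. -/
  fibre : ∃ e : ι ⋙ F ≅ ω ⋙ can 𝕜 C, NatTrans.IsMonoidal e.hom
  /-- The functor `F` is normal: the largest trivial subobject of `F X` is `F X₀`, for a subobject
  `X₀` of `X`. -/
  normal : ∀ X : D, ∃ (X₀ : D) (i : X₀ ⟶ X), Mono i ∧ Mono (F.map i) ∧ IsTrivial (F.obj X₀) ∧
    ∀ (Y : C) (j : Y ⟶ F.obj X), Mono j → IsTrivial Y → ∃ h : Y ⟶ F.obj X₀, h ≫ F.map i = j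

/-- A tensor equivalence: a `𝕜`-linear monoidal functor which is an equivalence of categories. -/
structure IsTensorEquivalence (𝕜 : Type w) [Field 𝕜]
    {D : Type u₁} [Category.{v₁} D] [Preadditive D] [Linear 𝕜 D] [MonoidalCategory D]
    {D' : Type u₂} [Category.{v₂} D'] [Preadditive D'] [Linear 𝕜 D'] [MonoidalCategory D']
    (T : D ⥤ D') [T.Monoidal] : Prop where
  additive : T.Additive
  linear : T.Linear 𝕜
  isEquivalence : T.IsEquivalence

/-- The tensor functors `T'`, `T`, `T''` form an equivalence between the extensions
`B --ι--> D --F--> C` and `B₁ --ι₁--> D₁ --F₁--> C₁` with respect to the module categories of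
finite-dimensional vector spaces given by the fibre functors `ω` and `ω₁`. -/
structure IsExtensionEquivalence (𝕜 : Type w) [Field 𝕜]
    {B : Type u₁} [Category.{v₁} B] [Preadditive B] [Linear 𝕜 B] [MonoidalCategory B]
    {D : Type u₂} [Category.{v₂} D] [Preadditive D] [Linear 𝕜 D] [MonoidalCategory D]
    {C : Type u₃} [Category.{v₃} C] [Preadditive C] [Linear 𝕜 C] [MonoidalCategory C]
    {B₁ : Type u₄} [Category.{v₄} B₁] [Preadditive B₁] [Linear 𝕜 B₁] [MonoidalCategory B₁]
    {D₁ : Type u₅} [Category.{v₅} D₁] [Preadditive D₁] [Linear 𝕜 D₁] [MonoidalCategory D₁]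
    {C₁ : Type u₆} [Category.{v₆} C₁] [Preadditive C₁] [Linear 𝕜 C₁] [MonoidalCategory C₁]
    (ω : B ⥤ FGModuleCat.{w} 𝕜) [ω.Monoidal] (ι : B ⥤ D) [ι.Monoidal] (F : D ⥤ C) [F.Monoidal]
    (ω₁ : B₁ ⥤ FGModuleCat.{w} 𝕜) [ω₁.Monoidal] (ι₁ : B₁ ⥤ D₁) [ι₁.Monoidal]
    (F₁ : D₁ ⥤ C₁) [F₁.Monoidal]
    (T' : B ⥤ B₁) [T'.Monoidal] (T : D ⥤ D₁) [T.Monoidal] (T'' : C ⥤ C₁) [T''.Monoidal] :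
    Prop where
  tensorEquivalence_left : IsTensorEquivalence 𝕜 T'
  tensorEquivalence_middle : IsTensorEquivalence 𝕜 T
  tensorEquivalence_right : IsTensorEquivalence 𝕜 T''
  left_square : ∃ e : ι ⋙ T ≅ T' ⋙ ι₁, NatTrans.IsMonoidal e.hom
  right_square : ∃ e : T ⋙ F₁ ≅ F ⋙ T'', NatTrans.IsMonoidal e.hom
  fibre : ∃ e : ω ≅ T' ⋙ ω₁, NatTrans.IsMonoidal e.hom

end Extension

/-- The fibre functor of `Rep G`. -/
abbrev fibreFunctor (𝕜 : Type*) [Field 𝕜] (G : Type*) [Group G] :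
    FDRep 𝕜 G ⥤ FGModuleCat 𝕜 := Action.forget _ _

end FusionDual

end

open FusionDual

universe w v u u₁ u₂

/-!
The second extension is obtained from the first one, once `S` is known to be an equivalence.

*The extension `Rep G ⟶ C^(G,Γ) ⟶ C`.* By Schur's lemma, `End 1 = 𝕜`, so that a vector space `V` is
recovered from the trivial object `⊕ 1` as `Hom (1, ⊕ 1)` (`Can.evEquiv`); hence `ι₁` is fully
faithful. For an equivariant object `X`, the group `G` acts on the space `Hom (1, X)`, and the
evaluation `ι₁ (Hom (1, X)) ⟶ X` is equivariant (`Equivariant.trivialPart`). It is a monomorphism by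
semisimplicity (`Can.mono_lift`), and each morphism from a trivial object to `X` factors through it
(`Can.exists_factor`), so that its image is the largest trivial subobject of `X`. This is normality,
and it shows that `X` lies in the image of `ι₁` if its underlying object is trivial. Each object `Y`
of `C` is a subobject of the induced equivariant object `⊕ Y ◁ a`.

*The functor `S` is an equivalence.* A module functor `F` over `B` is determined by its value at `1`:
the restriction of `F` to `C ⊆ B` gives `F 1 ⊗ M ≅ F M`, and the constraints at the objects `g ⋈ 1`
give `F (M ◁ g) ≅ F M ◁ g`, which make `F 1` an equivariant object (`ModEndo.toEquivariant`). That
`F 1 ⊗ - ≅ F` is an isomorphism of module functors over all of `B` needs to be checked only at the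
objects `1 ⋈ X`, and at `1` and `g ⋈ 1`, because the pairs for which the compatibility with the
constraints holds are stable under the tensor product of `B` and may be cancelled (`CommutesAt.tensor`,
`CommutesAt.of_tensor`), and because `(1 ⋈ M) ⊗ (g ⋈ X) ≅ (k ▶ g ⋈ 1) ⊗ (1 ⋈ M ◁ g ⊗ X)` for `M` of
degree `k`.

*The second extension.* The isomorphisms `r` form a monoidal isomorphism `S ⋙ F₂ ≅ F₁`
(`functorSForgetIso`), and `ι₂ = ι₁ ⋙ S`, so that the second sequence is the transport of the first
one along `S` (`IsExtension.transport`).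
-/

noncomputable section

namespace FusionDual

/-! ### The functor `S` is fully faithful -/

section FunctorSFullyFaithful

open scoped MonoidalRightAction
open CrossedAction

variable {𝕜 : Type*} [Field 𝕜] {G Γ : Type*} [Group G] [Group Γ] [Fintype Γ]
  {P : MatchedPair G Γ} {C : Type u} [Category.{v} C] [Preadditive C] [HasFiniteBiproducts C]
  [Linear 𝕜 C] [MonoidalCategory C] [MonoidalPreadditive C] [MonoidalLinear 𝕜 C]
  {A : CrossedAction 𝕜 P C}

instance : (functorS A).Additive where
  map_add {X Y f g} := ModEndo.hom_ext fun M =>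
    MonoidalPreadditive.add_whiskerRight f.val g.val

instance : (functorS A).Linear 𝕜 where
  map_smul {X Y} f a := ModEndo.hom_ext fun M => MonoidalLinear.smul_whiskerRight a f.val M

instance : (dualToBase A).Additive where
  map_add := rfl

instance : (dualToBase A).Linear 𝕜 where
  map_smul _ _ := rfl

instance : (Equivariant.forget A).Additive where
  map_add := rfl

instance : (Equivariant.forget A).Linear 𝕜 where
  map_smul _ _ := rfl

instance : (Equivariant.forget A).Faithful where
  map_injective h := Equivariant.hom_ext h

namespace ModEndo

/-- Extension of a module functor from `E` to `Mat_ E` does not change its constraint on `E`. -/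
theorem ofMat_toMat_s {E : Type*} [Category E] [Preadditive E] [MonoidalCategory E]
    [MonoidalPreadditive E] {D : Type u} [Category.{v} D] [Preadditive D] [HasFiniteBiproducts D]
    [Linear 𝕜 D] [MonoidalRightAction E D] [AdditiveAction E D] (F : ModEndo 𝕜 E D) (d : D)
    (c : E) : ((ofMat 𝕜 E D).obj ((toMat 𝕜 E D).obj F)).s d c = F.s d c := by
  change F.F.map (sglIso d c).hom ≫ MatAction.linDelta F.F d (sgl c) ≫
    (sglIso (F.F.obj d) c).inv = _
  have h := MatAction.inc_linDelta F.F d (sgl c) PUnit.unit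
  change F.F.map (sglIso d c).hom ≫ _ = F.s d c ≫ (sglIso (F.F.obj d) c).hom at h
  rw [reassoc_of% h, Iso.hom_inv_id, Category.comp_id]

theorem ofMat_functorS_s (X : Equivariant A) (M : C) (W : Homog A) :
    ((ofMat 𝕜 (Homog A) C).obj ((functorS A).obj X)).s M W = (X.sIso M W).hom :=
  ofMat_toMat_s ((Equivariant.functorSHomog A).obj X) M W

/-- On the homogeneous objects `1 ⋈ Y` of `C ⊆ B`, the constraint of `S X` is the inverse of the
associativity constraint. -/
theorem resHomog_of_sIso (X : Equivariant A) (N : C) {Y : C} {k : Γ} (hY : A.gr.deg k Y) :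
    X.obj ◁ (A.oneAct N Y).hom ≫ (X.sIso N (Homog.one hY)).hom ≫ (A.oneAct (X.obj ⊗ N) Y).inv =
      (α_ X.obj N Y).inv := by
  have h : X.obj ◁ (A.T.oneIso N).hom ≫ (X.tau 1 N).inv = (A.T.oneIso (X.obj ⊗ N)).hom := by
    rw [← X.tau_one N, Category.assoc, Iso.hom_inv_id, Category.comp_id]
  change X.obj ◁ (A.T.oneIso N).hom ▷ Y ≫
    ((α_ _ _ _).inv ≫ (X.tau 1 N).inv ▷ Y) ≫ (A.T.oneIso (X.obj ⊗ N)).inv ▷ Y = _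
  rw [Category.assoc, associator_inv_naturality_middle_assoc, ← comp_whiskerRight_assoc, h,
    hom_inv_whiskerRight, Category.comp_id]

/-- The constraint of `S X`, restricted to all of `C`, is the inverse of the associativity constraint:
this follows from the homogeneous case by decomposition into components. -/
theorem resIso_functorS (X : Equivariant A) (N M : C) :
    (resIso ((ofMat 𝕜 (Homog A) C).obj ((functorS A).obj X)) N M).hom = (α_ X.obj N M).inv := by
  refine Equivariant.ext_homog (A := A) (F := tensorLeft N ⋙ tensorLeft X.obj)
    (F' := tensorLeft (X.obj ⊗ N))
    (fun M => (resIso ((ofMat 𝕜 (Homog A) C).obj ((functorS A).obj X)) N M).hom)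
    (fun M => (α_ X.obj N M).inv)
    (fun {Y Y'} q => ?_) (fun {Y Y'} q => ?_) (fun {M k} hM => ?_) M
  · exact res_nat_right ((ofMat 𝕜 (Homog A) C).obj ((functorS A).obj X)) N q
  · exact associator_inv_naturality_right X.obj N q
  · rw [res_homog _ _ hM, resHomog_hom, ofMat_functorS_s]
    exact resHomog_of_sIso X N hM

/-- For the restriction of `S X` to the regular `C`-module category, the comparison
`(X ⊗ 1) ⊗ M ≅ X ⊗ M` of a module functor with its value at `1` is `r ⊗ M`. -/
theorem evalIso_functorS (X : Equivariant A) (M : C) :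
    (evalIso ((restrict A).obj ((ofMat 𝕜 (Homog A) C).obj ((functorS A).obj X))) M).hom =
      (ρ_ X.obj).hom ▷ M := by
  have h : (evalIso ((restrict A).obj ((ofMat 𝕜 (Homog A) C).obj ((functorS A).obj X))) M).inv =
      X.obj ◁ (λ_ M).inv ≫ (α_ X.obj (𝟙_ C) M).inv :=
    congrArg (fun t => X.obj ◁ (λ_ M).inv ≫ t) (resIso_functorS X (𝟙_ C) M)
  have h' : X.obj ◁ (λ_ M).inv ≫ (α_ X.obj (𝟙_ C) M).inv =
    (whiskerRightIso (ρ_ X.obj) M).inv := by simp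
  exact congrArg Iso.hom (Iso.ext_inv (β := whiskerRightIso (ρ_ X.obj) M) (h.trans h'))

end ModEndo

/-- A morphism `S X ⟶ S X'` is determined by its component at the unit object. -/
theorem functorS_val_app {X X' : Equivariant A} (t : (functorS A).obj X ⟶ (functorS A).obj X')
    (q : X.obj ⊗ 𝟙_ C ⟶ X'.obj ⊗ 𝟙_ C) (hq : t.val.app (𝟙_ C) = q) (M : C) :
    ((ρ_ X.obj).inv ≫ q ≫ (ρ_ X'.obj).hom) ▷ M = t.val.app M := by
  have h := ModEndo.evalIso_nat_left
    ((ModEndo.restrict A).map ((ModEndo.ofMat 𝕜 (Homog A) C).map t)) M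
  rw [ModEndo.evalIso_functorS, ModEndo.evalIso_functorS] at h
  have h' : q ▷ M ≫ (ρ_ X'.obj).hom ▷ M = (ρ_ X.obj).hom ▷ M ≫ t.val.app M := hq ▸ h
  rw [comp_whiskerRight, comp_whiskerRight, h']
  exact inv_hom_whiskerRight_assoc _ _ _

/-- A morphism `f` is recovered from `f ⊗ 1`. -/
instance : (functorS A).Faithful where
  map_injective {X X' f f'} h := Equivariant.hom_ext <| by
    have h' : f.val ▷ 𝟙_ C = f'.val ▷ 𝟙_ C := congrArg (fun t => t.val.app (𝟙_ C)) h
    rwa [whiskerRight_id, whiskerRight_id, Iso.cancel_iso_hom_left, Iso.cancel_iso_inv_right] at h'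

/-- At the unit object, `τ` is given by the equivariant structure alone, since `1` is homogeneous of
degree `1` and `1 ▶ g = g`. -/
theorem tau_unit_inv (X : Equivariant A) (g : G) :
    (X.tau g (𝟙_ C)).inv = X.obj ◁ (A.η0 g).hom ≫ (ρ_ X.obj).hom ≫ (X.u g).inv ≫
      (A.T.act g).map (ρ_ X.obj).inv := by
  rw [← cancel_epi (X.tau g (𝟙_ C)).hom, Iso.hom_inv_id, reassoc_of% (X.tau_unit_right g),
    Iso.hom_inv_id_assoc, ← Functor.map_comp, Iso.hom_inv_id, CategoryTheory.Functor.map_id]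

/-- A morphism that is compatible with `τ` at the unit object is equivariant. -/
theorem equivariant_of_tau {X X' : Equivariant A} (f : X.obj ⟶ X'.obj) (g : G)
    (h : f ▷ (A.T.act g).obj (𝟙_ C) ≫ (X'.tau g (𝟙_ C)).inv =
      (X.tau g (𝟙_ C)).inv ≫ (A.T.act g).map (f ▷ 𝟙_ C)) :
    (X.u g).hom ≫ f = (A.T.act g).map f ≫ (X'.u g).hom := by
  rw [tau_unit_inv, tau_unit_inv] at h
  simp only [Category.assoc] at h
  rw [← whisker_exchange_assoc, cancel_epi, rightUnitor_naturality_assoc,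
    Iso.cancel_iso_hom_left, ← Functor.map_comp, ← rightUnitor_inv_naturality, Functor.map_comp,
    ← Category.assoc, ← Category.assoc, cancel_mono, Iso.comp_inv_eq, Category.assoc,
    Iso.eq_inv_comp] at h
  exact h

/-- A morphism `S X ⟶ S X'` is of the form `f ⊗ -`, and its compatibility with the constraints at
`1` and `g ⋈ 1` says that `f` is equivariant. -/
instance : (functorS A).Full where
  map_surjective {X X'} t := by
    obtain ⟨q, hq⟩ : ∃ q : X.obj ⊗ 𝟙_ C ⟶ X'.obj ⊗ 𝟙_ C, t.val.app (𝟙_ C) = q := ⟨_, rfl⟩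
    have ht := functorS_val_app t q hq
    set f := (ρ_ X.obj).inv ≫ q ≫ (ρ_ X'.obj).hom with hf
    refine ⟨⟨f, fun g => equivariant_of_tau f g ?_⟩, ModEndo.hom_ext ht⟩
    have h := ((ModEndo.ofMat 𝕜 (Homog A) C).map t).comm (𝟙_ C)
      ⟨g, A.gr.deg_unit⟩
    have h₁ := ModEndo.ofMat_functorS_s X (𝟙_ C) ⟨g, A.gr.deg_unit⟩
    have h₂ := ModEndo.ofMat_functorS_s X' (𝟙_ C) ⟨g, A.gr.deg_unit⟩
    have h₃ : f ▷ ((A.T.act g).obj (𝟙_ C) ⊗ 𝟙_ C) ≫ (α_ _ _ _).inv ≫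
        (X'.tau g (𝟙_ C)).inv ▷ 𝟙_ C =
      ((α_ _ _ _).inv ≫ (X.tau g (𝟙_ C)).inv ▷ 𝟙_ C) ≫ (A.T.act g).map (f ▷ 𝟙_ C) ▷ 𝟙_ C := by
      have e₁ : (A.T.act g).map (f ▷ 𝟙_ C) ▷ 𝟙_ C = A.mactL (t.val.app (𝟙_ C)) ⟨g, A.gr.deg_unit⟩ :=
        congrArg (fun t => (A.T.act g).map t ▷ 𝟙_ C) (ht (𝟙_ C))
      refine (congrArg₂ (fun a b => a ≫ b) (ht _) h₂.symm).trans (h.trans ?_)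
      exact (congrArg₂ (fun a b => a ≫ b) h₁ e₁.symm)
    rw [associator_inv_naturality_left_assoc, Category.assoc, Iso.cancel_iso_inv_left,
      ← comp_whiskerRight, ← comp_whiskerRight, whiskerRight_id, whiskerRight_id,
      Iso.cancel_iso_hom_left, Iso.cancel_iso_inv_right] at h₃
    exact h₃

/-- The monoidal isomorphism `r : S ⋙ F₂ ≅ F₁`. -/
def functorSForgetIso (A : CrossedAction 𝕜 P C) :
    functorS A ⋙ dualToBase A ≅ Equivariant.forget A :=
  NatIso.ofComponents (fun X => ρ_ X.obj) (fun f => rightUnitor_naturality f.val)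

section Monoidality

open Functor.LaxMonoidal

theorem ε_dualToBase : ε (dualToBase A) = 𝟙 (𝟙_ C) :=
  (Category.comp_id _).trans (Category.comp_id _)

theorem ε_functorS_app : (ε (functorS A)).val.app (𝟙_ C) = (λ_ (𝟙_ C)).inv := Category.id_comp _

theorem μ_functorS_app (X Y : Equivariant A) (M : C) :
    (μ (functorS A) X Y).val.app M = (α_ X.obj Y.obj M).inv := Category.id_comp _

theorem μ_dualToBase (F F' : DualCat A) : μ (dualToBase A) F F' =
    (ModEndo.evalIso ((ModEndo.restrict A).obj ((ModEndo.ofMat 𝕜 (Homog A) C).obj F))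
      (F'.F.obj (𝟙_ C))).hom :=
  (Category.comp_id _).trans (Category.comp_id _)

instance : NatTrans.IsMonoidal (functorSForgetIso A).hom where
  unit := by
    have h : ε (functorS A ⋙ dualToBase A) = (λ_ (𝟙_ C)).inv :=
      (congrArg₂ (fun a b => a ≫ b) ε_dualToBase ε_functorS_app).trans (Category.id_comp _)
    refine (congrArg (fun t => t ≫ (ρ_ (𝟙_ C)).hom) h).trans ?_
    change (λ_ (𝟙_ C)).inv ≫ (ρ_ (𝟙_ C)).hom = 𝟙 _
    rw [← unitors_equal, Iso.inv_hom_id]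
  tensor X Y := by
    have h₁ : ((ρ_ X.obj).hom ▷ (Y.obj ⊗ 𝟙_ C) ≫ (α_ _ _ _).inv) ≫ (ρ_ (X.obj ⊗ Y.obj)).hom =
      ((ρ_ X.obj).hom ⊗ₘ (ρ_ Y.obj).hom) ≫ 𝟙 _ := by
      rw [MonoidalCategory.tensorHom_def]; simp
    have h₂ : μ (functorS A ⋙ dualToBase A) X Y = (ρ_ X.obj).hom ▷ (Y.obj ⊗ 𝟙_ C) ≫
        (α_ X.obj Y.obj (𝟙_ C)).inv :=
      congrArg₂ (fun a b => a ≫ b) ((μ_dualToBase _ _).trans (ModEndo.evalIso_functorS X _))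
        (μ_functorS_app X Y (𝟙_ C))
    exact (congrArg (fun t => t ≫ (ρ_ (X.obj ⊗ Y.obj)).hom) h₂).trans h₁

end Monoidality

end FunctorSFullyFaithful

/-! ### Module functors and the compatibility with their constraints -/

section CommutesAt

open scoped MonoidalRightAction
open Functor.LaxRightLinear Functor.OplaxRightLinear

variable {E : Type*} [Category E] [MonoidalCategory E] {D : Type*} [Category D]
  [MonoidalRightAction E D] {F F' : D ⥤ D} [F.RightLinear E] [F'.RightLinear E]

/-- A natural transformation of module functors is compatible with the constraints at the pair of
objects `d`, `c`. -/
def CommutesAt (e : F ⟶ F') (d : D) (c : E) : Prop :=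
  e.app (d ⊙ᵣ c) ≫ δᵣ F' d c = δᵣ F d c ≫ e.app d ⊵ᵣ c

namespace CommutesAt

variable {e : F ⟶ F'} {d d' : D} {c c' : E}

/-- Compatibility at `d` gives compatibility at `d'` on the image of `F (d ⊙ c)`. -/
theorem precomp (h : CommutesAt e d c) (i : d ⟶ d') :
    F.map (i ⊵ᵣ c) ≫ e.app (d' ⊙ᵣ c) ≫ δᵣ F' d' c =
      F.map (i ⊵ᵣ c) ≫ δᵣ F d' c ≫ e.app d' ⊵ᵣ c := by
  rw [e.naturality_assoc, δᵣ_naturality_left, reassoc_of% h, δᵣ_naturality_left_assoc,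
    ← MonoidalRightAction.comp_actionHomLeft, ← MonoidalRightAction.comp_actionHomLeft,
    e.naturality]

theorem congr_left (h : CommutesAt e d c) (i : d ≅ d') : CommutesAt e d' c := by
  have h₁ := h.precomp i.hom
  unfold CommutesAt
  have h₂ := congrArg (fun t => F.map (i.inv ⊵ᵣ c) ≫ t) h₁
  simpa only [← F.map_comp_assoc, ← MonoidalRightAction.comp_actionHomLeft, Iso.inv_hom_id,
    MonoidalRightAction.id_actionHomLeft, F.map_id, Category.id_comp] using h₂

theorem congr_right (h : CommutesAt e d c) (i : c ≅ c') : CommutesAt e d c' := by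
  have h₁ : F.map (d ⊴ᵣ i.hom) ≫ e.app (d ⊙ᵣ c') ≫ δᵣ F' d c' =
      F.map (d ⊴ᵣ i.hom) ≫ δᵣ F d c' ≫ e.app d ⊵ᵣ c' := by
    rw [e.naturality_assoc, δᵣ_naturality_right, reassoc_of% h, δᵣ_naturality_right_assoc,
      ← MonoidalRightAction.action_exchange]
  unfold CommutesAt
  have h₂ := congrArg (fun t => F.map (d ⊴ᵣ i.inv) ≫ t) h₁
  simpa only [← F.map_comp_assoc, ← MonoidalRightAction.actionHomRight_comp, Iso.inv_hom_id,
    MonoidalRightAction.actionHomRight_id, F.map_id, Category.id_comp] using h₂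

theorem tensor (h : CommutesAt e d c) (h' : CommutesAt e (d ⊙ᵣ c) c') :
    CommutesAt e d (c ⊗ c') := by
  have h₁ : F.map (αᵣ d c c').inv ≫ e.app (d ⊙ᵣ (c ⊗ c')) ≫ δᵣ F' d (c ⊗ c') =
      F.map (αᵣ d c c').inv ≫ δᵣ F d (c ⊗ c') ≫ e.app d ⊵ᵣ (c ⊗ c') := by
    rw [e.naturality_assoc, ← δᵣ_associativity_inv, reassoc_of% h',
      ← δᵣ_associativity_inv_assoc, ← MonoidalRightAction.comp_actionHomLeft_assoc, h]
    simp
  unfold CommutesAt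
  have h₂ := congrArg (fun t => F.map (αᵣ d c c').hom ≫ t) h₁
  simpa only [← F.map_comp_assoc, Iso.hom_inv_id, F.map_id, Category.id_comp] using h₂

/-- A converse of `CommutesAt.tensor`: the compatibility at `d`, `c ⊗ c'` and at `d`, `c` implies that
at `d ⊙ c`, `c'`. -/
theorem of_tensor (h : CommutesAt e d c) (h' : CommutesAt e d (c ⊗ c')) :
    CommutesAt e (d ⊙ᵣ c) c' := by
  have h₁ : F.map (αᵣ d c c').inv ≫ e.app (d ⊙ᵣ (c ⊗ c')) ≫ δᵣ F' d (c ⊗ c') =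
      F.map (αᵣ d c c').inv ≫ δᵣ F d (c ⊗ c') ≫ e.app d ⊵ᵣ (c ⊗ c') := by rw [h']
  have h₂ : δᵣ F (d ⊙ᵣ c) c' ≫ (δᵣ F d c ≫ e.app d ⊵ᵣ c) ⊵ᵣ c' ≫ (αᵣ (F'.obj d) c c').inv =
      (δᵣ F (d ⊙ᵣ c) c' ≫ e.app (d ⊙ᵣ c) ⊵ᵣ c') ≫ δᵣ F' d c ⊵ᵣ c' ≫
        (αᵣ (F'.obj d) c c').inv := by
    rw [← h]; simp
  rw [e.naturality_assoc, ← δᵣ_associativity_inv, ← δᵣ_associativity_inv_assoc] at h₁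
  have h₃ : (e.app ((d ⊙ᵣ c) ⊙ᵣ c') ≫ δᵣ F' (d ⊙ᵣ c) c') ≫ δᵣ F' d c ⊵ᵣ c' ≫
        (αᵣ (F'.obj d) c c').inv = (δᵣ F (d ⊙ᵣ c) c' ≫ e.app (d ⊙ᵣ c) ⊵ᵣ c') ≫
          δᵣ F' d c ⊵ᵣ c' ≫ (αᵣ (F'.obj d) c c').inv := by
    rw [← h₂, Category.assoc, h₁]; simp
  unfold CommutesAt
  have h₄ := congrArg (fun t => t ≫ (αᵣ (F'.obj d) c c').hom ≫ μᵣ F' d c ⊵ᵣ c') h₃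
  simpa only [Category.assoc, Iso.inv_hom_id_assoc, ← MonoidalRightAction.comp_actionHomLeft,
    Functor.RightLinear.δᵣ_comp_μᵣ, MonoidalRightAction.id_actionHomLeft, Category.comp_id] using h₄

end CommutesAt

end CommutesAt

namespace ModEndo

section OfMatToMat

open scoped MonoidalRightAction

variable {𝕜 : Type*} [Field 𝕜] {E : Type*} [Category E] [Preadditive E] [MonoidalCategory E]
  [MonoidalPreadditive E] {D : Type u} [Category.{v} D] [Preadditive D] [HasFiniteBiproducts D]
  [Linear 𝕜 D] [MonoidalRightAction E D] [AdditiveAction E D]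

/-- The constraint of a module functor over `Mat_ E` is the additive extension of its restriction to
`E`. -/
theorem linDelta_ofMat (F : ModEndo 𝕜 (Mat_ E) D) (d : D) (X : Mat_ E) :
    MatAction.linDelta ((ofMat 𝕜 E D).obj F).F d X = F.s d X :=
  letI := ofMatLinear F
  MatAction.ext_map_inc F.F fun i => by
    let q : sgl (X.X i) ⟶ X := MatAux.mono (fun _ => i) (fun _ => 𝟙 (X.X i))
    have e : ∀ d : D, (sglIso d (X.X i)).hom ≫ MatAction.mapR d q = MatAction.inc d X i := by
      intro d
      refine (MatAction.inc_mapR_mono d (X := sgl (X.X i)) (Y := X) (fun _ => i)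
        (fun _ => 𝟙 (X.X i)) PUnit.unit).trans ?_
      rw [MonoidalRightAction.actionHomRight_id, Category.id_comp]
    refine (MatAction.inc_linDelta ((ofMat 𝕜 E D).obj F).F d X i).trans ?_
    change (F.F.map (sglIso d (X.X i)).hom ≫ F.s d (sgl (X.X i)) ≫
      (sglIso (F.F.obj d) (X.X i)).inv) ≫ MatAction.inc (F.F.obj d) X i =
        F.F.map (MatAction.inc d X i) ≫ F.s d X
    rw [← e, ← e, F.F.map_comp, Category.assoc, Category.assoc, Category.assoc, s_mapR,
      Iso.inv_hom_id_assoc]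

/-- A module functor for the action of `Mat_ E` is the extension of its restriction to `E`. -/
def toMatOfMat (F : ModEndo 𝕜 (Mat_ E) D) : (toMat 𝕜 E D).obj ((ofMat 𝕜 E D).obj F) ≅ F :=
  mkIso (Iso.refl _) fun d X => by
    change 𝟙 _ ≫ F.s d X = MatAction.linDelta ((ofMat 𝕜 E D).obj F).F d X ≫
      MatAction.mapL (𝟙 _) X
    rw [MatAction.mapL_id, linDelta_ofMat, Category.id_comp]
    exact (Category.comp_id _).symm

end OfMatToMat

section Reg

variable {𝕜 : Type*} [Field 𝕜] {C : Type u} [Category.{v} C] [Preadditive C]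
  [Linear 𝕜 C] [MonoidalCategory C]

/-- The comparison `F 1 ⊗ M ≅ F M` is compatible with the constraint of `F`. -/
theorem evalIso_tensor (F : ModEndo 𝕜 C C) (M Y : C) :
    (evalIso F (M ⊗ Y)).hom ≫ F.s M Y = (α_ _ _ _).inv ≫ (evalIso F M).hom ▷ Y := by
  have h : F.s M Y ≫ (evalIso F M).inv ▷ Y ≫ (α_ _ _ _).hom = (evalIso F (M ⊗ Y)).inv := by
    rw [evalIso_inv, evalIso_inv, comp_whiskerRight, Category.assoc,
      ← reassoc_of% (reg_nat_left F (λ_ M).inv Y), reg_assoc, ← F.F.map_comp_assoc]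
    simp
  rw [← cancel_mono ((evalIso F M).inv ▷ Y ≫ (α_ _ _ _).hom), Category.assoc, h,
    Iso.hom_inv_id]
  simp

theorem evalIso_unit (F : ModEndo 𝕜 C C) : (evalIso F (𝟙_ C)).hom = (ρ_ _).hom := by
  rw [← cancel_epi (evalIso F (𝟙_ C)).inv, Iso.inv_hom_id, evalIso_inv, Category.assoc, reg_unit,
    ← F.F.map_comp, ← unitors_equal, Iso.inv_hom_id, F.F.map_id]

end Reg

end ModEndo

/-! ### The functor `S` is essentially surjective -/

section EssSurj

open scoped MonoidalRightAction
open CrossedAction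

variable {𝕜 : Type*} [Field 𝕜] {G Γ : Type*} [Group G] [Group Γ] [Fintype Γ]
  {P : MatchedPair G Γ} {C : Type u} [Category.{v} C] [Preadditive C] [HasFiniteBiproducts C]
  [Linear 𝕜 C] [MonoidalCategory C] [MonoidalPreadditive C]
  {A : CrossedAction 𝕜 P C}

namespace CrossedAction

/-- The object `g ⋈ 1`. -/
abbrev Homog.grp (A : CrossedAction 𝕜 P C) (g : G) : Homog A := ⟨g, A.gr.deg_unit⟩

/-- The canonical morphism `(g ⋈ 1) ⊗ (h ⋈ 1) ⟶ gh ⋈ 1`. -/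
def grpMul (A : CrossedAction 𝕜 P C) (g h : G) :
    (Homog.grp A g).tensor (Homog.grp A h) ⟶ Homog.grp A (g * h) :=
  ⟨(A.η0 h).hom ▷ 𝟙_ C ≫ (λ_ _).hom, fun e => (e (by simp [P.one_l])).elim⟩

/-- The associativity constraint of the action at `g ⋈ 1` and `h ⋈ 1` amounts to the constraint
`R²` of the action of `G`. -/
theorem mactAssoc_grp (A : CrossedAction 𝕜 P C) (g h : G) (N : C) :
    (A.mactAssoc N (Homog.grp A g) (Homog.grp A h)).inv ≫ A.mactR N (grpMul A g h) =
      ((A.T.act h).map (ρ_ ((A.T.act g).obj N)).hom ≫ (A.T.R2 g h).hom.app N) ▷ 𝟙_ C := by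
  have h₁ := A.η_unit_right h ((A.T.act g).obj N)
  have h₂ : A.T.tr ((A.T.act g).obj N) (P.l 1 h) h ≫ (A.T.R2 g h).hom.app N =
      (A.T.mulIso N g (P.l 1 h) _ rfl).hom ≫ A.T.tr N _ (g * h) := by
    rw [A.T.mulIso_tr _ _ _ _ _ _ (by rw [P.one_l]), ← A.T.tr_mulIso N g (P.l 1 h) h (g * h)
      (by rw [P.one_l]) rfl]
    simp [RightAction.mulIso]
  rw [mactAssoc_inv, ← h₁]
  simp only [mactR, grpMul, Category.assoc, h₂]
  have h₃ : ∀ (Z Z' : C) (a : Z ⟶ Z'), (Z ◁ (A.η0 h).hom ≫ (ρ_ _).hom ≫ a) ▷ 𝟙_ C =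
      (a ▷ _) ▷ 𝟙_ C ≫ (α_ _ _ _).hom ≫ Z' ◁ (A.η0 h).hom ▷ 𝟙_ C ≫ Z' ◁ (λ_ _).hom := by
    intro Z Z' a
    rw [← associator_naturality_middle_assoc, triangle, ← comp_whiskerRight, ← comp_whiskerRight,
      ← whisker_exchange_assoc, rightUnitor_naturality]
  rw [comp_whiskerRight, h₃]
  simp

end CrossedAction

namespace ModEndo

variable (F : ModEndo 𝕜 (Homog A) C)

/-- The isomorphism `F (M ◁ g) ≅ F M ◁ g`: a `B`-module functor is `G`-equivariant. -/
def equivIso (M : C) (g : G) : F.F.obj ((A.T.act g).obj M) ≅ (A.T.act g).obj (F.F.obj M) :=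
  F.F.mapIso (ρ_ _).symm ≪≫ (Functor.RightLinear.μᵣIso F.F M (Homog.grp A g)).symm ≪≫ ρ_ _

theorem equivIso_hom (M : C) (g : G) : (equivIso F M g).hom =
    F.F.map (ρ_ _).inv ≫ F.s M (Homog.grp A g) ≫ (ρ_ _).hom := rfl

theorem s_grp (M : C) (g : G) : F.s M (Homog.grp A g) =
    F.F.map (ρ_ _).hom ≫ (equivIso F M g).hom ≫ (ρ_ _).inv := by
  rw [equivIso_hom]
  simp only [Category.assoc]
  rw [← F.F.map_comp_assoc]
  simp

theorem equivIso_nat {M M' : C} (f : M ⟶ M') (g : G) :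
    F.F.map ((A.T.act g).map f) ≫ (equivIso F M' g).hom =
      (equivIso F M g).hom ≫ (A.T.act g).map (F.F.map f) := by
  have h : F.F.map ((A.T.act g).map f ▷ 𝟙_ C) ≫ F.s M' (Homog.grp A g) =
    F.s M (Homog.grp A g) ≫ (A.T.act g).map (F.F.map f) ▷ 𝟙_ C := hs_mactL F f (Homog.grp A g)
  rw [equivIso_hom, equivIso_hom, ← F.F.map_comp_assoc, rightUnitor_inv_naturality,
    F.F.map_comp_assoc, reassoc_of% h]
  simp

/-- The isomorphisms `F (M ◁ g) ≅ F M ◁ g` are compatible with the constraint `R²`. -/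
theorem equivIso_mul (M : C) (g h : G) :
    (equivIso F ((A.T.act g).obj M) h).hom ≫ (A.T.act h).map (equivIso F M g).hom ≫
      (A.T.R2 g h).hom.app (F.F.obj M) =
        F.F.map ((A.T.R2 g h).hom.app M) ≫ (equivIso F M (g * h)).hom := by
  have h₁ := hs_assoc F M (Homog.grp A g) (Homog.grp A h)
  have h₂ := hs_mactR F M (grpMul A g h)
  have h₃ := congrArg (fun t => t ≫ A.mactR (F.F.obj M) (grpMul A g h)) h₁
  simp only [Category.assoc, mactAssoc_grp] at h₃
  rw [← h₂, ← F.F.map_comp_assoc, mactAssoc_grp] at h₃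
  have h₄ : F.F.map ((A.T.act h).map (ρ_ ((A.T.act g).obj M)).inv ▷ 𝟙_ C) ≫
      F.s (A.mact M (Homog.grp A g)) (Homog.grp A h) = F.s _ (Homog.grp A h) ≫
        (A.T.act h).map (F.F.map (ρ_ ((A.T.act g).obj M)).inv) ▷ 𝟙_ C :=
    hs_mactL F (ρ_ ((A.T.act g).obj M)).inv (Homog.grp A h)
  have h₅ := congrArg (fun t => F.F.map ((A.T.act h).map (ρ_ ((A.T.act g).obj M)).inv ▷ 𝟙_ C) ≫ t) h₃
  have h₆ : F.s ((A.T.act g).obj M) (Homog.grp A h) ≫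
      ((A.T.act h).map (equivIso F M g).hom ≫ (A.T.R2 g h).hom.app (F.F.obj M)) ▷ 𝟙_ C =
      F.F.map ((A.T.R2 g h).hom.app M ▷ 𝟙_ C) ≫ F.s M (Homog.grp A (g * h)) := by
    rw [reassoc_of% h₄] at h₅
    have e : F.F.map ((A.T.act h).map (ρ_ ((A.T.act g).obj M)).inv ▷ 𝟙_ C) ≫
      F.F.map (((A.T.act h).map (ρ_ ((A.T.act g).obj M)).hom ≫ (A.T.R2 g h).hom.app M) ▷ 𝟙_ C) =
        F.F.map ((A.T.R2 g h).hom.app M ▷ 𝟙_ C) := by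
      rw [← F.F.map_comp, ← comp_whiskerRight, ← Functor.map_comp_assoc, Iso.inv_hom_id,
        CategoryTheory.Functor.map_id, Category.id_comp]
    rw [reassoc_of% e] at h₅
    rw [← h₅, equivIso_hom, mactL]
    simp only [Functor.map_comp, comp_whiskerRight, Category.assoc]
  have h₇ := congrArg (fun t => F.F.map (ρ_ _).inv ≫ t ≫ (ρ_ _).hom) h₆
  simp only [Category.assoc, rightUnitor_naturality] at h₇
  rw [← F.F.map_comp_assoc (ρ_ _).inv, ← rightUnitor_inv_naturality, F.F.map_comp_assoc] at h₇
  rw [equivIso_hom F _ (g * h), ← h₇, equivIso_hom F _ h]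
  simp only [Category.assoc]

/-- The equivariant object `F 1`, for a `B`-module functor `F`, with structure
`F 1 ◁ g ≅ F (1 ◁ g) ≅ F 1`. -/
abbrev toEquivariant : Equivariant A where
  obj := F.F.obj (𝟙_ C)
  u g := (equivIso F (𝟙_ C) g).symm ≪≫ F.F.mapIso (A.η0 g)
  u_mul g h := by
    have h₁ := equivIso_mul F (𝟙_ C) g h
    have h₂ := equivIso_nat F (A.η0 g).hom h
    have h₃ := A.η0_R2 g h
    simp only [Iso.trans_hom, Iso.symm_hom, Functor.mapIso_hom, Functor.map_comp, Category.assoc]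
    rw [← cancel_epi ((A.T.act h).map (equivIso F (𝟙_ C) g).hom),
      ← cancel_epi (equivIso F ((A.T.act g).obj (𝟙_ C)) h).hom, reassoc_of% h₁,
      Iso.hom_inv_id_assoc, ← F.F.map_comp, h₃, ← Functor.map_comp_assoc,
      Iso.hom_inv_id, CategoryTheory.Functor.map_id, Category.id_comp, ← reassoc_of% h₂]
    simp

/-- At the objects `1 ⋈ Y`, compatibility with the constraints may be checked for the restrictions
to `C`. -/
theorem commutesAt_one {F F' : ModEndo 𝕜 (Homog A) C} (e : F.F ⟶ F'.F) (M : C) {Y : C} {k : Γ}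
    (hY : A.gr.deg k Y) (h : e.app (M ⊗ Y) ≫ (resHomog F' M hY).hom =
      (resHomog F M hY).hom ≫ e.app M ▷ Y) : CommutesAt e M (Homog.one hY) := by
  change e.app (A.mact M (Homog.one hY)) ≫ F'.s M (Homog.one hY) =
    F.s M (Homog.one hY) ≫ A.mactL (e.app M) (Homog.one hY)
  rw [resHomog_hom, resHomog_hom, ← e.naturality_assoc, Category.assoc, Category.assoc] at h
  rw [← cancel_mono (A.oneAct (F'.F.obj M) Y).inv, ← cancel_epi (F.F.map (A.oneAct M Y).hom)]
  simp only [Category.assoc]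
  have h₁ : A.mactL (e.app M) (Homog.one hY) ≫ (A.oneAct (F'.F.obj M) Y).inv =
      (A.oneAct (F.F.obj M) Y).inv ≫ e.app M ▷ Y := by
    rw [Iso.eq_inv_comp, ← reassoc_of% (oneAct_nat_left (e.app M) hY), Iso.hom_inv_id,
      Category.comp_id]
  rw [h₁]
  exact h

variable [MonoidalLinear 𝕜 C]

theorem resHomog_functorSHomog (X : Equivariant A) (N : C) {Y : C} {k : Γ} (hY : A.gr.deg k Y) :
    (resHomog ((Equivariant.functorSHomog A).obj X) N hY).hom = (α_ X.obj N Y).inv :=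
  resHomog_of_sIso X N hY

/-- The natural isomorphism `F 1 ⊗ M ≅ F M`, for a `B`-module functor `F`. -/
def unitTensorIso : tensorLeft (F.F.obj (𝟙_ C)) ≅ F.F :=
  NatIso.ofComponents (fun M => evalIso ((restrict A).obj F) M)
    (fun f => evalIso_nat_right ((restrict A).obj F) f)

/-- The transformation `F 1 ⊗ - ⟶ F` of functors between which the constraints are to be
compared. -/
abbrev unitTensorHom : ((Equivariant.functorSHomog A).obj (toEquivariant F)).F ⟶ F.F :=
  (unitTensorIso F).hom

/-- On `C ⊆ B`, compatibility holds for every module functor over the regular module category. -/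
theorem unitTensorHom_one (M : C) {Y : C} {k : Γ} (hY : A.gr.deg k Y) :
    CommutesAt (unitTensorHom F) M (Homog.one hY) := by
  refine commutesAt_one (F := (Equivariant.functorSHomog A).obj (toEquivariant F)) (F' := F) _ M hY ?_
  have h := evalIso_tensor ((restrict A).obj F) M Y
  rw [resHomog_functorSHomog, ← res_homog F M hY]
  exact h

/-- At the objects `1` and `g ⋈ 1`, compatibility holds by the choice of the equivariant structure of
`F 1`. -/
theorem unitTensorHom_grp (g : G) : CommutesAt (unitTensorHom F) (𝟙_ C) (Homog.grp A g) := by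
  let Z := F.F.obj (𝟙_ C)
  let Q := (A.T.act g).obj (𝟙_ C)
  -- Both sides come from the same morphism `Z ⊗ 1 ◁ g ⟶ Z ◁ g`.
  let a : Z ⊗ Q ⟶ (A.T.act g).obj Z :=
    Z ◁ (A.η0 g).hom ≫ (ρ_ Z).hom ≫ F.F.map (A.η0 g).inv ≫ (equivIso F (𝟙_ C) g).hom
  obtain ⟨x, hx⟩ : ∃ x : Z ⊗ Q ⊗ 𝟙_ C ⟶ F.F.obj (Q ⊗ 𝟙_ C),
    (evalIso ((restrict A).obj F) (Q ⊗ 𝟙_ C)).hom = x := ⟨_, rfl⟩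
  have h₁ : (evalIso ((restrict A).obj F) (𝟙_ C)).hom = (ρ_ Z).hom :=
    evalIso_unit ((restrict A).obj F)
  have h₂ := evalIso_nat_right ((restrict A).obj F) ((ρ_ Q).hom ≫ (A.η0 g).hom)
  rw [h₁, hx] at h₂
  have h₃ : Z ◁ ((ρ_ Q).hom ≫ (A.η0 g).hom) ≫ (ρ_ Z).hom =
    x ≫ F.F.map ((ρ_ Q).hom ≫ (A.η0 g).hom) := h₂
  have h₄ : ((toEquivariant F).tau g (𝟙_ C)).inv = a ≫ (A.T.act g).map (ρ_ Z).inv := by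
    refine (tau_unit_inv (toEquivariant F) g).trans ?_
    change Z ◁ (A.η0 g).hom ≫ (ρ_ Z).hom ≫ (F.F.map (A.η0 g).inv ≫ (equivIso F (𝟙_ C) g).hom) ≫
      (A.T.act g).map (ρ_ Z).inv = _
    simp only [a, Category.assoc]
  have h₅ : x ≫ F.F.map (ρ_ Q).hom ≫ (equivIso F (𝟙_ C) g).hom = Z ◁ (ρ_ Q).hom ≫ a := by
    have e : x ≫ F.F.map (ρ_ Q).hom = Z ◁ ((ρ_ Q).hom ≫ (A.η0 g).hom) ≫
        (ρ_ Z).hom ≫ F.F.map (A.η0 g).inv := by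
      rw [reassoc_of% h₃, ← F.F.map_comp]
      simp
    rw [reassoc_of% e]
    simp only [a, MonoidalCategory.whiskerLeft_comp, Category.assoc]
  have h₆ : x ≫ F.s (𝟙_ C) (Homog.grp A g) =
      ((α_ Z Q (𝟙_ C)).inv ≫ (a ≫ (A.T.act g).map (ρ_ Z).inv) ▷ 𝟙_ C) ≫
        (A.T.act g).map (ρ_ Z).hom ▷ 𝟙_ C := by
    have e₁ : ∀ {N : C} (b : Z ⊗ Q ⟶ N), (Z ◁ (ρ_ Q).hom ≫ b) ≫ (ρ_ N).inv =
        (α_ Z Q (𝟙_ C)).inv ≫ b ▷ 𝟙_ C := by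
      intro N b
      rw [Category.assoc, rightUnitor_inv_naturality]
      simp
    have e₂ : ((α_ Z Q (𝟙_ C)).inv ≫ (a ≫ (A.T.act g).map (ρ_ Z).inv) ▷ 𝟙_ C) ≫
        (A.T.act g).map (ρ_ Z).hom ▷ 𝟙_ C = (α_ Z Q (𝟙_ C)).inv ≫ a ▷ 𝟙_ C := by
      rw [Category.assoc, ← comp_whiskerRight, Category.assoc, ← Functor.map_comp,
        Iso.inv_hom_id, CategoryTheory.Functor.map_id, Category.comp_id]
    rw [s_grp, e₂, ← e₁ a, ← h₅, Category.assoc, Category.assoc]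
  refine (congrArg (fun t => t ≫ F.s (𝟙_ C) (Homog.grp A g)) hx).trans (h₆.trans ?_)
  refine congrArg₂ (fun s t => ((α_ Z Q (𝟙_ C)).inv ≫ s ▷ 𝟙_ C) ≫ (A.T.act g).map t ▷ 𝟙_ C)
    h₄.symm h₁.symm

/-- Compatibility at all objects: for `M` of degree `k`, it follows from the isomorphism
`(1 ⋈ M) ⊗ (g ⋈ X) ≅ (k ▶ g ⋈ 1) ⊗ (1 ⋈ M ◁ g ⊗ X)` in `B`. -/
theorem unitTensorHom_commutesAt (M : C) (W : Homog A) : CommutesAt (unitTensorHom F) M W := by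
  have h : ∀ {M : C} {k : Γ}, A.gr.deg k M → CommutesAt (unitTensorHom F) M W := by
    intro M k hM
    have hZ := A.gr.deg_tensor (A.deg_act W.g hM) W.deg
    have h₁ := (unitTensorHom_grp F (P.l k W.g)).tensor
      (unitTensorHom_one F (𝟙_ C ⊙ᵣ Homog.grp A (P.l k W.g)) hZ)
    let i : Homog.grp A (P.l k W.g) ⊗ Homog.one hZ ≅ Homog.one hM ⊗ W :=
      Homog.mkIso ((A.oneAct (𝟙_ C) _).symm ≪≫ λ_ _) (by
        change P.l k W.g * P.l 1 1 = 1 * P.l k W.g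
        rw [P.l_one, one_mul, mul_one])
    exact ((unitTensorHom_one F (𝟙_ C) hM).of_tensor (h₁.congr_right i)).congr_left
      ((A.oneAct (𝟙_ C) M).symm ≪≫ λ_ _)
  exact A.gr.hom_ext_incl (MatAction.actL C W ⋙ tensorLeft (F.F.obj (𝟙_ C))) fun k =>
    (h (A.gr.deg_comp M k)).precomp (A.gr.incl M k)

/-- Each `B`-module functor `F` is isomorphic to the functor `F 1 ⊗ -`. -/
def toEquivariantIso : (Equivariant.functorSHomog A).obj (toEquivariant F) ≅ F :=
  mkIso (unitTensorIso F) (unitTensorHom_commutesAt F)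

end ModEndo

variable [MonoidalLinear 𝕜 C]

instance : (functorS A).EssSurj where
  mem_essImage F := ⟨_, ⟨(ModEndo.toMat 𝕜 (Homog A) C).mapIso
    (ModEndo.toEquivariantIso ((ModEndo.ofMat 𝕜 (Homog A) C).obj F)) ≪≫ ModEndo.toMatOfMat F⟩⟩

instance : (functorS A).IsEquivalence where

end EssSurj

/-! ### Trivial objects, induced objects, and morphisms from the unit object -/

section Unit

variable {𝕜 : Type w} [Field 𝕜] [IsAlgClosed 𝕜] {C : Type u} [Category.{v} C] [Abelian C]
  [Linear 𝕜 C] [MonoidalCategory C] [MonoidalPreadditive C] [MonoidalLinear 𝕜 C]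
  [RigidCategory C] [FusionCategory 𝕜 C]

namespace Can

variable {V : Type w} [AddCommGroup V] [Module 𝕜 V] [Module.Finite 𝕜 V]

theorem ev_eq_sum (x : V) : ev C x = ∑ i, (Module.finBasis 𝕜 V).repr x i • inc C V i := by
  simp [ev, Module.Basis.constr_apply_fintype]

theorem ev_prj (x : V) (i : Fin (Module.finrank 𝕜 V)) :
    ev C x ≫ prj C V i = (Module.finBasis 𝕜 V).repr x i • 𝟙 _ := by
  rw [ev_eq_sum, Preadditive.sum_comp, Finset.sum_eq_single i]
  · rw [Linear.smul_comp, inc_prj_self]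
  · intro j _ hj
    rw [Linear.smul_comp, inc_prj_ne hj, smul_zero]
  · simp

variable (𝕜 C V) in
theorem ev_injective : Function.Injective (ev (𝕜 := 𝕜) C (V := V)) := by
  have : Simple (𝟙_ C) := FusionCategory.simple_unit 𝕜
  rw [injective_iff_map_eq_zero]
  intro x hx
  refine (Module.finBasis 𝕜 V).ext_elem fun i => ?_
  have h := ev_prj (C := C) x i
  rw [hx, zero_comp] at h
  simpa [id_nonzero] using h.symm

variable (𝕜 C V) in
theorem ev_surjective : Function.Surjective (ev (𝕜 := 𝕜) C (V := V)) := by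
  have : Simple (𝟙_ C) := FusionCategory.simple_unit 𝕜
  have : FiniteDimensional 𝕜 (𝟙_ C ⟶ 𝟙_ C) := FusionCategory.finite_hom _ _
  intro f
  choose c hc using fun i => endomorphism_simple_eq_smul_id 𝕜 (f ≫ prj C V i)
  refine ⟨∑ i, c i • Module.finBasis 𝕜 V i, ?_⟩
  have h : f = ∑ i, (f ≫ prj C V i) ≫ inc C V i := by
    simp only [Category.assoc, ← Preadditive.comp_sum, total, Category.comp_id]
  rw [h, map_sum]
  refine Finset.sum_congr rfl fun i _ => ?_
  rw [LinearMap.map_smul, ev_basis, ← hc i, Linear.smul_comp, Category.id_comp]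

variable (𝕜 C V) in
/-- Since the unit object is simple, a vector space is recovered from the trivial object that it
defines. -/
def evEquiv : V ≃ₗ[𝕜] (𝟙_ C ⟶ obj 𝕜 C V) :=
  LinearEquiv.ofBijective (ev C) ⟨ev_injective 𝕜 C V, ev_surjective 𝕜 C V⟩

/-- A family of linearly independent morphisms from the unit object defines a monomorphism: by
semisimplicity, a nonzero kernel would contain a simple object, which would have to be the
unit object. -/
theorem mono_lift {X : C} (f : V →ₗ[𝕜] (𝟙_ C ⟶ X)) (hf : Function.Injective f) :
    Mono (lift f) := by
  have : Simple (𝟙_ C) := FusionCategory.simple_unit 𝕜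
  refine Preadditive.mono_of_cancel_zero _ fun {Z} q hq => ?_
  obtain ⟨n, S, hS, ⟨e⟩⟩ := FusionCategory.semisimple 𝕜 Z
  rw [← cancel_epi e.inv, comp_zero]
  refine biproduct.hom_ext' _ _ fun i => ?_
  rw [comp_zero]
  by_contra hne
  obtain ⟨s, hs⟩ : ∃ s, biproduct.ι S i ≫ e.inv ≫ q = s := ⟨_, rfl⟩
  rw [hs] at hne
  have h₁ : s ≫ lift f = 0 := by rw [← hs]; simp [hq]
  have h₂ : ∃ j, s ≫ prj C V j ≠ 0 := by
    by_contra! h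
    refine hne ?_
    rw [← Category.comp_id s, ← total, Preadditive.comp_sum]
    exact Finset.sum_eq_zero fun j _ => by rw [← Category.assoc, h j, zero_comp]
  obtain ⟨j, hj⟩ := h₂
  have := hS i
  have : IsIso (s ≫ prj C V j) := isIso_of_hom_simple hj
  obtain ⟨x, hx⟩ := ev_surjective 𝕜 C V (inv (s ≫ prj C V j) ≫ s)
  have h₃ : f x = 0 := by rw [← ev_lift f x, hx, Category.assoc, h₁, comp_zero]
  rw [hf (h₃.trans (map_zero f).symm), map_zero] at hx
  refine hne ?_
  rw [← cancel_epi (inv (s ≫ prj C V j)), ← hx, comp_zero]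

/-- Morphisms from a trivial object to `X` factor through `⊕ 1 ⟶ X`, if all morphisms from the unit
object do. -/
theorem exists_factor {X : C} (f : V →ₗ[𝕜] (𝟙_ C ⟶ X)) (hf : Function.Surjective f) {Y : C}
    (hY : IsTrivial Y) (j : Y ⟶ X) : ∃ h : Y ⟶ obj 𝕜 C V, h ≫ lift f = j := by
  obtain ⟨n, ⟨e⟩⟩ := hY
  choose x hx using fun i : Fin n => hf (biproduct.ι (fun _ : Fin n => 𝟙_ C) i ≫ e.inv ≫ j)
  refine ⟨e.hom ≫ biproduct.desc fun i => ev C (x i), ?_⟩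
  rw [Category.assoc, ← Iso.eq_inv_comp]
  refine biproduct.hom_ext' _ _ fun i => ?_
  rw [biproduct.ι_desc_assoc, ev_lift, hx]

end Can

theorem isTrivial_can (V : Type w) [AddCommGroup V] [Module 𝕜 V] :
    IsTrivial (Can.obj 𝕜 C V) := ⟨_, ⟨Iso.refl _⟩⟩

theorem IsTrivial.of_iso {D : Type*} [Category D] [Preadditive D] [HasFiniteBiproducts D]
    [MonoidalCategory D] {X Y : D} (e : X ≅ Y) (h : IsTrivial Y) : IsTrivial X := by
  obtain ⟨n, ⟨i⟩⟩ := h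
  exact ⟨n, ⟨e ≪≫ i⟩⟩

end Unit

section Induction

open CrossedAction

variable {𝕜 : Type w} [Field 𝕜] {G Γ : Type*} [Group G] [Finite G] [Group Γ] [Fintype Γ]
  {P : MatchedPair G Γ} {C : Type u} [Category.{v} C] [Preadditive C] [HasFiniteBiproducts C]
  [Linear 𝕜 C] [MonoidalCategory C]

/-- Two morphisms out of `F (⨁ f)` agree if they agree on each `F (f j)`. -/
theorem hom_ext_map_ι {D : Type*} [Category D] [Preadditive D] {E : Type*} [Category E]
    [Preadditive E] (F : D ⥤ E) [F.Additive] {J : Type*} [Finite J] (f : J → D) [HasBiproduct f]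
    {Z : E} {q q' : F.obj (⨁ f) ⟶ Z}
    (h : ∀ j, F.map (biproduct.ι f j) ≫ q = F.map (biproduct.ι f j) ≫ q') : q = q' := by
  have := Fintype.ofFinite J
  have e : ∀ q : F.obj (⨁ f) ⟶ Z,
      q = ∑ j, F.map (biproduct.π f j) ≫ F.map (biproduct.ι f j) ≫ q := by
    intro q
    simp only [← Category.assoc, ← F.map_comp, ← Preadditive.sum_comp, ← F.map_sum,
      biproduct_total]
    simp
  rw [e q, e q']
  exact Finset.sum_congr rfl fun j _ => by rw [h]

theorem map_ι_sum_map_π {D : Type*} [Category D] [Preadditive D] {E : Type*} [Category E]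
    [Preadditive E] (F : D ⥤ E) [F.Additive] {J K : Type*} [Fintype K] (f : J → D)
    [HasBiproduct f] (σ : K ≃ J) {Z : E} (q : ∀ k, F.obj (f (σ k)) ⟶ Z) (k : K) :
    F.map (biproduct.ι f (σ k)) ≫ ∑ i, F.map (biproduct.π f (σ i)) ≫ q i = q k := by
  rw [Preadditive.comp_sum, Finset.sum_eq_single k]
  · rw [← Functor.map_comp_assoc, biproduct.ι_π_self, CategoryTheory.Functor.map_id,
      Category.id_comp]
  · intro i _ hi
    rw [← Functor.map_comp_assoc, biproduct.ι_π_ne _ (σ.injective.ne hi.symm), Functor.map_zero,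
      zero_comp]
  · simp

/-- The isomorphism `(⊕ Y ◁ a) ◁ g ≅ ⊕ Y ◁ a`, which maps the summand `(Y ◁ a) ◁ g` to
`Y ◁ ag`. -/
def inducedIso (A : CrossedAction 𝕜 P C) (Y : C) (g : G) :
    (A.T.act g).obj (⨁ fun a : G => (A.T.act a).obj Y) ≅ ⨁ fun a : G => (A.T.act a).obj Y :=
  letI := Fintype.ofFinite G
  have h : ∀ a, (A.T.act g).map (biproduct.ι (fun a : G => (A.T.act a).obj Y) a) ≫
      (∑ a, (A.T.act g).map (biproduct.π (fun a : G => (A.T.act a).obj Y) a) ≫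
        (A.T.R2 a g).hom.app Y ≫ biproduct.ι (fun a : G => (A.T.act a).obj Y) (a * g)) =
      (A.T.R2 a g).hom.app Y ≫ biproduct.ι (fun a : G => (A.T.act a).obj Y) (a * g) :=
    map_ι_sum_map_π (A.T.act g) (fun a : G => (A.T.act a).obj Y) (Equiv.refl G)
      (fun a => (A.T.R2 a g).hom.app Y ≫ biproduct.ι (fun a : G => (A.T.act a).obj Y) (a * g))
  have h' : ∀ a, biproduct.ι (fun a : G => (A.T.act a).obj Y) (a * g) ≫
      (∑ a, biproduct.π (fun a : G => (A.T.act a).obj Y) (a * g) ≫ (A.T.R2 a g).inv.app Y ≫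
        (A.T.act g).map (biproduct.ι (fun a : G => (A.T.act a).obj Y) a)) =
      (A.T.R2 a g).inv.app Y ≫
        (A.T.act g).map (biproduct.ι (fun a : G => (A.T.act a).obj Y) a) := fun a =>
    map_ι_sum_map_π (𝟭 C) (fun a : G => (A.T.act a).obj Y) (Equiv.mulRight g)
      (fun a => (A.T.R2 a g).inv.app Y ≫
      (A.T.act g).map (biproduct.ι (fun a : G => (A.T.act a).obj Y) a)) a
  { hom := ∑ a, (A.T.act g).map (biproduct.π (fun a : G => (A.T.act a).obj Y) a) ≫
      (A.T.R2 a g).hom.app Y ≫ biproduct.ι (fun a : G => (A.T.act a).obj Y) (a * g)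
    inv := ∑ a, biproduct.π (fun a : G => (A.T.act a).obj Y) (a * g) ≫ (A.T.R2 a g).inv.app Y ≫
      (A.T.act g).map (biproduct.ι (fun a : G => (A.T.act a).obj Y) a)
    hom_inv_id := hom_ext_map_ι (A.T.act g) _ fun a => by
      rw [reassoc_of% (h a), h', Iso.hom_inv_id_app_assoc, Category.comp_id]
    inv_hom_id := biproduct.hom_ext' _ _ fun b => by
      obtain ⟨a, rfl⟩ := (Equiv.mulRight g).surjective b
      change biproduct.ι (fun a : G => (A.T.act a).obj Y) (a * g) ≫ _ =
        biproduct.ι (fun a : G => (A.T.act a).obj Y) (a * g) ≫ _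
      rw [reassoc_of% (h' a), h, Iso.inv_hom_id_app_assoc, Category.comp_id] }

theorem map_ι_inducedIso (A : CrossedAction 𝕜 P C) (Y : C) (g a : G) :
    (A.T.act g).map (biproduct.ι (fun a : G => (A.T.act a).obj Y) a) ≫ (inducedIso A Y g).hom =
      (A.T.R2 a g).hom.app Y ≫ biproduct.ι (fun a : G => (A.T.act a).obj Y) (a * g) := by
  let := Fintype.ofFinite G
  exact map_ι_sum_map_π (A.T.act g) (fun a : G => (A.T.act a).obj Y) (Equiv.refl G)
    (fun a => (A.T.R2 a g).hom.app Y ≫ biproduct.ι (fun a : G => (A.T.act a).obj Y) (a * g)) a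

/-- The equivariant object `⊕ Y ◁ a`, induced by an object `Y` of `C`, the sum being over `a ∈ G`. -/
def induced (A : CrossedAction 𝕜 P C) (Y : C) : Equivariant A where
  obj := ⨁ fun a : G => (A.T.act a).obj Y
  u := inducedIso A Y
  u_mul g h := hom_ext_map_ι (A.T.act g ⋙ A.T.act h) _ fun a => by
    have h₁ := (A.T.R2 g h).hom.naturality (biproduct.ι (fun a : G => (A.T.act a).obj Y) a)
    rw [← Category.assoc, h₁, Category.assoc, map_ι_inducedIso, Functor.comp_map,
      ← Functor.map_comp_assoc, map_ι_inducedIso, Functor.map_comp, Category.assoc, map_ι_inducedIso,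
      reassoc_of% (A.T.assoc a g h Y)]
    refine congrArg (fun t => _ ≫ _ ≫ t) ?_
    exact (biproduct.eqToHom_comp_ι (fun a : G => (A.T.act a).obj Y) (mul_assoc a g h).symm).symm

end Induction

section Invariants

open CrossedAction

variable {𝕜 : Type w} [Field 𝕜] {G Γ : Type*} [Group G] [Group Γ] [Fintype Γ]
  {P : MatchedPair G Γ} {C : Type u} [Category.{v} C] [Preadditive C] [HasFiniteBiproducts C]
  [Linear 𝕜 C] [MonoidalCategory C] [MonoidalPreadditive C] {A : CrossedAction 𝕜 P C}

namespace Equivariant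

/-- The right action of `G` on the space of morphisms `1 ⟶ X` to an equivariant object. -/
def homAct (X : Equivariant A) (g : G) : (𝟙_ C ⟶ X.obj) →ₗ[𝕜] (𝟙_ C ⟶ X.obj) where
  toFun f := (A.η0 g).inv ≫ (A.T.act g).map f ≫ (X.u g).hom
  map_add' f f' := by simp [Functor.map_add]
  map_smul' a f := by simp [Functor.map_smul]

theorem homAct_apply (X : Equivariant A) (g : G) (f : 𝟙_ C ⟶ X.obj) :
    X.homAct g f = (A.η0 g).inv ≫ (A.T.act g).map f ≫ (X.u g).hom := rfl

theorem homAct_one (X : Equivariant A) : X.homAct 1 = LinearMap.id := by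
  ext f
  have h₁ := A.T.oneIso_nat f
  have h₂ : (A.T.oneIso (𝟙_ C)).hom ≫ (A.η0 1).hom = 𝟙 _ := A.η0_R0
  rw [homAct_apply, LinearMap.id_apply, Iso.inv_comp_eq, ← cancel_epi (A.T.oneIso (𝟙_ C)).hom,
    ← Category.assoc, ← h₁, Category.assoc, oneIso_u, reassoc_of% h₂, Category.comp_id]

theorem homAct_mul (X : Equivariant A) (g h : G) :
    X.homAct (g * h) = X.homAct h ∘ₗ X.homAct g := by
  ext f
  have h₁ := (A.T.R2 g h).hom.naturality f
  have h₂ := A.η0_R2 g h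
  rw [Functor.comp_map] at h₁
  rw [LinearMap.comp_apply, homAct_apply, homAct_apply, homAct_apply, Iso.inv_comp_eq,
    ← cancel_epi ((A.T.R2 g h).hom.app (𝟙_ C)), reassoc_of% h₂, Iso.hom_inv_id_assoc,
    Functor.map_comp, Functor.map_comp, Category.assoc, Category.assoc, ← Functor.map_comp_assoc,
    Iso.hom_inv_id, CategoryTheory.Functor.map_id, Category.id_comp, ← reassoc_of% h₁, X.u_mul]

/-- The left representation of `G` on the space of morphisms `1 ⟶ X` to an equivariant object. -/
def homRep (X : Equivariant A) : Representation 𝕜 G (𝟙_ C ⟶ X.obj) where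
  toFun g := X.homAct g⁻¹
  map_one' := by rw [inv_one, homAct_one]; rfl
  map_mul' g h := by rw [mul_inv_rev, homAct_mul]; rfl

variable (X : Equivariant A) [Module.Finite 𝕜 (𝟙_ C ⟶ X.obj)]

/-- The isomorphism of the space of morphisms `1 ⟶ X` with a coordinate space, which lies in the
universe of the field. -/
def homCoord : (Fin (Module.finrank 𝕜 (𝟙_ C ⟶ X.obj)) → 𝕜) ≃ₗ[𝕜] (𝟙_ C ⟶ X.obj) :=
  (Module.finBasis 𝕜 (𝟙_ C ⟶ X.obj)).equivFun.symm

/-- The representation of `G` on the space of morphisms `1 ⟶ X`, as an object of `Rep G`. -/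
def invariants : FDRep 𝕜 G :=
  FDRep.of (V := Fin (Module.finrank 𝕜 (𝟙_ C ⟶ X.obj)) → 𝕜)
    ((homCoord X).symm.conjRingEquiv.toRingHom.toMonoidHom.comp X.homRep)

end Equivariant

end Invariants

/-! ### The extension given by the equivariant objects -/

section Extension

open CrossedAction

variable {𝕜 : Type w} [Field 𝕜] {G : Type u₁} [Group G] {Γ : Type u₂} [Group Γ] [Fintype Γ]
  {P : MatchedPair G Γ}

section Preadditive

variable {C : Type u} [Category.{v} C] [Preadditive C] [HasFiniteBiproducts C]
  [Linear 𝕜 C] [MonoidalCategory C] [MonoidalPreadditive C]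

namespace Equivariant

variable {A : CrossedAction 𝕜 P C} (X : Equivariant A) [Module.Finite 𝕜 (𝟙_ C ⟶ X.obj)]

/-- The vectors of the representation `Hom (1, X)`, regarded as morphisms `1 ⟶ X`. -/
def homEval : (invariants X).V →ₗ[𝕜] (𝟙_ C ⟶ X.obj) := (homCoord X).toLinearMap

theorem homEval_injective : Function.Injective (homEval X) := (homCoord X).injective

theorem homEval_surjective : Function.Surjective (homEval X) := (homCoord X).surjective

theorem homEval_ρ (g : G) (x : (invariants X).V) :
    homEval X ((invariants X).ρ g x) = X.homAct g⁻¹ (homEval X x) :=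
  (homCoord X).apply_symm_apply _

variable [MonoidalLinear 𝕜 C]

/-- The morphism `ι₁ (Hom (1, X)) ⟶ X`, which is given by `f` on the copy of the unit object that
belongs to a basis vector `f : 1 ⟶ X`. -/
def trivialPart : (iota₁ A).obj (invariants X) ⟶ X where
  val := Can.lift (homEval X)
  comm g := Can.ext_ev (A.T.act g) fun x => by
    have h : (A.T.act g).map (Can.ev C x) ≫ ((iotaObj A (invariants X)).u g).hom ≫
        Can.lift (homEval X) = (A.T.act g).map (Can.ev C x) ≫
          (A.T.act g).map (Can.lift (homEval X)) ≫ (X.u g).hom := by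
      rw [reassoc_of% (ev_u A (invariants X) g x), Can.ev_lift, homEval_ρ, inv_inv, homAct_apply,
        Iso.hom_inv_id_assoc, ← Functor.map_comp_assoc, Can.ev_lift]
    exact h

end Equivariant

variable [MonoidalLinear 𝕜 C] (A : CrossedAction 𝕜 P C)

instance : (iota₁ A).Additive where
  map_add {V W f f'} := Equivariant.hom_ext (Can.map_add f.hom.hom.hom f'.hom.hom.hom)

instance : (iota₁ A).Linear 𝕜 where
  map_smul {V W} f a := Equivariant.hom_ext (Can.map_smul a f.hom.hom.hom)

/-- On underlying objects, `ι₁ V` is `⊕ 1` by definition. -/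
def iotaForgetIso : iota₁ A ⋙ Equivariant.forget A ≅ fibreFunctor 𝕜 G ⋙ can 𝕜 C :=
  NatIso.ofComponents (fun V => Iso.refl _)
    (fun f => (Category.comp_id _).trans (Category.id_comp _).symm)

instance : NatTrans.IsMonoidal (iotaForgetIso A).hom where
  unit := by
    change (𝟙 _ ≫ Can.ev C (1 : 𝕜)) ≫ 𝟙 _ = Can.ev C (1 : 𝕜) ≫ Can.map C LinearMap.id
    rw [Can.map_id, Category.id_comp]
  tensor V W := by
    change (𝟙 _ ≫ Can.muHom C V.V W.V) ≫ 𝟙 _ = (𝟙 _ ⊗ₘ 𝟙 _) ≫ Can.muHom C V.V W.V ≫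
      Can.map C LinearMap.id
    have h : ∀ {X Y Z : C} (m : X ⊗ Y ⟶ Z) (r : Z ⟶ Z), r = 𝟙 Z →
        (𝟙 _ ≫ m) ≫ 𝟙 _ = (𝟙 X ⊗ₘ 𝟙 Y) ≫ m ≫ r := by
      rintro X Y Z m r rfl
      simp
    exact h _ _ Can.map_id

end Preadditive

variable [IsAlgClosed 𝕜] {C : Type u} [Category.{v} C] [Abelian C] [Linear 𝕜 C]
  [MonoidalCategory C] [MonoidalPreadditive C] [MonoidalLinear 𝕜 C] [RigidCategory C]
  [FusionCategory 𝕜 C] (A : CrossedAction 𝕜 P C)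

instance : (iota₁ A).Faithful where
  map_injective {V W f f'} h := by
    have h₁ : Can.map C f.hom.hom.hom = Can.map C f'.hom.hom.hom :=
      congrArg Equivariant.Hom.val h
    apply Action.Hom.ext
    refine FGModuleCat.hom_ext (LinearMap.ext fun x => Can.ev_injective 𝕜 C W.V ?_)
    exact (Can.ev_map f.hom.hom.hom x).symm.trans
      ((congrArg (fun t => Can.ev C x ≫ t) h₁).trans (Can.ev_map f'.hom.hom.hom x))

/-- By Schur's lemma, a morphism `⊕ 1 ⟶ ⊕ 1` is the matrix of a linear map, and it is equivariant if
and only if the linear map commutes with the action of `G`. -/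
instance : (iota₁ A).Full where
  map_surjective {V W} f := by
    obtain ⟨t, ht⟩ : ∃ t : Can.obj 𝕜 C V.V ⟶ Can.obj 𝕜 C W.V, f.val = t := ⟨_, rfl⟩
    have hf : ∀ g, ((iotaObj A V).u g).hom ≫ t = (A.T.act g).map t ≫ ((iotaObj A W).u g).hom :=
      fun g => ht ▸ f.comm g
    let φ : V.V →ₗ[𝕜] W.V := (Can.evEquiv 𝕜 C W.V).symm.toLinearMap ∘ₗ
      Linear.rightComp 𝕜 (𝟙_ C) t ∘ₗ Can.ev C
    have hφ : ∀ x : V.V, Can.ev C (φ x) = Can.ev C x ≫ t := fun x =>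
      (Can.evEquiv 𝕜 C W.V).apply_symm_apply _
    have hρ : ∀ (g : G) (x : V.V), φ (V.ρ g x) = W.ρ g (φ x) := by
      intro g x
      refine Can.ev_injective 𝕜 C W.V ?_
      rw [hφ, ← cancel_epi (A.η0 g⁻¹).hom]
      have h₁ := ev_u A V g⁻¹ x
      have h₂ := ev_u A W g⁻¹ (φ x)
      rw [inv_inv] at h₁ h₂
      rw [← h₂, hφ, ← reassoc_of% h₁, hf, ← Functor.map_comp_assoc]

    refine ⟨⟨FGModuleCat.ofHom φ, fun g => FGModuleCat.hom_ext (LinearMap.ext fun x => hρ g x)⟩,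
      Equivariant.hom_ext (Can.hom_ext_ev fun x => ?_)⟩
    exact (Can.ev_map φ x).trans ((hφ x).trans (congrArg (fun t => Can.ev C x ≫ t) ht.symm))

/-- The sequence `Rep G ⟶ C^(G,Γ) ⟶ C` is an extension. -/
theorem isExtension_forget [Finite G] :
    IsExtension 𝕜 (fibreFunctor 𝕜 G) (iota₁ A) (Equivariant.forget A) where
  additive_ι := inferInstance
  linear_ι := inferInstance
  additive_F := inferInstance
  linear_F := inferInstance
  full := inferInstance
  faithful := inferInstance
  surjective Y := by
    refine ⟨induced A Y, Y, (A.T.oneIso Y).hom ≫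
      biproduct.ι (fun a : G => (A.T.act a).obj Y) 1, 𝟙 Y, ?_, inferInstance⟩
    have : Mono (biproduct.ι (fun a : G => (A.T.act a).obj Y) 1) :=
      mono_of_mono_fac (biproduct.ι_π_self (fun a : G => (A.T.act a).obj Y) 1)
    exact mono_comp (A.T.oneIso Y).hom (biproduct.ι (fun a : G => (A.T.act a).obj Y) 1)
  kernel X := by
    constructor
    · intro hX
      have : Module.Finite 𝕜 (𝟙_ C ⟶ X.obj) := FusionCategory.finite_hom _ _
      have : Mono (Can.lift X.homEval) :=
        Can.mono_lift _ X.homEval_injective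
      obtain ⟨h, hh⟩ : ∃ h : X.obj ⟶ Can.obj 𝕜 C X.invariants.V,
          h ≫ Can.lift X.homEval = 𝟙 X.obj :=
        Can.exists_factor X.homEval X.homEval_surjective hX (𝟙 X.obj)
      have hh' : Can.lift X.homEval ≫ h = 𝟙 _ := by
        rw [← cancel_mono (Can.lift X.homEval), Category.assoc, hh, Category.comp_id,
          Category.id_comp]
      exact ⟨X.invariants, ⟨Equivariant.mkIso
        ⟨Can.lift X.homEval, h, hh', hh⟩ X.trivialPart.comm⟩⟩
    · rintro ⟨V, ⟨e⟩⟩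
      exact IsTrivial.of_iso ((Equivariant.forget A).mapIso e.symm) (isTrivial_can V.V)
  fibre := ⟨iotaForgetIso A, inferInstance⟩
  normal X := by
    have : Module.Finite 𝕜 (𝟙_ C ⟶ X.obj) := FusionCategory.finite_hom _ _
    have h : Mono ((Equivariant.forget A).map X.trivialPart) :=
      Can.mono_lift X.homEval X.homEval_injective
    exact ⟨_, X.trivialPart, (Equivariant.forget A).mono_of_mono_map h, h,
      isTrivial_can X.invariants.V,
      fun Y j _ hY => Can.exists_factor X.homEval X.homEval_surjective hY j⟩

end Extension

/-! ### Transport of extensions -/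

section Transport

/-- An extension may be transported along a tensor equivalence of the middle categories. -/
theorem IsExtension.transport {𝕜 : Type w} [Field 𝕜]
    {B : Type*} [Category B] [Preadditive B] [Linear 𝕜 B] [MonoidalCategory B]
    {D : Type*} [Category D] [Preadditive D] [Linear 𝕜 D] [MonoidalCategory D]
    {D' : Type*} [Category D'] [Preadditive D'] [Linear 𝕜 D'] [MonoidalCategory D']
    {C : Type*} [Category C] [Preadditive C] [HasFiniteBiproducts C] [Linear 𝕜 C]
    [MonoidalCategory C] [MonoidalPreadditive C] [MonoidalLinear 𝕜 C]
    {ω : B ⥤ FGModuleCat.{w} 𝕜} [ω.Monoidal] {ι : B ⥤ D} [ι.Monoidal] {F : D ⥤ C} [F.Monoidal]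
    (h : IsExtension 𝕜 ω ι F) {T : D ⥤ D'} [T.Monoidal] (hT : IsTensorEquivalence 𝕜 T)
    {F' : D' ⥤ C} [F'.Monoidal] (hF : F'.Additive) (hF' : F'.Linear 𝕜)
    (e : T ⋙ F' ≅ F) [NatTrans.IsMonoidal e.hom] : IsExtension 𝕜 ω (ι ⋙ T) F' := by
  have := h.additive_ι
  have := h.linear_ι
  have := h.full
  have := h.faithful
  have := hT.additive
  have := hT.linear
  have := hT.isEquivalence
  obtain ⟨f, hf⟩ := h.fibre
  refine
    { additive_ι := inferInstance
      linear_ι := inferInstance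
      additive_F := hF
      linear_F := hF'
      full := inferInstance
      faithful := inferInstance
      surjective := fun Y => ?_
      kernel := fun X => ?_
      fibre := ?_
      normal := fun X => ?_ }
  · obtain ⟨X, Z, i, p, hi, hp⟩ := h.surjective Y
    exact ⟨T.obj X, Z, i ≫ e.inv.app X, p, mono_comp _ _, hp⟩
  · have t : X ≅ T.obj (T.objPreimage X) := (T.objObjPreimageIso X).symm
    have h₁ : IsTrivial (F'.obj X) ↔ IsTrivial (F.obj (T.objPreimage X)) :=
      ⟨IsTrivial.of_iso (F'.mapIso t ≪≫ e.app _).symm, IsTrivial.of_iso (F'.mapIso t ≪≫ e.app _)⟩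
    rw [h₁, h.kernel]
    constructor
    · rintro ⟨V, ⟨i⟩⟩
      exact ⟨V, ⟨T.mapIso i ≪≫ t.symm⟩⟩
    · rintro ⟨V, ⟨i⟩⟩
      exact ⟨V, ⟨T.preimageIso (i ≪≫ t)⟩⟩
  · refine ⟨Functor.associator ι T F' ≪≫ Functor.isoWhiskerLeft ι e ≪≫ f, ?_⟩
    simp only [Iso.trans_hom, Functor.isoWhiskerLeft_hom]
    infer_instance
  · have t : T.obj (T.objPreimage X) ≅ X := T.objObjPreimageIso X
    obtain ⟨X₀, i, hi, hFi, hX₀, hmax⟩ := h.normal (T.objPreimage X)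
    refine ⟨T.obj X₀, T.map i ≫ t.hom, mono_comp _ _, ?_, IsTrivial.of_iso (e.app X₀) hX₀,
      fun Y j hj hY => ?_⟩
    · have h₁ : F'.map (T.map i ≫ t.hom) = e.hom.app X₀ ≫ F.map i ≫
          e.inv.app (T.objPreimage X) ≫ F'.map t.hom := by
        rw [← e.hom.naturality_assoc]
        simp
      rw [h₁]
      infer_instance
    · obtain ⟨q, hq⟩ := hmax Y (j ≫ F'.map t.inv ≫ e.hom.app _) (mono_comp _ _) hY
      refine ⟨q ≫ e.inv.app X₀, ?_⟩
      have h₁ := e.inv.naturality i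
      rw [F'.map_comp, Category.assoc]
      rw [Functor.comp_map] at h₁
      rw [← reassoc_of% h₁, reassoc_of% hq]
      simp [← F'.map_comp]

end Transport

theorem isTensorEquivalence_id (𝕜 : Type w) [Field 𝕜] (D : Type*) [Category D]
    [Preadditive D] [Linear 𝕜 D] [MonoidalCategory D] : IsTensorEquivalence 𝕜 (𝟭 D) :=
  ⟨inferInstance, inferInstance, inferInstance⟩

section FunctorS

open CrossedAction

variable {𝕜 : Type w} [Field 𝕜] {G : Type u₁} [Group G] {Γ : Type u₂} [Group Γ] [Fintype Γ]
  {P : MatchedPair G Γ} {C : Type u} [Category.{v} C] [Preadditive C] [HasFiniteBiproducts C]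
  [Linear 𝕜 C] [MonoidalCategory C] [MonoidalPreadditive C] [MonoidalLinear 𝕜 C]
  (A : CrossedAction 𝕜 P C)

theorem isTensorEquivalence_functorS : IsTensorEquivalence 𝕜 (functorS A) :=
  ⟨inferInstance, inferInstance, inferInstance⟩

/-- The left square commutes strictly, since `ι₂` is by definition the composite of `ι₁` and `S`. -/
theorem isExtensionEquivalence_functorS : IsExtensionEquivalence 𝕜
    (fibreFunctor 𝕜 G) (iota₁ A) (Equivariant.forget A)
    (fibreFunctor 𝕜 G) (iota₂ A) (dualToBase A)
    (𝟭 (FDRep 𝕜 G)) (functorS A) (𝟭 C) where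
  tensorEquivalence_left := isTensorEquivalence_id 𝕜 _
  tensorEquivalence_middle := isTensorEquivalence_functorS A
  tensorEquivalence_right := isTensorEquivalence_id 𝕜 C
  left_square := by
    -- The target `𝟭 ⋙ ι₂` is read as `𝟭 ⋙ (ι₁ ⋙ S)`.
    refine ⟨(Functor.leftUnitor (iota₁ A ⋙ functorS A)).symm, ?_⟩
    exact inferInstanceAs (NatTrans.IsMonoidal (Functor.leftUnitor (iota₁ A ⋙ functorS A)).inv)
  right_square := by
    refine ⟨functorSForgetIso A ≪≫ (Functor.rightUnitor _).symm, ?_⟩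
    simp only [Iso.trans_hom, Iso.symm_hom]
    infer_instance
  fibre := by
    refine ⟨(Functor.leftUnitor _).symm, ?_⟩
    simp only [Iso.symm_hom]
    infer_instance

end FunctorS

end FusionDual

end

theorem lemma3p6 {𝕜 : Type w} [Field 𝕜] [IsAlgClosed 𝕜] [CharZero 𝕜]
    {G : Type u₁} [Group G] [Finite G] {Γ : Type u₂} [Group Γ] [Fintype Γ]
    {P : MatchedPair G Γ}
    {C : Type u} [Category.{v} C] [Abelian C] [Linear 𝕜 C] [MonoidalCategory C]
    [MonoidalPreadditive C] [MonoidalLinear 𝕜 C] [RigidCategory C] [FusionCategory 𝕜 C]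
    (A : CrossedAction 𝕜 P C) :
    IsExtension 𝕜 (fibreFunctor 𝕜 G) (iota₁ A) (Equivariant.forget A) ∧
    IsExtension 𝕜 (fibreFunctor 𝕜 G) (iota₂ A) (dualToBase A) ∧
    IsExtensionEquivalence 𝕜
      (fibreFunctor 𝕜 G) (iota₁ A) (Equivariant.forget A)
      (fibreFunctor 𝕜 G) (iota₂ A) (dualToBase A)
      (𝟭 (FDRep 𝕜 G)) (functorS A) (𝟭 C) ∧
    ∃ e : functorS A ⋙ dualToBase A ≅ Equivariant.forget A,
      NatTrans.IsMonoidal e.hom ∧ ∀ X : Equivariant A, e.hom.app X = (ρ_ X.obj).hom :=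
  ⟨isExtension_forget A,
    (isExtension_forget A).transport (isTensorEquivalence_functorS A) inferInstance inferInstance
      (functorSForgetIso A),
    isExtensionEquivalence_functorS A, functorSForgetIso A, inferInstance, fun _ => rfl⟩
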